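/- Throughout, $\log$ is the natural logarithm, the length of a path is its number of edges, and a red-blue coloured graph is a simple graph each of whose edges is coloured red or blue. A coloured subgraph $G_0$ of a graph $G$ is regarded as a set of coloured edges (it has no isolated vertices); $G\setminus G_0$ is the graph of the edges of $G$ not in $G_0$. A set of vertices touches an edge if exactly one end point of the edge lies in it. Let $G$ be a cubic graph of order $n$ (not necessarily connected) and let $C$ be a real number. A red-blue coloured subgraph $G_0\subseteq G$ is called $C$-extendable if: (E1) every vertex of degree at least $2$ in $G_0$ is incident with a red and with a blue edge of $G_0$; (E2) every connected component of $G_0$ has at most $C\sqrt{\log n}$ vertices, and any two distinct components are at distance at least $10$ in $G$; (E3) every cycle in $G$ which does not contain both a red and a blue edge from the same component of $G_0$ has two consecutive edges outside $G_0$; (E4) $G\setminus G_0$ has an edge-decomposition into graphs $H_1,H_2,H_3$, with $H_2$ and $H_3$ vertex-disjoint, such that $H_1$ is obtained from a finite simple graph all of whose vertices have degree $1$ or $3$ by subdividing each edge at most $C\sqrt{\log n}$ times; $H_2$ is a vertex-disjoint union of even cycles of length at most $C\sqrt{\log n}$, each of which touches at most two edges of $H_1$; and $H_3$ is a vertex-disjoint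 union of graphs obtained from the two-vertex multigraph with three parallel edges by subdividing each edge at most $C\sqrt{\log n}$ times. For a red-blue colouring of (all edges of) $G$ and $t\ge 1$, let $r(P_t)$ and $b(P_t)$ be the numbers of connected components of the red graph, respectively of the blue graph, that are paths of length $t$. **Lemma.** There is an absolute constant $K$ such that for every $C$ there is $n_0$ such that the following holds for every $n\ge n_0$. Let $G$ be a cubic graph of order $n$ and let $G_0$ be a $C$-extendable red-blue coloured subgraph of $G$. Then there is a red-blue colouring of $G$ such that: (Q1) every monochromatic component is a path of length at most $K\log n$; (Q2) there is no red path of length at most $(\log n)^{2/3}$ that intersects at least $100\sqrt{\log n}$ pairwise vertex-disjoint blue paths of length at least $100\sqrt{\log n}$, and similarly with the roles of red and blue reversed (none of these paths need be maximal); (Q3) $|r(P_t)-b(P_t)|\le n^{2/3}$ for every $t\ge 1$; (Q4) for every finite red-blue coloured graph $H$, if $G_0$ has at least $n^{0.99}$ components that are isomorphic to $H$ (as coloured graphs), then at least $n^{0.9}$ of these components appear in $G$ with the colours of all their edges unchanged. -/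

import Mathlib

/-- A red-blue edge-coloured simple graph with vertices in `V`: its red edges and its blue edges,
no edge having both colours. -/
structure ColouredGraph (V : Type*) where
  red : SimpleGraph V
  blue : SimpleGraph V
  disjoint : Disjoint red blue

namespace ColouredGraph

/-- The underlying graph: all coloured edges. -/
def graph {V : Type*} (A : ColouredGraph V) : SimpleGraph V := A.red ⊔ A.blue

/-- The connected component `c` of `A` is isomorphic, as a red-blue coloured graph, to `H`. -/
def ComponentIso {V W : Type*} (A : ColouredGraph V) (H : ColouredGraph W)
    (c : A.graph.ConnectedComponent) : Prop :=
  ∃ φ : c.supp ≃ W, ∀ x y : c.supp,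
    (A.red.Adj x y ↔ H.red.Adj (φ x) (φ y)) ∧ (A.blue.Adj x y ↔ H.blue.Adj (φ x) (φ y))

/-- All edges of the component `c` of `A` are present in `B`, with the same colours. -/
def Survives {V : Type*} (A B : ColouredGraph V) (c : A.graph.ConnectedComponent) : Prop :=
  ∀ x ∈ c.supp, ∀ y ∈ c.supp,
    (A.red.Adj x y → B.red.Adj x y) ∧ (A.blue.Adj x y → B.blue.Adj x y)

end ColouredGraph

/-- The component `c` of `F` is a path of length `t` (with `t` edges). -/
def IsPathComponent {V : Type*} (F : SimpleGraph V) (c : F.ConnectedComponent) (t : ℕ) : Prop :=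
  Nonempty (c.toSimpleGraph ≃g SimpleGraph.pathGraph (t + 1))

/-- The number of components of `F` which are paths of length `t`. -/
noncomputable def pathCount {V : Type*} (F : SimpleGraph V) (t : ℕ) : ℕ :=
  {c : F.ConnectedComponent | IsPathComponent F c t}.ncard

/-- `H` is obtained, up to isolated vertices, from the (multi)graph with vertex set `W`, edge set
`E` and end points `ends : E → Sym2 W` by replacing every edge by a path with at most `b` interior
vertices; these paths are internally disjoint from each other and from the old vertices. -/
def IsSubdivision {V W E : Type*} (H : SimpleGraph V) (ends : E → Sym2 W) (b : ℝ) : Prop :=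
  ∃ (f : W → V) (src tgt : E → W) (P : ∀ e, H.Walk (f (src e)) (f (tgt e))),
    Function.Injective f ∧
    (∀ e, ends e = s(src e, tgt e)) ∧
    (∀ e, (P e).IsPath ∧ ((P e).length : ℝ) ≤ b + 1) ∧
    (∀ e w, f w ∈ (P e).support → w ∈ ends e) ∧
    (∀ e e', e ≠ e' → ∀ x, x ∈ (P e).support → x ∈ (P e').support → x ∈ Set.range f) ∧
    (∀ e e', e ≠ e' → (P e).edges.Disjoint (P e').edges) ∧
    (∀ z, z ∈ H.edgeSet ↔ ∃ e, z ∈ (P e).edges)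

/-- The edges of `H` with exactly one end point in the vertex set `S`. -/
def touchedEdges {V : Type*} (H : SimpleGraph V) (S : Set V) : Set (Sym2 V) :=
  {e | e ∈ H.edgeSet ∧ (∃ x ∈ e, x ∈ S) ∧ ∃ y ∈ e, y ∉ S}

/-- `H₁` is a subdivision of a finite simple graph with all degrees `1` or `3`, each edge being
subdivided at most `b` times. -/
def IsShortSubdivision {V : Type*} (H₁ : SimpleGraph V) (b : ℝ) : Prop :=
  ∃ (m : ℕ) (F : SimpleGraph (Fin m)),
    (∀ w, (F.neighborSet w).ncard = 1 ∨ (F.neighborSet w).ncard = 3) ∧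
    IsSubdivision H₁ (fun e : F.edgeSet => (e : Sym2 (Fin m))) b

/-- `H₂` is a vertex-disjoint union of even cycles of length at most `b`, each of which touches at
most two edges of `H₁`. -/
def IsShortEvenCycles {V : Type*} (H₁ H₂ : SimpleGraph V) (b : ℝ) : Prop :=
  ∀ c : H₂.ConnectedComponent, c.supp.Nontrivial →
    (∃ k : ℕ, 3 ≤ k ∧ Even k ∧ (k : ℝ) ≤ b ∧
      Nonempty (c.toSimpleGraph ≃g SimpleGraph.cycleGraph k)) ∧
    (touchedEdges H₁ c.supp).ncard ≤ 2

/-- `H₃` is a vertex-disjoint union of subdivisions of edges of multiplicity three, each of the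
three edges being subdivided at most `b` times. -/
def IsShortThetas {V : Type*} (H₃ : SimpleGraph V) (b : ℝ) : Prop :=
  ∀ c : H₃.ConnectedComponent, c.supp.Nontrivial →
    IsSubdivision c.toSimpleGraph (fun _ : Fin 3 => (s(0, 1) : Sym2 (Fin 2))) b

/-- Extendable red-blue coloured subgraphs `A` of `G`, where `s` bounds the sizes (to be taken of
order `√(log n)`). The components of `A` are those having an edge. -/
structure Extendable {V : Type*} (G : SimpleGraph V) (A : ColouredGraph V) (s : ℝ) : Prop where
  le : A.graph ≤ G
  /-- Vertices of degree at least two in `A` are incident to both colours. -/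
  degree : ∀ v, 2 ≤ (A.graph.neighborSet v).ncard →
    1 ≤ (A.red.neighborSet v).ncard ∧ 1 ≤ (A.blue.neighborSet v).ncard
  /-- Components are small. -/
  size : ∀ c : A.graph.ConnectedComponent, c.supp.Nontrivial → (c.supp.ncard : ℝ) ≤ s
  /-- Distinct components are at distance at least ten in `G`. -/
  dist : ∀ c d : A.graph.ConnectedComponent, c.supp.Nontrivial → d.supp.Nontrivial → c ≠ d →
    ∀ x ∈ c.supp, ∀ y ∈ d.supp, 10 ≤ G.edist x y
  /-- Every cycle of `G` without a red and a blue edge from the same component of `A` has two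
  consecutive edges outside `A`. -/
  cycle : ∀ (u : V) (p : G.Walk u u), p.IsCycle →
    (¬ ∃ x y x' y', s(x, y) ∈ p.edges ∧ A.red.Adj x y ∧ s(x', y') ∈ p.edges ∧ A.blue.Adj x' y' ∧
      A.graph.Reachable x x') →
    ∃ x y z, x ≠ z ∧ s(x, y) ∈ p.edges ∧ s(y, z) ∈ p.edges ∧
      ¬ A.graph.Adj x y ∧ ¬ A.graph.Adj y z
  /-- The uncoloured edges decompose into a short subdivision of a simple graph with degrees `1`
  and `3`, short even cycles, and short subdivided triple edges. -/
  decomp : ∃ H₁ H₂ H₃ : SimpleGraph V,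
    H₁ ⊔ H₂ ⊔ H₃ = G \ A.graph ∧ Disjoint H₁ H₂ ∧ Disjoint H₁ H₃ ∧ Disjoint H₂ H₃ ∧
    Disjoint H₂.support H₃.support ∧
    IsShortSubdivision H₁ s ∧ IsShortEvenCycles H₁ H₂ s ∧ IsShortThetas H₃ s

/-- No path of `F` of length at most `l` intersects at least `m` pairwise vertex-disjoint paths of
`F'` of length at least `m'`. -/
def NoSpider {V : Type*} (F F' : SimpleGraph V) (l m m' : ℝ) : Prop :=
  ¬ ∃ (u v : V) (p : F.Walk u v) (k : ℕ) (a b : Fin k → V) (q : ∀ i, F'.Walk (a i) (b i)),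
    p.IsPath ∧ (p.length : ℝ) ≤ l ∧ m ≤ (k : ℝ) ∧
    (∀ i, (q i).IsPath ∧ m' ≤ ((q i).length : ℝ) ∧ ∃ x ∈ p.support, x ∈ (q i).support) ∧
    (∀ i j, i ≠ j → (q i).support.Disjoint (q j).support)

/-!
Outside the pieces of `G₀`, the edges of the cubic graph split into vertex-disjoint directed cycles
and a forest. Most edges are tied to a second edge at their tail, which must have the opposite
colour; the colours of the remaining edges are independent random bits. The ties put both colours
at every vertex away from the pieces, and identifying further bits along triples of consecutive
edges on the directed cycles stops every monochromatic walk away from the pieces after twenty edges.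
Near a piece the edges are recoloured so that both colours appear at each vertex and no cycle is
monochromatic, which (E1) and (E3) permit; each piece depends on a single bit and is either left
unchanged or has its colours exchanged.

Only components of `G₀` at mutual distance more than a hundred are kept as pieces. A monochromatic
path with more than twenty edges then lives near one piece, which has at most `C √(log n)` vertices,
so all monochromatic components are short paths. Exchanging all colours negates all bits, so
`r(P_t) - b(P_t)` is an odd function of the bits, and it changes by `O(log² n)` when one bit is
flipped. Its mean is zero and by the Efron-Stein inequality its variance is `O(n log⁴ n)`, which
leaves room for all `t` at once in Chebyshev's inequality. The number of pieces with unchanged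
colours is concentrated as well.
-/

/-! ### Odd functions on the discrete cube -/

section Cube

variable {B : Type*} [DecidableEq B]

/-- Negation of the coordinate `b` on the discrete cube. -/
def flipBit (b : B) : Equiv.Perm (B → Bool) :=
  Function.Involutive.toPerm (fun ω => Function.update ω b (!ω b)) fun ω => by simp

theorem flipBit_apply (b : B) (ω : B → Bool) (a : B) :
    flipBit b ω a = if a = b then !ω b else ω a := Function.update_apply ω b (!ω b) a

theorem flipBit_not (b : B) (ω : B → Bool) :
    flipBit b (fun a => !ω a) = fun a => !flipBit b ω a := by
  funext a
  simp only [flipBit_apply]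
  split_ifs <;> rfl

theorem dependsOn_add_flipBit {f : (B → Bool) → ℝ} {b : B} {s : Finset B}
    (hf : DependsOn f (insert b s : Finset B)) :
    DependsOn (fun ω => f ω + f (flipBit b ω)) (s : Set B) := by
  have key : ∀ ω ω' : B → Bool, (∀ a ∈ s, ω a = ω' a) → ω b = ω' b → f ω = f ω' := by
    refine fun ω ω' h hb => hf fun a ha => ?_
    rcases Finset.mem_insert.mp (Finset.mem_coe.mp ha) with rfl | ha
    exacts [hb, h a ha]
  intro ω ω' h
  dsimp only
  replace h : ∀ a ∈ s, ω a = ω' a := h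
  rcases Bool.eq_or_eq_not (ω b) (ω' b) with hb | hb
  · rw [key ω ω' h hb, key (flipBit b ω) (flipBit b ω')] <;> grind [flipBit_apply]
  · rw [key ω (flipBit b ω'), key (flipBit b ω) ω', add_comm] <;> grind [flipBit_apply]

theorem abs_average_flipBit_sub_le {a b : B} (hab : a ≠ b) {f : (B → Bool) → ℝ} {r : ℝ}
    (h : ∀ ω, |f (flipBit a ω) - f ω| ≤ r) (ω : B → Bool) :
    |(f (flipBit a ω) + f (flipBit b (flipBit a ω))) / 2 - (f ω + f (flipBit b ω)) / 2| ≤ r := by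
  have hcomm : flipBit b (flipBit a ω) = flipBit a (flipBit b ω) := by
    funext c
    simp only [flipBit_apply]
    grind
  have h₁ := abs_le.mp (h ω)
  have h₂ := abs_le.mp (h (flipBit b ω))
  rw [hcomm, abs_le]
  constructor <;> linarith

theorem sum_sq_le_of_odd_of_dependsOn [Fintype B] {l : B → ℝ} (s : Finset B)
    {f : (B → Bool) → ℝ} (hf : DependsOn f s)
    (hl : ∀ b ∈ s, ∀ ω, |f (flipBit b ω) - f ω| ≤ l b) (hodd : ∀ ω, f (fun b => !ω b) = -f ω) :
    ∑ ω, f ω ^ 2 ≤ 2 ^ Fintype.card B * ∑ b ∈ s, (l b / 2) ^ 2 := by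
  induction s using Finset.induction_on generalizing f with
  | empty =>
    have h0 : ∀ ω, f ω = 0 := fun ω => by
      linarith [hodd ω, hf (x := fun b => !ω b) (y := ω) (by simp)]
    simp [h0]
  | insert b s hb ih =>
    set g : (B → Bool) → ℝ := fun ω => (f ω + f (flipBit b ω)) / 2 with hg
    have hgl : ∀ a ∈ s, ∀ ω, |g (flipBit a ω) - g ω| ≤ l a := fun a ha =>
      abs_average_flipBit_sub_le (ne_of_mem_of_not_mem ha hb) (hl a (Finset.mem_insert_of_mem ha))
    have hgsum := ih (f := g) (by
      intro ω ω' h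
      simp only [hg, dependsOn_add_flipBit hf h]) hgl fun ω => by
      simp only [hg, flipBit_not, hodd]
      ring
    have hsplit : ∀ ω, (f ω ^ 2 + f (flipBit b ω) ^ 2) / 2 =
        g ω ^ 2 + ((f (flipBit b ω) - f ω) / 2) ^ 2 := fun ω => by
      simp only [hg]
      ring
    calc ∑ ω, f ω ^ 2 = ∑ ω, (f ω ^ 2 + f (flipBit b ω) ^ 2) / 2 := by
          rw [← Finset.sum_div, Finset.sum_add_distrib,
            Equiv.sum_comp (flipBit b) fun ω => f ω ^ 2]
          ring
      _ ≤ ∑ ω, (g ω ^ 2 + (l b / 2) ^ 2) := Finset.sum_le_sum fun ω _ => by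
          rw [hsplit, ← sq_abs ((f (flipBit b ω) - f ω) / 2), abs_div, abs_two]
          gcongr
          exact hl b (Finset.mem_insert_self b s) ω
      _ ≤ 2 ^ Fintype.card B * ∑ a ∈ insert b s, (l a / 2) ^ 2 := by
          rw [Finset.sum_add_distrib, Finset.sum_insert hb, mul_add, add_comm]
          exact add_le_add (by simp) hgsum

theorem exists_forall_abs_le_of_odd [Fintype B] {I : Type*} (J : Finset I)
    (f : I → (B → Bool) → ℝ) (l : I → B → ℝ) (t : I → ℝ) (ht : ∀ i ∈ J, 0 < t i)
    (hl : ∀ i ∈ J, ∀ b ω, |f i (flipBit b ω) - f i ω| ≤ l i b)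
    (hodd : ∀ i ∈ J, ∀ ω, f i (fun b => !ω b) = -f i ω)
    (hsum : ∑ i ∈ J, (∑ b, (l i b / 2) ^ 2) / t i ^ 2 < 1) :
    ∃ ω, ∀ i ∈ J, |f i ω| ≤ t i := by
  by_contra! hcon
  have hmoment : ∀ i ∈ J, ∑ ω, f i ω ^ 2 ≤ 2 ^ Fintype.card B * ∑ b, (l i b / 2) ^ 2 :=
    fun i hi => sum_sq_le_of_odd_of_dependsOn _ (by simpa using dependsOn_univ (f i))
      (fun b _ => hl i hi b) (hodd i hi)
  have hlarge : ∀ ω, 1 ≤ ∑ i ∈ J, f i ω ^ 2 / t i ^ 2 := fun ω => by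
    obtain ⟨i, hi, hlt⟩ := hcon ω
    refine le_trans ?_ (Finset.single_le_sum (f := fun i => f i ω ^ 2 / t i ^ 2)
      (fun i _ => by positivity) hi)
    have := ht i hi
    rw [one_le_div (by positivity), ← sq_abs (f i ω)]
    gcongr
  have : (2 : ℝ) ^ Fintype.card B < 2 ^ Fintype.card B * 1 := by
    calc (2 : ℝ) ^ Fintype.card B = ∑ ω : B → Bool, 1 := by simp
      _ ≤ ∑ ω, ∑ i ∈ J, f i ω ^ 2 / t i ^ 2 := Finset.sum_le_sum fun ω _ => hlarge ω
      _ = ∑ i ∈ J, (∑ ω, f i ω ^ 2) / t i ^ 2 := by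
          rw [Finset.sum_comm]
          simp only [Finset.sum_div]
      _ ≤ ∑ i ∈ J, (2 ^ Fintype.card B * ∑ b, (l i b / 2) ^ 2) / t i ^ 2 :=
          Finset.sum_le_sum fun i hi => by
            gcongr
            exact hmoment i hi
      _ < 2 ^ Fintype.card B * 1 := by
          simp only [mul_div_assoc, ← Finset.mul_sum]
          gcongr
  linarith

end Cube

open SimpleGraph

/-! ### Path components -/

section PathComponents

variable {V : Type*} {F F' : SimpleGraph V}

/-- All degrees of `F` are at most two, phrased so as to make sense in infinite graphs. -/
def MaxDegTwo (F : SimpleGraph V) : Prop :=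
  ∀ v a b c, F.Adj v a → F.Adj v b → F.Adj v c → a = b ∨ a = c ∨ b = c

theorem mem_of_reachable {S : Set V} (hS : ∀ x ∈ S, ∀ y, F.Adj x y → y ∈ S) {x y : V}
    (hx : x ∈ S) (h : F.Reachable x y) : y ∈ S := by
  obtain ⟨p⟩ := h
  by_contra hy
  obtain ⟨d, -, h₁, h₂⟩ := p.exists_boundary_dart S hx hy
  exact h₂ (hS _ h₁ _ d.adj)

namespace MaxDegTwo

theorem mem_support_of_adj_getVert (hF : MaxDegTwo F) {u v : V} {p : F.Walk u v} (hp : p.IsPath)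
    {i : ℕ} (h0 : 0 < i) (hi : i < p.length) {y : V} (hy : F.Adj (p.getVert i) y) :
    y ∈ p.support := by
  have hnext : F.Adj (p.getVert i) (p.getVert (i + 1)) := p.adj_getVert_succ hi
  have hprev : F.Adj (p.getVert i) (p.getVert (i - 1)) := by
    have := p.adj_getVert_succ (i := i - 1) (by lia)
    rw [Nat.sub_add_cancel h0] at this
    exact this.symm
  rcases hF _ _ _ _ hnext hprev hy with h | rfl | rfl
  · have := hp.getVert_injOn (by simp; lia) (by simp; lia) h
    lia
  · exact p.getVert_mem_support _
  · exact p.getVert_mem_support _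

theorem mem_support_of_forall_length_le (hF : MaxDegTwo F) {u v : V} {p : F.Walk u v}
    (hp : p.IsPath) (hmax : ∀ u' v' (q : F.Walk u' v'), q.IsPath → F.Reachable u u' →
      q.length ≤ p.length) {x : V} (hx : F.Reachable u x) : x ∈ p.support := by
  refine mem_of_reachable (S := {x | x ∈ p.support}) (fun y hy z hyz => ?_) p.start_mem_support hx
  by_contra hz
  obtain ⟨i, rfl, hi⟩ := Walk.mem_support_iff_exists_getVert.mp hy
  rcases Nat.eq_zero_or_pos i with rfl | h0
  · rw [Walk.getVert_zero] at hyz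
    have := hmax _ _ _ (hp.cons (h := hyz.symm) hz) hyz.reachable
    simp at this
  rcases hi.lt_or_eq with hi | rfl
  · exact hz (hF.mem_support_of_adj_getVert hp h0 hi hyz)
  · rw [Walk.getVert_length] at hyz
    have := hmax _ _ _ (hp.concat hz hyz) .rfl
    simp at this

theorem exists_isPath_support_eq [Finite V] (hF : MaxDegTwo F) (c : F.ConnectedComponent) :
    ∃ (u v : V) (p : F.Walk u v), p.IsPath ∧ ∀ x, x ∈ p.support ↔ x ∈ c.supp := by
  classical
  have := Fintype.ofFinite V
  obtain ⟨x₀, hx₀⟩ := c.nonempty_supp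
  let lengths : Set ℕ := {n | ∃ u v, ∃ p : F.Walk u v, p.IsPath ∧ u ∈ c.supp ∧ p.length = n}
  have hfin : lengths.Finite := (Set.finite_Iio (Fintype.card V)).subset <| by
    rintro n ⟨u, v, p, hp, -, rfl⟩
    exact hp.length_lt
  have hne : lengths.Nonempty := ⟨0, x₀, x₀, .nil, .nil, hx₀, rfl⟩
  obtain ⟨_, ⟨u, v, p, hp, hu, rfl⟩, hmax⟩ := hfin.exists_maximal hne
  refine ⟨u, v, p, hp, fun x => ⟨fun hx => ?_, fun hx => ?_⟩⟩
  · exact (ConnectedComponent.sound (p.takeUntil x hx).reachable).symm.trans hu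
  · refine hF.mem_support_of_forall_length_le hp (fun u' v' q hq hu' => ?_)
      (c.reachable_of_mem_supp hu hx)
    by_contra! h
    exact absurd (hmax ⟨u', v', q, hq, (ConnectedComponent.sound hu').symm.trans hu, rfl⟩ h.le)
      h.not_ge

theorem not_reachable_three [Finite V] (hF : MaxDegTwo F) {x y z : V} (hxy : x ≠ y) (hxz : x ≠ z)
    (hyz : y ≠ z) (hx : (F.neighborSet x).Subsingleton) (hy : (F.neighborSet y).Subsingleton)
    (hz : (F.neighborSet z).Subsingleton) (h : F.Reachable x y) : ¬ F.Reachable x z := by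
  intro h'
  obtain ⟨u, v, p, hp, hsupp⟩ := hF.exists_isPath_support_eq (F.connectedComponentMk x)
  have hend : ∀ w, (F.neighborSet w).Subsingleton → F.Reachable x w → w = u ∨ w = v := by
    intro w hw hxw
    by_contra! hne
    exact hp.isTrail.not_mem_support_of_subsingleton_neighborSet hne.1 hne.2 hw
      ((hsupp w).2 (ConnectedComponent.sound hxw.symm))
  grind [hend x hx .rfl, hend y hy h, hend z hz h']

end MaxDegTwo

theorem adj_getVert_iff_of_isAcyclic (hF : F.IsAcyclic) {u v : V} {p : F.Walk u v}
    (hp : p.IsPath) {i j : ℕ} (hij : i < j) (hj : j ≤ p.length) :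
    F.Adj (p.getVert i) (p.getVert j) ↔ i + 1 = j := by
  constructor
  · intro h
    have hsnd := hF.eq_snd_of_adj_start (hp.drop i) h <| Walk.mem_support_iff_exists_getVert.2
      ⟨j - i, by rw [Walk.drop_getVert]; congr 1; lia, by rw [Walk.drop_length]; lia⟩
    rw [Walk.snd, Walk.drop_getVert] at hsnd
    exact (hp.getVert_injOn (by simp; lia) (by simp; lia) hsnd).symm
  · rintro rfl
    exact p.adj_getVert_succ hj

theorem isPathComponent_of_isPath (hF : F.IsAcyclic) {c : F.ConnectedComponent} {u v : V}
    {p : F.Walk u v} (hp : p.IsPath) (hsupp : ∀ x, x ∈ p.support ↔ x ∈ c.supp) :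
    IsPathComponent F c p.length := by
  let f : Fin (p.length + 1) → c := fun i => ⟨p.getVert i, (hsupp _).1 (p.getVert_mem_support _)⟩
  have hf : Function.Bijective f := by
    constructor
    · intro i j hij
      exact Fin.ext <| hp.getVert_injOn (by simp; lia) (by simp; lia) (congrArg Subtype.val hij)
    · rintro ⟨x, hx⟩
      obtain ⟨i, rfl, hi⟩ := Walk.mem_support_iff_exists_getVert.mp ((hsupp x).2 hx)
      exact ⟨⟨i, by lia⟩, rfl⟩
  refine ⟨RelIso.symm ⟨Equiv.ofBijective f hf, fun {i j} => ?_⟩⟩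
  rw [pathGraph_adj]
  change F.Adj (p.getVert i) (p.getVert j) ↔ _
  rcases lt_trichotomy i.val j.val with h | h | h
  · rw [adj_getVert_iff_of_isAcyclic hF hp h (by lia)]; lia
  · rw [h]; simp
  · rw [adj_comm, adj_getVert_iff_of_isAcyclic hF hp h (by lia)]; lia

theorem IsPathComponent.ncard_supp {c : F.ConnectedComponent} {t : ℕ}
    (h : IsPathComponent F c t) : c.supp.ncard = t + 1 := by
  obtain ⟨φ⟩ := h
  rw [← Nat.card_coe_set_eq]
  exact (Nat.card_congr φ.toEquiv).trans (by simp)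

theorem supp_connectedComponentMk_eq {c : F.ConnectedComponent}
    (h : ∀ x ∈ c.supp, ∀ y, F.Adj x y ↔ F'.Adj x y) {x : V} (hx : x ∈ c.supp) :
    (F'.connectedComponentMk x).supp = c.supp := by
  ext y
  constructor
  · intro hy
    exact mem_of_reachable (fun z hz w hzw => c.mem_supp_of_adj_mem_supp hz ((h z hz w).2 hzw)) hx
      (ConnectedComponent.exact hy).symm
  · intro hy
    have hinter : y ∈ c.supp ∩ (F'.connectedComponentMk x).supp :=
      mem_of_reachable (S := c.supp ∩ _) (fun z hz w hzw => ⟨c.mem_supp_of_adj_mem_supp hz.1 hzw,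
        ConnectedComponent.mem_supp_of_adj_mem_supp _ hz.2 ((h z hz.1 w).1 hzw)⟩)
        ⟨hx, rfl⟩ (c.reachable_of_mem_supp hx hy)
    exact hinter.2

theorem ncard_pathComponents_avoiding_le [Finite V] {U : Set V}
    (h : ∀ x, x ∉ U → ∀ y, F.Adj x y ↔ F'.Adj x y) (t : ℕ) :
    {c : F.ConnectedComponent | IsPathComponent F c t ∧ ∀ x ∈ c.supp, x ∉ U}.ncard ≤
      pathCount F' t := by
  choose r hr using fun c : F.ConnectedComponent => c.nonempty_supp
  have hsupp : ∀ c : F.ConnectedComponent, (∀ x ∈ c.supp, x ∉ U) →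
      (F'.connectedComponentMk (r c)).supp = c.supp :=
    fun c hU => supp_connectedComponentMk_eq (fun x hx => h x (hU x hx)) (hr c)
  refine Set.ncard_le_ncard_of_injOn (fun c => F'.connectedComponentMk (r c)) ?_ ?_ (Set.toFinite _)
  · rintro c ⟨⟨φ⟩, hU⟩
    refine ⟨RelIso.trans ⟨Equiv.setCongr (hsupp c hU), ?_⟩ φ⟩
    rintro ⟨x, hx⟩ ⟨y, _⟩
    exact h x (hU x (hsupp c hU ▸ hx)) y
  · rintro c ⟨_, hU⟩ c' ⟨_, hU'⟩ hcc
    have hcc' : F'.connectedComponentMk (r c) = F'.connectedComponentMk (r c') := hcc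
    exact ConnectedComponent.supp_injective <| by rw [← hsupp c hU, hcc', hsupp c' hU']

theorem pathCount_le_add_ncard [Finite V] {U : Set V}
    (h : ∀ x, x ∉ U → ∀ y, F.Adj x y ↔ F'.Adj x y) (t : ℕ) :
    pathCount F t ≤ pathCount F' t + U.ncard := by
  have hsub : {c : F.ConnectedComponent | IsPathComponent F c t} ⊆
      {c : F.ConnectedComponent | IsPathComponent F c t ∧ ∀ x ∈ c.supp, x ∉ U} ∪
        F.connectedComponentMk '' U := by
    intro c hc
    by_cases hU : ∀ x ∈ c.supp, x ∉ U
    · exact Or.inl ⟨hc, hU⟩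
    · push Not at hU
      obtain ⟨x, hx, hxU⟩ := hU
      exact Or.inr ⟨x, hxU, hx⟩
  exact (Set.ncard_le_ncard hsub (Set.toFinite _)).trans <| (Set.ncard_union_le _ _).trans <|
    add_le_add (ncard_pathComponents_avoiding_le h t) (Set.ncard_image_le (Set.toFinite _))

end PathComponents

/-! ### Colourings with both colours at every vertex -/

section Colourings

variable {V : Type*} {G : SimpleGraph V} {col : Sym2 V → Bool}

/-- The graph of the edges of `G` of colour `c`. A colouring is a map `Sym2 V → Bool`; its values
off the edges of `G` are irrelevant. -/
def colourClass (G : SimpleGraph V) (col : Sym2 V → Bool) (c : Bool) : SimpleGraph V where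
  Adj u v := G.Adj u v ∧ col s(u, v) = c
  symm := ⟨fun u v h => ⟨h.1.symm, by rw [Sym2.eq_swap]; exact h.2⟩⟩
  loopless := ⟨fun v h => G.loopless.irrefl v h.1⟩

/-- Every vertex is incident to edges of both colours. -/
def BothColours (G : SimpleGraph V) (col : Sym2 V → Bool) : Prop :=
  ∀ v c, ∃ w, (colourClass G col c).Adj v w

/-- Every vertex has exactly three neighbours; unlike `G.IsRegularOfDegree 3` this needs no
local finiteness instance. -/
def IsCubic (G : SimpleGraph V) : Prop := ∀ v, (G.neighborSet v).ncard = 3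

theorem colourClass_le (c : Bool) : colourClass G col c ≤ G := fun _ _ h => h.1

theorem ne_of_adj_colourClass {v x y : V} {c : Bool} (hx : (colourClass G col c).Adj v x)
    (hy : (colourClass G col (!c)).Adj v y) : x ≠ y := by
  rintro rfl
  simpa using hx.2.symm.trans hy.2

namespace IsCubic

theorem exists_three (hG : IsCubic G) (v : V) :
    ∃ a b c, a ≠ b ∧ a ≠ c ∧ b ≠ c ∧ G.neighborSet v = {a, b, c} :=
  Set.ncard_eq_three.mp (hG v)

theorem eq_or_eq_or_eq (hG : IsCubic G) {v a b c d : V} (ha : G.Adj v a) (hb : G.Adj v b)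
    (hc : G.Adj v c) (hd : G.Adj v d) (hab : a ≠ b) (hac : a ≠ c) (hbc : b ≠ c) :
    d = a ∨ d = b ∨ d = c := by
  obtain ⟨x, y, z, -, -, -, h⟩ := hG.exists_three v
  simp only [← mem_neighborSet, h, Set.mem_insert_iff, Set.mem_singleton_iff] at ha hb hc hd
  grind

theorem exists_third (hG : IsCubic G) (v a b : V) : ∃ c, G.Adj v c ∧ c ≠ a ∧ c ≠ b := by
  obtain ⟨x, y, z, hxy, hxz, hyz, h⟩ := hG.exists_three v
  simp only [← mem_neighborSet, h, Set.mem_insert_iff, Set.mem_singleton_iff]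
  by_contra! hne
  have hab : ∀ w, w = x ∨ w = y ∨ w = z → w = a ∨ w = b := fun w hw =>
    or_iff_not_imp_left.2 (hne w hw)
  have := hab x (by simp)
  have := hab y (by simp)
  have := hab z (by simp)
  grind

theorem subsingleton_neighborSet (hG : IsCubic G) {v x y : V} {c : Bool} (hxy : x ≠ y)
    (hx : (colourClass G col c).Adj v x) (hy : (colourClass G col c).Adj v y) :
    ((colourClass G col (!c)).neighborSet v).Subsingleton := by
  intro a ha b hb
  by_contra hab
  rcases hG.eq_or_eq_or_eq hx.1 hy.1 ha.1 hb.1 hxy (ne_of_adj_colourClass hx ha)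
    (ne_of_adj_colourClass hy ha) with h | h | h
  · exact ne_of_adj_colourClass hx hb h.symm
  · exact ne_of_adj_colourClass hy hb h.symm
  · exact hab h.symm

end IsCubic

theorem BothColours.maxDegTwo (hcol : BothColours G col) (hG : IsCubic G) (c : Bool) :
    MaxDegTwo (colourClass G col c) := by
  intro v x y z hx hy hz
  by_contra! h
  obtain ⟨w, hw⟩ := hcol v (!c)
  rcases hG.eq_or_eq_or_eq hx.1 hy.1 hz.1 hw.1 h.1 h.2.1 h.2.2 with h | h | h
  · exact ne_of_adj_colourClass hx hw h.symm
  · exact ne_of_adj_colourClass hy hw h.symm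
  · exact ne_of_adj_colourClass hz hw h.symm

theorem exists_two_edges_of_isCycle {F : SimpleGraph V} {u : V} {p : F.Walk u u}
    (hp : p.IsCycle) {x : V} (hx : x ∈ p.support) :
    ∃ a b, a ≠ b ∧ s(x, a) ∈ p.edges ∧ s(x, b) ∈ p.edges := by
  classical
  have hq : (p.rotate x hx).IsCycle := hp.rotate hx
  refine ⟨_, _, hq.snd_ne_penultimate, ?_, ?_⟩ <;> rw [← (p.rotate_edges x hx).mem_iff]
  · exact Walk.mk_start_snd_mem_edges hq.not_nil
  · rw [Sym2.eq_swap]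
    exact Walk.mk_penultimate_end_mem_edges hq.not_nil

theorem exists_edge_ne_of_isCycle {F : SimpleGraph V} {u : V} {p : F.Walk u u}
    (hp : p.IsCycle) {x : V} (y : V) (hx : x ∈ p.support) : ∃ a, a ≠ y ∧ s(x, a) ∈ p.edges := by
  obtain ⟨a, b, hab, ha, hb⟩ := exists_two_edges_of_isCycle hp hx
  by_cases h : a = y
  · exact ⟨b, fun hb => hab (h.trans hb.symm), hb⟩
  · exact ⟨a, h, ha⟩

section Recolour

variable [DecidableEq V] {c : Bool} {y z : V}

/-- The colouring `col` with the colour of the edge `e` changed. -/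
def recolour (col : Sym2 V → Bool) (e : Sym2 V) : Sym2 V → Bool := Function.update col e (!col e)

theorem recolour_self (e : Sym2 V) : recolour col e e = !col e := Function.update_self ..

theorem recolour_of_ne {e e' : Sym2 V} (h : e' ≠ e) : recolour col e e' = col e' :=
  Function.update_of_ne h _ _

theorem adj_recolour {e : Sym2 V} {v w : V} (h : (colourClass G col c).Adj v w)
    (hne : s(v, w) ≠ e) : (colourClass G (recolour col e) c).Adj v w :=
  ⟨h.1, (recolour_of_ne hne).trans h.2⟩

theorem BothColours.recolour_edge {z' z'' : V} (hcol : BothColours G col)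
    (hz : (colourClass G col c).Adj y z) (hz' : (colourClass G col c).Adj y z') (hne' : z' ≠ z)
    (hz'' : (colourClass G col c).Adj z z'') (hne'' : z'' ≠ y) :
    BothColours G (recolour col s(y, z)) := by
  intro v d
  by_cases hdc : d = c
  · subst hdc
    by_cases hvy : v = y
    · exact ⟨z', by subst hvy; exact adj_recolour hz' (by simp [hne', hz'.ne.symm])⟩
    by_cases hvz : v = z
    · exact ⟨z'', by subst hvz; exact adj_recolour hz'' (by simp [hne'', hvy])⟩
    · obtain ⟨w, hw⟩ := hcol v d
      exact ⟨w, adj_recolour hw (by simp [hvy, hvz])⟩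
  · obtain ⟨w, hw⟩ := hcol v d
    refine ⟨w, adj_recolour hw fun h => hdc ?_⟩
    rw [← hw.2, h, hz.2]

theorem notMem_edges_of_not_reachable (hz : (colourClass G col c).Adj y z)
    (hnr : ¬ (colourClass G col (!c)).Reachable y z) {d : Bool} {w : V}
    {q : (colourClass G (recolour col s(y, z)) d).Walk w w} (hq : q.IsCycle) :
    s(y, z) ∉ q.edges := by
  intro hmem
  have hd : d = !c := by
    rw [← (q.adj_of_mem_edges hmem).2, recolour_self, hz.2]
  subst hd
  refine hnr ((adj_and_reachable_delete_edges_iff_exists_cycle.mpr ⟨w, q, hq, hmem⟩).2.mono ?_)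
  intro v x hvx
  rw [deleteEdges_adj] at hvx
  exact ⟨hvx.1.1, (recolour_of_ne hvx.2).symm.trans hvx.1.2⟩

/- Let `x₁ y x₂` be consecutive on a monochromatic cycle. In the other colour these three vertices
have degree one, so they cannot all be joined by a path of that colour. -/
theorem BothColours.exists_recolour [Finite V] (hcol : BothColours G col) (hG : IsCubic G) {u : V}
    {p : (colourClass G col c).Walk u u} (hp : p.IsCycle) {x₁ x₂ : V} (hne : x₁ ≠ x₂)
    (h₁ : s(y, x₁) ∈ p.edges) (h₂ : s(y, x₂) ∈ p.edges) :
    ∃ z, (z = x₁ ∨ z = x₂) ∧ BothColours G (recolour col s(y, z)) ∧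
      ∀ (d : Bool) (w : V) (q : (colourClass G (recolour col s(y, z)) d).Walk w w),
        q.IsCycle → s(y, z) ∉ q.edges := by
  obtain ⟨x₁', hne₁, h₁'⟩ := exists_edge_ne_of_isCycle hp y (p.snd_mem_support_of_mem_edges h₁)
  obtain ⟨x₂', hne₂, h₂'⟩ := exists_edge_ne_of_isCycle hp y (p.snd_mem_support_of_mem_edges h₂)
  have a₁ := p.adj_of_mem_edges h₁
  have a₂ := p.adj_of_mem_edges h₂
  have a₁' := p.adj_of_mem_edges h₁'
  have a₂' := p.adj_of_mem_edges h₂'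
  have hnr : ¬ ((colourClass G col (!c)).Reachable y x₁ ∧
      (colourClass G col (!c)).Reachable y x₂) := fun h =>
    (hcol.maxDegTwo hG (!c)).not_reachable_three a₁.ne a₂.ne hne
      (hG.subsingleton_neighborSet hne a₁ a₂) (hG.subsingleton_neighborSet hne₁.symm a₁.symm a₁')
      (hG.subsingleton_neighborSet hne₂.symm a₂.symm a₂') h.1 h.2
  rcases not_and_or.mp hnr with hnr | hnr
  · exact ⟨x₁, .inl rfl, hcol.recolour_edge a₁ a₂ hne.symm a₁' hne₁,
      fun _ _ _ hq => notMem_edges_of_not_reachable a₁ hnr hq⟩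
  · exact ⟨x₂, .inr rfl, hcol.recolour_edge a₂ a₁ hne a₂' hne₂,
      fun _ _ _ hq => notMem_edges_of_not_reachable a₂ hnr hq⟩

end Recolour

/-- The edges lying on monochromatic cycles within `X`. -/
def monoCycleEdges (G : SimpleGraph V) (X : Set V) (col : Sym2 V → Bool) : Set (Sym2 V) :=
  {e | ∃ (c : Bool) (u : V) (p : (colourClass G col c).Walk u u), p.IsCycle ∧
    (∀ x ∈ p.support, x ∈ X) ∧ e ∈ p.edges}

theorem monoCycleEdges_recolour_subset [DecidableEq V] {X : Set V} {e : Sym2 V}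
    (he : ∀ (d : Bool) (w : V) (q : (colourClass G (recolour col e) d).Walk w w),
      q.IsCycle → e ∉ q.edges) :
    monoCycleEdges G X (recolour col e) ⊆ monoCycleEdges G X col := by
  rintro e' ⟨d, w, q, hq, hqX, he'⟩
  have htransfer : ∀ e ∈ q.edges, e ∈ (colourClass G col d).edgeSet := by
    intro e'' he''
    have hne : e'' ≠ e := by rintro rfl; exact he _ _ q hq he''
    have hmem := q.edges_subset_edgeSet he''
    induction e'' with
    | _ a b => exact ⟨hmem.1, (recolour_of_ne hne).symm.trans hmem.2⟩
  exact ⟨d, w, q.transfer _ htransfer, hq.transfer htransfer, by simpa using hqX,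
    by simpa using he'⟩

theorem BothColours.exists_repair [Finite V] (hcol : BothColours G col) (hG : IsCubic G)
    (S : Set (Sym2 V)) (X : Set V)
    (hcyc : ∀ col' : Sym2 V → Bool, (∀ e, e ∉ S → col' e = col e) → BothColours G col' →
      ∀ (c : Bool) (u : V) (p : (colourClass G col' c).Walk u u), p.IsCycle →
        (∀ x ∈ p.support, x ∈ X) →
        ∃ y x₁ x₂, x₁ ≠ x₂ ∧ s(y, x₁) ∈ p.edges ∧ s(y, x₂) ∈ p.edges ∧
          s(y, x₁) ∈ S ∧ s(y, x₂) ∈ S) :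
    ∃ col' : Sym2 V → Bool, (∀ e, e ∉ S → col' e = col e) ∧ BothColours G col' ∧
      ∀ (c : Bool) (u : V) (p : (colourClass G col' c).Walk u u), p.IsCycle →
        ¬ ∀ x ∈ p.support, x ∈ X := by
  classical
  obtain ⟨col', ⟨hoff, hcol'⟩, hmin⟩ :=
    WellFounded.has_min (measure fun col' => (monoCycleEdges G X col').ncard).wf
      {col' | (∀ e, e ∉ S → col' e = col e) ∧ BothColours G col'} ⟨col, fun _ _ => rfl, hcol⟩
  refine ⟨col', hoff, hcol', fun c u p hp hX => ?_⟩
  obtain ⟨y, x₁, x₂, hne, h₁, h₂, hS₁, hS₂⟩ := hcyc col' hoff hcol' c u p hp hX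
  obtain ⟨z, hz, hcol'', hflip⟩ := hcol'.exists_recolour hG hp hne h₁ h₂
  have hzS : s(y, z) ∈ S := by rcases hz with rfl | rfl <;> assumption
  have hzp : s(y, z) ∈ p.edges := by rcases hz with rfl | rfl <;> assumption
  refine hmin (recolour col' s(y, z)) ⟨fun e he => ?_, hcol''⟩ (Set.ncard_lt_ncard
    ⟨monoCycleEdges_recolour_subset hflip, fun hsub => ?_⟩ (Set.toFinite _))
  · rw [recolour_of_ne (by rintro rfl; exact he hzS)]
    exact hoff e he
  · obtain ⟨d, w, q, hq, _, he⟩ := hsub ⟨c, u, p, hp, hX, hzp⟩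
    exact hflip _ _ q hq he

end Colourings

/-! ### Directed cycles and forests -/

section CyclesAndForests

variable {V : Type*} {G B F T : SimpleGraph V} {σ τ : Equiv.Perm V}

/-- The nontrivial orbits of `σ` are cycles of the graph `B`, traversed in one direction: this
encodes a family of vertex-disjoint directed cycles. -/
def IsCyclePerm (B : SimpleGraph V) (σ : Equiv.Perm V) : Prop :=
  ∀ v, σ v ≠ v → B.Adj v (σ v) ∧ σ (σ v) ≠ v

/-- The edges of `B` that are not on the directed cycles of `σ`. -/
def offCycles (B : SimpleGraph V) (σ : Equiv.Perm V) : SimpleGraph V where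
  Adj u v := B.Adj u v ∧ σ u ≠ v ∧ σ v ≠ u
  symm := ⟨fun _ _ h => ⟨h.1.symm, h.2.2, h.2.1⟩⟩
  loopless := ⟨fun v h => B.loopless.irrefl v h.1⟩

namespace IsCyclePerm

theorem symm_apply_ne {v : V} (hv : σ v ≠ v) : σ.symm v ≠ v := fun h => hv <| by
  rw [Equiv.symm_apply_eq] at h
  exact h.symm

theorem adj_symm_apply (h : IsCyclePerm B σ) {v : V} (hv : σ v ≠ v) : B.Adj v (σ.symm v) := by
  have := (h (σ.symm v) (by simpa using (symm_apply_ne hv).symm)).1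
  rw [σ.apply_symm_apply] at this
  exact this.symm

theorem symm_apply_ne_apply (h : IsCyclePerm B σ) {v : V} (hv : σ v ≠ v) : σ.symm v ≠ σ v := by
  intro heq
  rw [Equiv.symm_apply_eq] at heq
  exact (h v hv).2 heq.symm

theorem mul (hσ : IsCyclePerm B σ) (hτ : IsCyclePerm B τ) (hdisj : σ.Disjoint τ) :
    IsCyclePerm B (σ * τ) := by
  intro v hv
  simp only [Equiv.Perm.mul_apply] at hv ⊢
  rcases hdisj v with hσv | hτv
  · by_cases hτv : τ v = v
    · rw [hτv] at hv
      exact absurd hσv hv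
    have hσ' : σ (τ v) = τ v := (hdisj (τ v)).resolve_right fun h => hτv (τ.injective h)
    have hσ'' : σ (τ (τ v)) = τ (τ v) :=
      (hdisj (τ (τ v))).resolve_right fun h => hτv (τ.injective (τ.injective h))
    rw [hσ', hσ'']
    exact hτ v hτv
  · rw [hτv] at hv ⊢
    rw [(hdisj (σ v)).resolve_left fun h => hv (σ.injective h)]
    exact hσ v hv

theorem apply_eq_of_isCycle (hσ : IsCyclePerm B σ) (hG : IsCubic G) (hB : B ≤ G) {u v : V}
    {p : (offCycles B σ).Walk u u} (hp : p.IsCycle) (hv : v ∈ p.support) : σ v = v := by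
  by_contra hne
  obtain ⟨a, b, hab, ha, hb⟩ := exists_two_edges_of_isCycle hp hv
  have ha := p.adj_of_mem_edges ha
  have hb := p.adj_of_mem_edges hb
  have hsymm : ∀ {c}, (offCycles B σ).Adj v c → σ.symm v ≠ c := by
    rintro c hc rfl
    exact hc.2.2 (σ.apply_symm_apply v)
  rcases hG.eq_or_eq_or_eq (hB (hσ v hne).1) (hB (hσ.adj_symm_apply hne)) (hB ha.1) (hB hb.1)
    (hσ.symm_apply_ne_apply hne).symm ha.2.1 (hsymm ha) with h | h | h
  · exact hb.2.1 h.symm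
  · exact hsymm hb h.symm
  · exact hab h.symm

end IsCyclePerm

theorem formPerm_formPerm_apply_ne [DecidableEq V] {l : List V} (hl : l.Nodup) (hlen : 3 ≤ l.length)
    {v : V} (hv : v ∈ l) : l.formPerm (l.formPerm v) ≠ v := by
  obtain ⟨i, hi, rfl⟩ := List.mem_iff_getElem.mp hv
  rw [List.formPerm_apply_getElem l hl, List.formPerm_apply_getElem l hl, Ne, hl.getElem_inj_iff,
    Nat.mod_add_mod]
  intro h
  rcases lt_or_ge (i + 1 + 1) l.length with h' | h'
  · rw [Nat.mod_eq_of_lt h'] at h; lia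
  · rw [Nat.mod_eq_sub_mod h', Nat.mod_eq_of_lt (by lia)] at h; lia

theorem adj_formPerm_of_isCycle [DecidableEq V] {u : V} {p : F.Walk u u} (hp : p.IsCycle) {v : V}
    (hv : v ∈ p.support.tail) : F.Adj v (p.support.tail.formPerm v) := by
  obtain ⟨i, hi, rfl⟩ := List.mem_iff_getElem.mp hv
  have hlen : p.support.tail.length = p.length := by simp
  have hget : ∀ j (hj : j < p.support.tail.length), p.support.tail[j] = p.getVert (j + 1) :=
    fun j hj => by simp [Walk.support_getElem_eq_getVert]
  rw [List.formPerm_apply_getElem _ hp.support_nodup, hget, hget]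
  rcases (show i + 1 ≤ p.support.tail.length from hi).lt_or_eq with h | h
  · simp only [Nat.mod_eq_of_lt h]
    exact p.adj_getVert_succ (by lia)
  · simp only [h, Nat.mod_self]
    rw [hlen, Walk.getVert_length]
    simpa using p.adj_getVert_succ (i := 0) (by lia)

theorem exists_isCyclePerm_of_isCycle {u : V} {p : F.Walk u u} (hp : p.IsCycle) :
    ∃ τ : Equiv.Perm V, IsCyclePerm F τ ∧ ∀ v, τ v ≠ v ↔ v ∈ p.support := by
  classical
  have hlen : 3 ≤ p.support.tail.length := by simpa using hp.three_le_length
  have hmem : ∀ v, v ∈ p.support ↔ v ∈ p.support.tail := fun v =>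
    ⟨fun h => (Walk.mem_support_iff _).1 h |>.elim
      (fun h => h ▸ Walk.end_mem_tail_support hp.not_nil) id, List.mem_of_mem_tail⟩
  have hmoved : ∀ {v}, p.support.tail.formPerm v ≠ v → v ∈ p.support.tail := fun hv => by
    by_contra hvl
    exact hv (List.formPerm_apply_of_notMem hvl)
  refine ⟨p.support.tail.formPerm, fun v hv => ?_, fun v => ?_⟩
  · exact ⟨adj_formPerm_of_isCycle hp (hmoved hv),
      formPerm_formPerm_apply_ne hp.support_nodup hlen (hmoved hv)⟩
  · rw [hmem]
    exact ⟨hmoved, fun hv => (adj_formPerm_of_isCycle hp hv).ne'⟩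

theorem exists_isCyclePerm_isAcyclic_offCycles [Finite V] (hG : IsCubic G) (hB : B ≤ G) :
    ∃ σ : Equiv.Perm V, IsCyclePerm B σ ∧ (offCycles B σ).IsAcyclic := by
  classical
  have := Fintype.ofFinite V
  obtain ⟨σ, hσ, hmax⟩ := Set.Finite.exists_maximalFor (fun σ : Equiv.Perm V => σ.support.card)
    {σ | IsCyclePerm B σ} (Set.toFinite _) ⟨1, fun v hv => absurd rfl hv⟩
  refine ⟨σ, hσ, fun u p hp => ?_⟩
  obtain ⟨τ, hτ, hsupp⟩ := exists_isCyclePerm_of_isCycle hp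
  have hdisj : σ.Disjoint τ := fun v => or_iff_not_imp_right.2 fun hv =>
    hσ.apply_eq_of_isCycle hG hB hp ((hsupp v).1 hv)
  have hτ' : IsCyclePerm B τ := fun v hv => ⟨(hτ v hv).1.1, (hτ v hv).2⟩
  have hpos : 0 < τ.support.card := Finset.card_pos.2
    ⟨u, Equiv.Perm.mem_support.2 ((hsupp u).2 p.start_mem_support)⟩
  have hle := hmax (hσ.mul hτ' hdisj) (by simp only [hdisj.card_support_mul]; lia)
  simp only [hdisj.card_support_mul] at hle
  lia

/-- A depth function on a forest `T`: adjacent vertices differ in depth by one, and every vertex of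
positive depth has exactly one neighbour of smaller depth, its parent. -/
structure IsDepth (T : SimpleGraph V) (d : V → ℕ) : Prop where
  adj : ∀ {u v}, T.Adj u v → d u = d v + 1 ∨ d v = d u + 1
  unique : ∀ {u a b}, T.Adj u a → T.Adj u b → d a < d u → d b < d u → a = b
  exists_lower : ∀ {u}, 0 < d u → ∃ a, T.Adj u a ∧ d a < d u

theorem exists_isPath_penultimate_eq {r u c : V} (hr : T.Reachable r u) (hc : T.Adj u c)
    (hd : T.dist r c < T.dist r u) : ∃ q : T.Walk r u, q.IsPath ∧ q.penultimate = c := by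
  classical
  obtain ⟨q, hq, hlen⟩ := (hr.trans hc.reachable).exists_path_of_dist
  refine ⟨q.concat hc.symm, hq.concat (fun hmem => ?_) hc.symm, by simp⟩
  have := dist_le (q.takeUntil u hmem)
  have := q.length_takeUntil_le_length hmem
  lia

theorem exists_adj_dist_lt {r u : V} (hr : T.Reachable r u) (hne : r ≠ u) :
    ∃ a, T.Adj u a ∧ T.dist r a < T.dist r u := by
  obtain ⟨q, -, hlen⟩ := hr.exists_path_of_dist
  have hnil : ¬ q.Nil := Walk.not_nil_of_ne hne
  refine ⟨q.penultimate, (q.adj_penultimate hnil).symm, ?_⟩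
  have hdrop : q.dropLast.length < q.length := by
    have := Walk.not_nil_iff_lt_length.1 hnil
    simp
    lia
  exact (dist_le q.dropLast).trans_lt (hlen ▸ hdrop)

theorem exists_isDepth (hT : T.IsAcyclic) : ∃ d : V → ℕ, IsDepth T d := by
  let root : V → V := fun v => (T.connectedComponentMk v).out
  have hroot : ∀ v, T.Reachable (root v) v := fun v =>
    ConnectedComponent.exact (T.connectedComponentMk v).out_eq
  have hroot_adj : ∀ {u v}, T.Adj u v → root v = root u := fun h => by
    simp only [root, ConnectedComponent.sound h.reachable]
  refine ⟨fun v => T.dist (root v) v, fun {u v} h => ?_, fun {u a b} ha hb hda hdb => ?_,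
    fun {u} hu => ?_⟩
  · simp only [hroot_adj h]
    exact hT.dist_eq_dist_add_one_of_adj_of_reachable _ h (hroot u)
  · simp only [hroot_adj ha] at hda
    simp only [hroot_adj hb] at hdb
    obtain ⟨q, hq, rfl⟩ := exists_isPath_penultimate_eq (hroot u) ha hda
    obtain ⟨q', hq', rfl⟩ := exists_isPath_penultimate_eq (hroot u) hb hdb
    have := congrArg Subtype.val ((hT.subsingleton_path _ _).elim ⟨q, hq⟩ ⟨q', hq'⟩)
    rw [show q = q' from this]
  · have hne : root u ≠ u := fun h => hu.ne' <| by simp only [h, dist_self]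
    obtain ⟨a, ha, hlt⟩ := exists_adj_dist_lt (hroot u) hne
    exact ⟨a, ha, by simpa only [hroot_adj ha] using hlt⟩

end CyclesAndForests

/-! ### Identifying variables -/

section Identification

variable {Q X : Type*}

theorem ncard_preimage_le_mul {Y : Type*} [Finite X] {f : X → Y} {q : ℕ}
    (h : ∀ y, {x | f x = y}.ncard ≤ q) {Z : Set Y} (hZ : Z.Finite) :
    (f ⁻¹' Z).ncard ≤ q * Z.ncard := by
  classical
  have := Fintype.ofFinite X
  rw [Set.ncard_eq_toFinset_card' (f ⁻¹' Z), Set.ncard_eq_toFinset_card Z hZ]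
  refine Finset.card_le_mul_card_image_of_maps_to (f := f) (by simp) q fun y _ => ?_
  rw [← Set.ncard_coe_finset]
  exact (Set.ncard_le_ncard (fun x hx => (Finset.mem_filter.1 hx).2) (Set.toFinite _)).trans (h y)

theorem ncard_iterate_fibre_le [Finite X] {t : X → X} {q : ℕ}
    (h : ∀ x, {e | t e = x}.ncard ≤ q) (n : ℕ) (x : X) : {e | t^[n] e = x}.ncard ≤ q ^ n := by
  induction n generalizing x with
  | zero => simp
  | succ n ih =>
    rw [pow_succ']
    exact (ncard_preimage_le_mul h (Z := {y | t^[n] y = x}) (Set.toFinite _)).trans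
      (Nat.mul_le_mul_left _ (ih x))

theorem apply_iterate_eq_of_rank_le {t : X → X} {rk : X → ℕ}
    (hrk : ∀ e, t e ≠ e → rk (t e) < rk e) {n : ℕ} {e : X} (he : rk e ≤ n) :
    t (t^[n] e) = t^[n] e := by
  induction n generalizing e with
  | zero =>
    by_contra h
    have := hrk e h
    lia
  | succ n ih =>
    by_cases h : t e = e
    · rw [Function.iterate_fixed h, h]
    · rw [Function.iterate_succ_apply]
      exact ih (by have := hrk e h; lia)

theorem exists_parity_of_rank_le {t : X → X} {rk : X → ℕ}
    (hrk : ∀ e, t e ≠ e → rk (t e) < rk e) (s : X → Bool) (n : ℕ) :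
    ∃ k : X → Bool, ∀ e, rk e ≤ n →
      (t e = e → k e = false) ∧ (t e ≠ e → k e = xor (s e) (k (t e))) := by
  classical
  induction n with
  | zero => exact ⟨fun _ => false, fun e he => ⟨fun _ => rfl, fun h => by have := hrk e h; lia⟩⟩
  | succ n ih =>
    obtain ⟨k, hk⟩ := ih
    refine ⟨fun e => if t e = e then false else xor (s e) (k (t e)), fun e he =>
      ⟨fun h => if_pos h, fun h => ?_⟩⟩
    have hte := hk (t e) (by have := hrk e h; lia)
    simp only [if_neg h]
    split_ifs with htt
    · rw [hte.1 htt]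
    · rw [hte.2 htt]

/- The layers `{x | f^[j + 1] x = y, f^[j] x ≠ y}` of the tree above `y` do not branch after the
first one. -/
theorem ncard_iterate_fibre_le_of_not_branching [Finite X] {f : X → X}
    (htwo : ∀ y, {x | f x = y ∧ x ≠ y}.ncard ≤ 2)
    (hone : ∀ y, f y ≠ y → {x | f x = y ∧ x ≠ y}.Subsingleton) (n : ℕ) (y : X) :
    {x | f^[n] x = y}.ncard ≤ 2 * n + 1 := by
  let layer : ℕ → Set X := fun j => {x | f^[j + 1] x = y ∧ f^[j] x ≠ y}
  have hmoved : ∀ {j x}, x ∈ layer (j + 1) → x ≠ f x ∧ f (f x) ≠ f x := by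
    rintro j x ⟨h1, h2⟩
    rw [Function.iterate_succ_apply] at h1 h2
    refine ⟨fun h => h2 ?_, fun h => h2 ?_⟩
    · rw [← h, Function.iterate_fixed h.symm] at h1 ⊢
      exact h1
    · rw [Function.iterate_fixed h] at h1 ⊢
      exact h1
  have hlayer : ∀ j, (layer j).ncard ≤ 2 := by
    intro j
    induction j with
    | zero => exact htwo y
    | succ j ih =>
      refine le_trans (Set.ncard_le_ncard_of_injOn f (fun x hx => ?_) ?_ (Set.toFinite _)) ih
      · obtain ⟨h1, h2⟩ := hx
        rw [Function.iterate_succ_apply] at h1 h2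
        exact ⟨h1, h2⟩
      · intro x hx x' hx' hxx
        exact hone (f x) (hmoved hx).2 ⟨rfl, (hmoved hx).1⟩ ⟨hxx.symm, hxx ▸ (hmoved hx').1⟩
  induction n with
  | zero => simp
  | succ n ih =>
    have hsub : {x | f^[n + 1] x = y} ⊆ {x | f^[n] x = y} ∪ layer n := fun x hx => by
      by_cases h : f^[n] x = y
      · exact Or.inl h
      · exact Or.inr ⟨hx, h⟩
    have := (Set.ncard_le_ncard hsub (Set.toFinite _)).trans (Set.ncard_union_le _ _)
    have := hlayer n
    lia

section Triples

variable {pos : Q → Fin 3 → X}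

/-- The map on variables sending the variable owned by a triple to its referenced variable, and
fixing the variables without an owner. -/
noncomputable def redirect (pos : Q → Fin 3 → X) (owned ref : Q → Fin 3) : X → X :=
  Function.extend (fun q => pos q (owned q)) (fun q => pos q (ref q)) id

theorem exists_owner_of_redirect_ne {owned ref : Q → Fin 3} {x : X}
    (hx : redirect pos owned ref x ≠ x) :
    ∃ q, pos q (owned q) = x := by
  by_contra h
  exact hx (Function.extend_apply' _ _ _ h)

theorem exists_rank_redirect {owned ref : Q → Fin 3}
    (hinj : Function.Injective fun q => pos q (owned q)) {level : Q → ℕ} {D : ℕ}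
    (hlevel : ∀ q, level q < D)
    (href : ∀ q q', pos q' (owned q') = pos q (ref q) → level q' < level q) :
    ∃ rk : X → ℕ, (∀ x, rk x ≤ D) ∧
      ∀ x, redirect pos owned ref x ≠ x → rk (redirect pos owned ref x) < rk x := by
  let rk : X → ℕ := Function.extend (fun q => pos q (owned q)) (fun q => level q + 1) 0
  have hown : ∀ q, rk (pos q (owned q)) = level q + 1 := fun q => hinj.extend_apply _ _ _
  refine ⟨rk, fun x => ?_, fun x hx => ?_⟩
  · by_cases h : ∃ q, pos q (owned q) = x
    · obtain ⟨q, rfl⟩ := h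
      exact (hown q).trans_le (hlevel q)
    · exact (Function.extend_apply' _ _ _ h).trans_le D.zero_le
  · obtain ⟨q, rfl⟩ := exists_owner_of_redirect_ne hx
    rw [redirect, hinj.extend_apply, hown]
    by_cases h : ∃ q', pos q' (owned q') = pos q (ref q)
    · obtain ⟨q', hq'⟩ := h
      rw [← hq', hown]
      exact Nat.succ_lt_succ (href q q' hq')
    · rw [show rk (pos q (ref q)) = 0 from Function.extend_apply' _ _ _ h]
      exact Nat.succ_pos _

variable [Finite Q]

theorem three_mul_card_le (hpos : ∀ x, {p : Q × Fin 3 | pos p.1 p.2 = x}.ncard ≤ 2)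
    {S : Finset Q} {Y : Finset X} (hSY : ∀ q ∈ S, ∀ i, pos q i ∈ Y) :
    3 * S.card ≤ 2 * Y.card := by
  classical
  have := Finset.card_le_mul_card_image_of_maps_to (s := S ×ˢ (Finset.univ : Finset (Fin 3)))
    (t := Y) (f := fun p => pos p.1 p.2) (fun p hp => hSY _ (Finset.mem_product.1 hp).1 _) 2
    fun x _ => by
      rw [← Set.ncard_coe_finset]
      exact (Set.ncard_le_ncard (fun p hp => (Finset.mem_filter.1 hp).2)
        (Set.toFinite _)).trans (hpos x)
  simpa [mul_comm 3] using this

theorem exists_injective_owned (hpos : ∀ x, {p : Q × Fin 3 | pos p.1 p.2 = x}.ncard ≤ 2) :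
    ∃ i : Q → Fin 3, Function.Injective fun q => pos q (i q) := by
  classical
  obtain ⟨own, hinj, hown⟩ := (Finset.all_card_le_biUnion_card_iff_exists_injective
    (fun q => Finset.univ.image (pos q))).mp fun S => by
      have := three_mul_card_le hpos (S := S) (Y := S.biUnion fun q => Finset.univ.image (pos q))
        fun q hq i => Finset.mem_biUnion.2 ⟨q, hq, by simp⟩
      lia
  choose i hi using fun q => show ∃ i, pos q i = own q by simpa using hown q
  exact ⟨i, by simpa only [hi] using hinj⟩

/- Repeatedly remove the triples that contain a variable not owned by a remaining triple; by double
counting at most two thirds of the triples remain in each round. -/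
theorem exists_level (hpos : ∀ x, {p : Q × Fin 3 | pos p.1 p.2 = x}.ncard ≤ 2) {own : Q → X}
    (hown : Function.Injective own) (D : ℕ) (S : Finset Q) (hD : 2 ^ D * S.card < 3 ^ D) :
    ∃ (level : Q → ℕ) (ref : Q → Fin 3), (∀ q ∈ S, level q < D) ∧
      ∀ q ∈ S, ∀ q' ∈ S, own q' = pos q (ref q) → level q' < level q := by
  classical
  induction D generalizing S with
  | zero =>
    obtain rfl : S = ∅ := Finset.card_eq_zero.1 (by simpa using hD)
    exact ⟨0, 0, by simp, by simp⟩
  | succ D ih =>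
    let S' := S.filter fun q => ∀ i, pos q i ∈ S.image own
    have hcard : 3 * S'.card ≤ 2 * S.card := by
      rw [← Finset.card_image_of_injective S hown]
      exact three_mul_card_le hpos fun q hq => (Finset.mem_filter.1 hq).2
    obtain ⟨level, ref, hlevel, href⟩ := ih S' <| by
      rw [pow_succ, pow_succ] at hD
      have := Nat.mul_le_mul_left (2 ^ D) hcard
      lia
    have hfree : ∀ q, ∃ i, q ∈ S → q ∉ S' → ∀ q' ∈ S, own q' ≠ pos q i := by
      intro q
      by_contra! h
      have hq := h 0
      refine hq.2.1 (Finset.mem_filter.2 ⟨hq.1, fun i => ?_⟩)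
      obtain ⟨-, -, q', hq', h'⟩ := h i
      exact h' ▸ Finset.mem_image_of_mem _ hq'
    choose free hfree using hfree
    refine ⟨fun q => if q ∈ S' then level q + 1 else 0,
      fun q => if q ∈ S' then ref q else free q, fun q _ => ?_, fun q hq q' hq' h => ?_⟩
    · beta_reduce
      split_ifs with h
      · exact Nat.succ_lt_succ (hlevel q h)
      · exact Nat.succ_pos D
    · by_cases hqS : q ∈ S'
      · simp only [if_pos hqS] at h ⊢
        split_ifs with hqS'
        · exact Nat.succ_lt_succ (href q hqS q' hqS' h)
        · exact Nat.succ_pos _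
      · simp only [if_neg hqS] at h
        exact absurd h (hfree q hq hqS q' hq')

variable [Finite X] {owned ref : Q → Fin 3}

theorem ncard_redirect_iterate_fibre_le
    (hpos : ∀ x, {p : Q × Fin 3 | pos p.1 p.2 = x}.ncard ≤ 2)
    (hinj : Function.Injective fun q => pos q (owned q)) (n : ℕ) (x : X) :
    {y | (redirect pos owned ref)^[n] y = x}.ncard ≤ 2 * n + 1 := by
  classical
  have happly : ∀ q, redirect pos owned ref (pos q (owned q)) = pos q (ref q) :=
    fun q => hinj.extend_apply _ _ _
  refine ncard_iterate_fibre_le_of_not_branching (fun y => ?_) (fun y hy => ?_) n x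
  · have hsub : {x | redirect pos owned ref x = y ∧ x ≠ y} ⊆
        (fun p : Q × Fin 3 => pos p.1 (owned p.1)) '' {p : Q × Fin 3 | pos p.1 p.2 = y} := by
      rintro x ⟨hx, hxy⟩
      obtain ⟨q, rfl⟩ := exists_owner_of_redirect_ne (hx ▸ hxy.symm)
      exact ⟨(q, ref q), (happly q).symm.trans hx, rfl⟩
    exact (Set.ncard_le_ncard hsub (Set.toFinite _)).trans
      ((Set.ncard_image_le (Set.toFinite _)).trans (hpos y))
  · rintro x ⟨hx, hxy⟩ x' ⟨hx', hxy'⟩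
    obtain ⟨q₀, rfl⟩ := exists_owner_of_redirect_ne hy
    obtain ⟨q, rfl⟩ := exists_owner_of_redirect_ne (hx ▸ hxy.symm)
    obtain ⟨q', rfl⟩ := exists_owner_of_redirect_ne (hx' ▸ hxy'.symm)
    rw [happly] at hx hx'
    by_contra hne
    have hsub : ({(q₀, owned q₀), (q, ref q), (q', ref q')} : Set (Q × Fin 3)) ⊆
        {p | pos p.1 p.2 = pos q₀ (owned q₀)} := by
      rintro p (rfl | rfl | rfl)
      exacts [rfl, hx, hx']
    have hthree : ({(q₀, owned q₀), (q, ref q), (q', ref q')} : Set (Q × Fin 3)).ncard = 3 :=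
      Set.ncard_eq_three.mpr ⟨_, _, _, by grind, by grind, by grind, rfl⟩
    have := (Set.ncard_le_ncard hsub (Set.toFinite _)).trans (hpos _)
    lia

theorem exists_identification_nonconstant {sg : Q → Fin 3 → Bool}
    (hpos : ∀ x, {p : Q × Fin 3 | pos p.1 p.2 = x}.ncard ≤ 2) {D : ℕ}
    (hD : 2 ^ D * Nat.card Q < 3 ^ D) :
    ∃ (ρ : X → X) (κ : X → Bool), (∀ x, {y | ρ y = x}.ncard ≤ 2 * D + 1) ∧
      ∀ (ω : X → Bool) (q : Q), ∃ i j,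
        xor (sg q i) (xor (κ (pos q i)) (ω (ρ (pos q i)))) ≠
        xor (sg q j) (xor (κ (pos q j)) (ω (ρ (pos q j)))) := by
  classical
  have := Fintype.ofFinite Q
  obtain ⟨owned, hinj⟩ := exists_injective_owned hpos
  obtain ⟨level, ref, hlevel, href⟩ := exists_level hpos hinj D Finset.univ
    (by rwa [Finset.card_univ, ← Nat.card_eq_fintype_card])
  obtain ⟨rk, hrkD, hrk⟩ := exists_rank_redirect hinj (fun q => hlevel q (Finset.mem_univ q))
    fun q q' => href q (Finset.mem_univ q) q' (Finset.mem_univ q')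
  set f := redirect pos owned ref
  have hfown : ∀ q, f (pos q (owned q)) = pos q (ref q) := fun q => hinj.extend_apply _ _ _
  obtain ⟨κ, hκ⟩ := exists_parity_of_rank_le hrk (Function.extend (fun q => pos q (owned q))
    (fun q => !xor (sg q (owned q)) (sg q (ref q))) fun _ => false) D
  refine ⟨f^[D], κ, ncard_redirect_iterate_fibre_le hpos hinj D, fun ω q =>
    ⟨owned q, ref q, ?_⟩⟩
  have hne : f (pos q (owned q)) ≠ pos q (owned q) := fun h =>
    (href q (Finset.mem_univ q) q (Finset.mem_univ q) (h.symm.trans (hfown q))).false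
  have hκq := (hκ _ (hrkD _)).2 hne
  rw [hinj.extend_apply, hfown] at hκq
  have hfD : f^[D] (pos q (owned q)) = f^[D] (pos q (ref q)) := by
    rw [← apply_iterate_eq_of_rank_le hrk (hrkD (pos q (owned q))),
      ← Function.iterate_succ_apply' f D, Function.iterate_succ_apply, hfown]
  rw [hκq, hfD]
  cases sg q (owned q) <;> cases sg q (ref q) <;> cases κ (pos q (ref q)) <;>
    cases ω (f^[D] (pos q (ref q))) <;> decide

end Triples

end Identification

/-! ### Frames -/

section Frame

variable {V : Type*} {G A : SimpleGraph V}

/-- A choice of directed cycles (the nontrivial orbits of `σ`) and a forest with depth function `d`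
that partition the edges of `G` outside `A`. It comes with a selection of neighbours of each vertex:
the third neighbour `nb` of a vertex on a directed cycle, two children `fst` and `snd` and the
parent `par` in the forest, a child `ex` on a directed cycle, and a neighbour `anb` in `A`. The
values are arbitrary where no such neighbour exists. -/
structure Frame (G A : SimpleGraph V) where
  σ : Equiv.Perm V
  d : V → ℕ
  nb : V → V
  fst : V → V
  snd : V → V
  par : V → V
  ex : V → V
  anb : V → V
  cyc : IsCyclePerm (G \ A) σ
  depth : IsDepth (offCycles (G \ A) σ) d
  nb_spec : ∀ v, G.Adj v (nb v) ∧ nb v ≠ σ v ∧ nb v ≠ σ.symm v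
  children_spec : ∀ u, σ u = u → (∀ w, ¬ A.Adj u w) → fst u ≠ snd u ∧
    ((offCycles (G \ A) σ).Adj u (fst u) ∧ d u < d (fst u)) ∧
    ((offCycles (G \ A) σ).Adj u (snd u) ∧ d u < d (snd u))
  par_spec : ∀ u, 0 < d u → (offCycles (G \ A) σ).Adj u (par u) ∧ d (par u) < d u
  ex_spec : ∀ u y, (offCycles (G \ A) σ).Adj u y → d u < d y → σ y ≠ y →
    (offCycles (G \ A) σ).Adj u (ex u) ∧ d u < d (ex u)
  ex_mem : ∀ u, (offCycles (G \ A) σ).Adj u (ex u) → σ (ex u) ≠ ex u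
  anb_spec : ∀ u w, A.Adj u w → A.Adj u (anb u)

theorem offCycles_adj_of_fixed {B : SimpleGraph V} {σ : Equiv.Perm V} {u w : V} (hu : σ u = u)
    (h : B.Adj u w) : (offCycles B σ).Adj u w :=
  ⟨h, by rw [hu]; exact h.ne, fun hw => h.ne (σ.injective (hu.trans hw.symm))⟩

theorem IsDepth.lt_or_lt {T : SimpleGraph V} {d : V → ℕ} (hd : IsDepth T d) {u a b : V}
    (hab : a ≠ b) (ha : T.Adj u a) (hb : T.Adj u b) : d u < d a ∨ d u < d b := by
  by_contra! h
  have := hd.adj ha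
  have := hd.adj hb
  exact hab (hd.unique ha hb (by lia) (by lia))

theorem IsDepth.exists_two_children {T : SimpleGraph V} {d : V → ℕ} (hd : IsDepth T d)
    {u a b c : V} (hab : a ≠ b) (hac : a ≠ c) (hbc : b ≠ c) (ha : T.Adj u a) (hb : T.Adj u b)
    (hc : T.Adj u c) :
    ∃ x y, x ≠ y ∧ (T.Adj u x ∧ d u < d x) ∧ (T.Adj u y ∧ d u < d y) := by
  have h1 := hd.lt_or_lt hab ha hb
  have h2 := hd.lt_or_lt hac ha hc
  have h3 := hd.lt_or_lt hbc hb hc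
  by_cases ea : d u < d a
  · rcases h3 with eb | ec
    · exact ⟨a, b, hab, ⟨ha, ea⟩, hb, eb⟩
    · exact ⟨a, c, hac, ⟨ha, ea⟩, hc, ec⟩
  · exact ⟨b, c, hbc, ⟨hb, h1.resolve_left ea⟩, hc, h2.resolve_left ea⟩

theorem IsCubic.exists_two_children (hG : IsCubic G) {σ : Equiv.Perm V} {d : V → ℕ}
    (hd : IsDepth (offCycles (G \ A) σ) d) {u : V} (hu : σ u = u) (hA : ∀ w, ¬ A.Adj u w) :
    ∃ x y, x ≠ y ∧ ((offCycles (G \ A) σ).Adj u x ∧ d u < d x) ∧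
      ((offCycles (G \ A) σ).Adj u y ∧ d u < d y) := by
  obtain ⟨a, b, c, hab, hac, hbc, habc⟩ := hG.exists_three u
  have hT : ∀ {w}, w ∈ ({a, b, c} : Set V) → (offCycles (G \ A) σ).Adj u w := fun {w} hw =>
    offCycles_adj_of_fixed hu ⟨(habc ▸ hw : w ∈ G.neighborSet u), hA w⟩
  exact hd.exists_two_children hab hac hbc (hT (by simp)) (hT (by simp)) (hT (by simp))

theorem nonempty_frame [Finite V] (hG : IsCubic G) (A : SimpleGraph V) :
    Nonempty (Frame G A) := by
  classical
  obtain ⟨σ, hσ, hac⟩ := exists_isCyclePerm_isAcyclic_offCycles hG (sdiff_le : G \ A ≤ G)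
  obtain ⟨d, hd⟩ := exists_isDepth hac
  choose nb hnb using fun v => hG.exists_third v (σ v) (σ.symm v)
  have hchildren : ∀ u, ∃ x y, σ u = u → (∀ w, ¬ A.Adj u w) → x ≠ y ∧
      ((offCycles (G \ A) σ).Adj u x ∧ d u < d x) ∧
      ((offCycles (G \ A) σ).Adj u y ∧ d u < d y) := fun u =>
    if h : σ u = u ∧ ∀ w, ¬ A.Adj u w then
      (hG.exists_two_children hd h.1 h.2).imp fun _ => Exists.imp fun _ h _ _ => h
    else ⟨u, u, fun h1 h2 => absurd ⟨h1, h2⟩ h⟩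
  have hparent : ∀ u, ∃ w, 0 < d u → (offCycles (G \ A) σ).Adj u w ∧ d w < d u := fun u =>
    if h : 0 < d u then (hd.exists_lower h).imp fun _ h _ => h else ⟨u, fun h' => absurd h' h⟩
  have hcycle : ∀ u, ∃ w, (∀ y, (offCycles (G \ A) σ).Adj u y → d u < d y → σ y ≠ y →
      (offCycles (G \ A) σ).Adj u w ∧ d u < d w) ∧
      ((offCycles (G \ A) σ).Adj u w → σ w ≠ w) := fun u =>
    if h : ∃ y, (offCycles (G \ A) σ).Adj u y ∧ d u < d y ∧ σ y ≠ y then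
      h.imp fun _ hy => ⟨fun _ _ _ _ => ⟨hy.1, hy.2.1⟩, fun _ => hy.2.2⟩
    else ⟨u, fun y h1 h2 h3 => absurd ⟨y, h1, h2, h3⟩ h, fun h => absurd rfl h.ne⟩
  have hA : ∀ u, ∃ w, ∀ x, A.Adj u x → A.Adj u w := fun u =>
    if h : ∃ y, A.Adj u y then h.imp fun _ hy _ _ => hy else ⟨u, fun x hx => absurd ⟨x, hx⟩ h⟩
  choose fst snd hfs using hchildren
  choose par hpar using hparent
  choose ex hex using hcycle
  choose anb hanb using hA
  exact ⟨⟨σ, d, nb, fst, snd, par, ex, anb, hσ, hd, hnb, hfs, hpar, fun u => (hex u).1,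
    fun u => (hex u).2, hanb⟩⟩

namespace Frame

variable (F : Frame G A) {u y v : V}

/-- The forest of a frame. -/
def T : SimpleGraph V := offCycles (G \ A) F.σ

/-- The direction of the edges outside `A`: away from the roots of the forest, or along the
directed cycles. -/
def Dir (u y : V) : Prop := (F.T.Adj u y ∧ F.d u < F.d y) ∨ (F.σ u = y ∧ F.σ u ≠ u)

open Classical in
/-- The edge `uy` directed from `u` to `y` is given the colour opposite to that of the edge from `u`
to `target u y`, if this is different from `y`. -/
noncomputable def target (u y : V) : V :=
  if F.σ u = y then F.nb u
  else if F.σ u ≠ u then y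
  else if ∃ w, A.Adj u w then (if ∀ w, A.Adj u w → w = F.anb u then F.anb u else y)
  else if Even (F.d u) then (if y = F.snd u then F.fst u else y)
  else if y = F.ex u then y else F.par u

open Classical in
/-- The map on edges given by `target`, fixing the edges without a direction. -/
noncomputable def tie (e : Sym2 V) : Sym2 V :=
  if h : ∃ p : V × V, F.Dir p.1 p.2 ∧ e = s(p.1, p.2) then
    s(h.choose.1, F.target h.choose.1 h.choose.2) else e

open Classical in
/-- The potential that makes the recursion along `tie` well-founded. -/
noncomputable def rank (e : Sym2 V) : ℕ :=
  if ∃ u, F.σ u ≠ u ∧ e = s(u, F.σ u) then 4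
  else if ∃ u y, F.Dir u y ∧ e = s(u, y) ∧ F.σ u = u ∧ (∀ w, ¬ A.Adj u w) ∧ ¬ Even (F.d u) ∧
    y ≠ F.ex u then 3
  else if F.tie e ≠ e then 2
  else if e ∈ A.edgeSet then 0 else 1

variable {F}

theorem Dir.adj (h : F.Dir u y) : G.Adj u y ∧ ¬ A.Adj u y := by
  rcases h with h | ⟨rfl, h⟩
  · exact h.1.1
  · exact (F.cyc u h).1

theorem Dir.not_symm (h : F.Dir u y) : ¬ F.Dir y u := by
  rintro (h' | ⟨h1, h2⟩)
  · rcases h with h | ⟨h1, _⟩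
    · exact absurd h.2 (not_lt.mpr h'.2.le)
    · exact h'.1.2.2 h1
  · rcases h with h | ⟨rfl, h⟩
    · exact h.1.2.2 h1
    · exact (F.cyc u h).2 h1

theorem Dir.unique {u' y' : V} (h : F.Dir u y) (h' : F.Dir u' y') (he : s(u, y) = s(u', y')) :
    u = u' ∧ y = y' := by
  rcases Sym2.eq_iff.mp he with h1 | ⟨rfl, rfl⟩
  · exact h1
  · exact absurd h' h.not_symm

theorem pos_of_not_even (h : ¬ Even (F.d u)) : 0 < F.d u :=
  Nat.pos_of_ne_zero fun h0 => h (by rw [h0]; exact Even.zero)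

theorem even_par_of_not_even (h : ¬ Even (F.d u)) : Even (F.d (F.par u)) := by
  have hp := F.par_spec u (pos_of_not_even h)
  have h1 : F.d u = F.d (F.par u) + 1 := by have := F.depth.adj hp.1; lia
  rwa [h1, Nat.even_add_one, not_not] at h

theorem T_ne_cycle_edge {w : V} (h : F.T.Adj u y) : s(u, y) ≠ s(w, F.σ w) := by
  intro he
  rcases Sym2.eq_iff.mp he with ⟨rfl, h1⟩ | ⟨h1, h2⟩
  · exact h.2.1 h1.symm
  · exact h.2.2 (by rw [h1, h2])

variable (F)

theorem nb_ne_cycle_edge {w : V} (hw : F.σ w ≠ w) : s(v, F.nb v) ≠ s(w, F.σ w) := by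
  intro h
  rcases Sym2.eq_iff.mp h with ⟨rfl, h⟩ | ⟨h1, h2⟩
  · exact (F.nb_spec v).2.1 h
  · exact (F.nb_spec v).2.2 (by rw [h2, h1, F.σ.symm_apply_apply])

theorem target_cycle (u : V) : F.target u (F.σ u) = F.nb u := if_pos rfl

theorem target_of_cycle (h : F.T.Adj u y) (hu : F.σ u ≠ u) : F.target u y = y := by
  rw [target, if_neg h.2.1, if_pos hu]

open Classical in
theorem target_of_adj (h : F.T.Adj u y) (hu : F.σ u = u) (hA : ∃ w, A.Adj u w) :
    F.target u y = if ∀ w, A.Adj u w → w = F.anb u then F.anb u else y := by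
  rw [target, if_neg h.2.1, if_neg (not_not.mpr hu), if_pos hA]

open Classical in
theorem target_even (h : F.T.Adj u y) (hu : F.σ u = u) (hA : ∀ w, ¬ A.Adj u w)
    (he : Even (F.d u)) : F.target u y = if y = F.snd u then F.fst u else y := by
  rw [target, if_neg h.2.1, if_neg (not_not.mpr hu), if_neg (not_exists.2 hA), if_pos he]

open Classical in
theorem target_odd (h : F.T.Adj u y) (hu : F.σ u = u) (hA : ∀ w, ¬ A.Adj u w)
    (he : ¬ Even (F.d u)) : F.target u y = if y = F.ex u then y else F.par u := by
  rw [target, if_neg h.2.1, if_neg (not_not.mpr hu), if_neg (not_exists.2 hA), if_neg he]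

theorem tie_of_dir (h : F.Dir u y) : F.tie s(u, y) = s(u, F.target u y) := by
  have hex : ∃ p : V × V, F.Dir p.1 p.2 ∧ s(u, y) = s(p.1, p.2) := ⟨(u, y), h, rfl⟩
  obtain ⟨h1, h2⟩ := hex.choose_spec.1.unique h hex.choose_spec.2.symm
  rw [tie, dif_pos hex, h1, h2]

theorem tie_eq_self (h : F.Dir u y) (ht : F.target u y = y) : F.tie s(u, y) = s(u, y) := by
  rw [F.tie_of_dir h, ht]

theorem tie_of_not_dir {e : Sym2 V} (h : ∀ u y, F.Dir u y → e ≠ s(u, y)) : F.tie e = e := by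
  rw [tie, dif_neg]
  rintro ⟨p, hp, he⟩
  exact h _ _ hp he

theorem ne_of_mem_edgeSet {e : Sym2 V} (h : e ∈ A.edgeSet) (hd : F.Dir u y) : e ≠ s(u, y) :=
  fun he => hd.adj.2 ((he ▸ h : s(u, y) ∈ A.edgeSet))

theorem tie_of_mem_edgeSet {e : Sym2 V} (h : e ∈ A.edgeSet) : F.tie e = e :=
  F.tie_of_not_dir fun _ _ => F.ne_of_mem_edgeSet h

theorem tie_fst (hu : F.σ u = u) (hA : ∀ w, ¬ A.Adj u w) (he : Even (F.d u)) :
    F.tie s(u, F.fst u) = s(u, F.fst u) := by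
  obtain ⟨hne, hfst, -⟩ := F.children_spec u hu hA
  exact F.tie_eq_self (Or.inl hfst) (by rw [F.target_even hfst.1 hu hA he, if_neg hne])

theorem rank_le (e : Sym2 V) : F.rank e ≤ 4 := by
  unfold rank; split_ifs <;> lia

theorem rank_cycle (hu : F.σ u ≠ u) : F.rank s(u, F.σ u) = 4 := if_pos ⟨u, hu, rfl⟩

theorem rank_nb_lt_four : F.rank s(v, F.nb v) < 4 := by
  rw [rank, if_neg fun ⟨_, hw, he⟩ => F.nb_ne_cycle_edge hw he]
  split_ifs <;> lia

theorem two_le_rank {e : Sym2 V} (h : F.tie e ≠ e) : 2 ≤ F.rank e := by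
  rw [rank, if_pos h]
  split_ifs <;> lia

theorem rank_of_mem_edgeSet {e : Sym2 V} (h : e ∈ A.edgeSet) : F.rank e = 0 := by
  rw [rank, if_neg, if_neg, if_neg (not_not.2 (F.tie_of_mem_edgeSet h)), if_pos h]
  · rintro ⟨a, b, hab, he, -⟩
    exact F.ne_of_mem_edgeSet h hab he
  · rintro ⟨a, ha, he⟩
    exact F.ne_of_mem_edgeSet h (Or.inr ⟨rfl, ha⟩) he

theorem rank_of_odd (h : F.T.Adj u y) (hlt : F.d u < F.d y) (hu : F.σ u = u)
    (hA : ∀ w, ¬ A.Adj u w) (hd : ¬ Even (F.d u)) (hy : y ≠ F.ex u) : F.rank s(u, y) = 3 := by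
  rw [rank, if_neg fun ⟨_, _, he⟩ => T_ne_cycle_edge h he,
    if_pos ⟨u, y, Or.inl ⟨h, hlt⟩, rfl, hu, hA, hd, hy⟩]

theorem rank_of_even (h : F.T.Adj u y) (hlt : F.d u < F.d y) (hd : Even (F.d u)) :
    F.rank s(u, y) ≤ 2 ∧ (F.tie s(u, y) = s(u, y) → F.rank s(u, y) ≤ 1) := by
  rw [rank, if_neg fun ⟨_, _, he⟩ => T_ne_cycle_edge h he, if_neg]
  · refine ⟨by split_ifs <;> lia, fun htie => ?_⟩
    rw [if_neg (not_not.2 htie)]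
    split_ifs <;> lia
  · rintro ⟨a, b, hab, he, -, -, hodd, -⟩
    rw [(Dir.unique (Or.inl ⟨h, hlt⟩) hab he).1] at hd
    exact hodd hd

theorem rank_tie_lt_of_T (h : F.T.Adj u y) (hlt : F.d u < F.d y)
    (htie : F.tie s(u, y) ≠ s(u, y)) : F.rank (F.tie s(u, y)) < F.rank s(u, y) := by
  classical
  have htwo := F.two_le_rank htie
  have heq := F.tie_of_dir (Or.inl ⟨h, hlt⟩)
  have htarget : F.target u y ≠ y := fun ht => htie (by rw [heq, ht])
  rw [heq]
  have hu : F.σ u = u := by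
    by_contra hu
    exact htarget (F.target_of_cycle h hu)
  by_cases hA : ∃ w, A.Adj u w
  · rw [F.target_of_adj h hu hA] at htarget ⊢
    rw [if_pos (ite_ne_right_iff.1 htarget).1,
      F.rank_of_mem_edgeSet (e := s(u, F.anb u)) (hA.elim (F.anb_spec u))]
    lia
  push Not at hA
  by_cases heven : Even (F.d u)
  · rw [F.target_even h hu hA heven] at htarget ⊢
    rw [if_pos (ite_ne_right_iff.1 htarget).1]
    have hfst := (F.children_spec u hu hA).2.1
    exact ((F.rank_of_even hfst.1 hfst.2 heven).2 (F.tie_fst hu hA heven)).trans_lt htwo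
  · rw [F.target_odd h hu hA heven] at htarget ⊢
    have hex := (ite_ne_left_iff.1 htarget).1
    have hpar := F.par_spec u (pos_of_not_even heven)
    rw [if_neg hex, F.rank_of_odd h hlt hu hA heven hex, Sym2.eq_swap]
    exact Nat.lt_succ_of_le
      (F.rank_of_even hpar.1.symm hpar.2 (even_par_of_not_even heven)).1

theorem rank_tie_lt (e : Sym2 V) (h : F.tie e ≠ e) : F.rank (F.tie e) < F.rank e := by
  obtain ⟨u, y, hdir, rfl⟩ : ∃ u y, F.Dir u y ∧ e = s(u, y) := by
    by_contra! hnot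
    exact h (F.tie_of_not_dir hnot)
  rcases hdir with hT | ⟨rfl, hu⟩
  · exact F.rank_tie_lt_of_T hT.1 hT.2 h
  · rw [F.rank_cycle hu, F.tie_of_dir (Or.inr ⟨rfl, hu⟩), F.target_cycle]
    exact F.rank_nb_lt_four

end Frame

end Frame

section Ports

variable {V : Type*} {G A : SimpleGraph V} {W : Set V} {u v w y : V}

/-- A set of vertices containing all vertices at distance at most two from the edges of `A`. -/
def IsGuard (G A : SimpleGraph V) (W : Set V) : Prop :=
  ∀ v, v ∉ W → (∀ w, ¬ A.Adj v w) ∧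
    ∀ u, G.Adj v u → (∀ w, ¬ A.Adj u w) ∧ ∀ p, G.Adj u p → ∀ w, ¬ A.Adj p w

namespace Frame

section Slot

variable (F : Frame G A)

/-- The edge of the forest at a vertex of a directed cycle. -/
def port (v : V) : Sym2 V := s(v, F.nb v)

/-- The vertex `v` is on a directed cycle, and equal to `y` or an unselected child of `y`. -/
def Slot (y v : V) : Prop :=
  F.σ v ≠ v ∧ (v = y ∨ (F.σ y = y ∧ ¬ Even (F.d y) ∧ F.T.Adj y v ∧ F.d y < F.d v ∧ v ≠ F.ex y))

theorem T_adj_of_adj (hA : ∀ w, ¬ A.Adj u w) (h : G.Adj u w) (h1 : w ≠ F.σ u)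
    (h2 : w ≠ F.σ.symm u) : F.T.Adj u w :=
  ⟨⟨h, hA w⟩, h1.symm, fun h3 => h2 (by rw [← h3, F.σ.symm_apply_apply])⟩

theorem eq_nb_of_adj (hG : IsCubic G) (hv : F.σ v ≠ v) (h : G.Adj v w)
    (h1 : w ≠ F.σ v) (h2 : w ≠ F.σ.symm v) : w = F.nb v := by
  have e := F.cyc.adj_symm_apply hv
  obtain ⟨n1, n2, n3⟩ := F.nb_spec v
  rcases hG.eq_or_eq_or_eq (F.cyc v hv).1.1 e.1 n1 h (F.cyc.symm_apply_ne_apply hv).symm n2.symm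
    n3.symm with h | h | h
  · exact absurd h h1
  · exact absurd h h2
  · exact h

theorem eq_nb_of_T (hG : IsCubic G) (hv : F.σ v ≠ v) (h : F.T.Adj v w) : w = F.nb v :=
  F.eq_nb_of_adj hG hv h.1.1 h.2.1.symm fun hw => h.2.2 (hw ▸ F.σ.apply_symm_apply v)

theorem T_adj_nb (hA : ∀ w, ¬ A.Adj v w) : F.T.Adj v (F.nb v) :=
  F.T_adj_of_adj hA (F.nb_spec v).1 (F.nb_spec v).2.1 (F.nb_spec v).2.2

end Slot

variable {F : Frame G A}

theorem Slot.eq (hG : IsCubic G) {v' : V} (h : F.Slot y v) (h' : F.Slot y v') : v = v' := by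
  obtain ⟨h0, rfl | ⟨a1, a2, a3, a4, a5⟩⟩ := h
  · obtain ⟨-, rfl | h'⟩ := h'
    · rfl
    · exact absurd h'.1 h0
  · obtain ⟨h0', rfl | ⟨-, -, b3, b4, b5⟩⟩ := h'
    · exact absurd a1 h0'
    · by_contra hne
      have hp := F.par_spec y (pos_of_not_even a2)
      have he := F.ex_spec y v a3 a4 h0
      rcases hG.eq_or_eq_or_eq a3.1.1 b3.1.1 he.1.1.1 hp.1.1.1 hne a5 b5 with h | h | h <;>
        · rw [h] at hp
          lia

theorem exists_root_of_slot (h : F.T.Adj u y) (hlt : F.d u < F.d y) (hA : ∀ w, ¬ A.Adj u w)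
    (heven : F.σ u = u → Even (F.d u)) (hv : F.Slot y v) (n : ℕ) :
    ∃ u₀ y₀, F.Dir u₀ y₀ ∧ F.tie^[n + 1] s(u, y) = s(u₀, y₀) ∧
      (F.Slot y₀ v ∨ (F.σ u₀ = u₀ ∧ F.Slot (F.snd u₀) v)) := by
  classical
  have hdir : F.Dir u y := Or.inl ⟨h, hlt⟩
  by_cases hu : F.σ u = u
  · have htarget := F.target_even h hu hA (heven hu)
    by_cases hy : y = F.snd u
    · refine ⟨u, F.fst u, Or.inl (F.children_spec u hu hA).2.1, ?_, Or.inr ⟨hu, hy ▸ hv⟩⟩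
      rw [Function.iterate_succ_apply, F.tie_of_dir hdir, htarget, if_pos hy,
        Function.iterate_fixed (F.tie_fst hu hA (heven hu))]
    · exact ⟨u, y, hdir,
        Function.iterate_fixed (F.tie_eq_self hdir (htarget.trans (if_neg hy))) _, Or.inl hv⟩
  · exact ⟨u, y, hdir,
      Function.iterate_fixed (F.tie_eq_self hdir (F.target_of_cycle h hu)) _, Or.inl hv⟩

theorem exists_root_port (hW : IsGuard G A W) (hv : F.σ v ≠ v) (hvW : v ∉ W) :
    ∃ u₀ y₀, F.Dir u₀ y₀ ∧ F.tie^[4] (F.port v) = s(u₀, y₀) ∧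
      ((F.σ u₀ ≠ u₀ ∧ v = u₀) ∨ F.Slot y₀ v ∨ (F.σ u₀ = u₀ ∧ F.Slot (F.snd u₀) v)) := by
  classical
  obtain ⟨hA, hA'⟩ := hW v hvW
  have hT := F.T_adj_nb hA
  by_cases hd : F.d v < F.d (F.nb v)
  · have hdir : F.Dir v (F.nb v) := Or.inl ⟨hT, hd⟩
    exact ⟨v, F.nb v, hdir,
      Function.iterate_fixed (F.tie_eq_self hdir (F.target_of_cycle hT hv)) 4, Or.inl ⟨hv, rfl⟩⟩
  rw [port, Sym2.eq_swap]
  set u := F.nb v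
  have hlt : F.d u < F.d v := by
    have := F.depth.adj hT
    lia
  obtain ⟨hAu, hAu'⟩ := hA' u hT.1.1
  have hslot : F.Slot v v := ⟨hv, Or.inl rfl⟩
  by_cases heven : F.σ u = u → Even (F.d u)
  · obtain ⟨u₀, y₀, h⟩ := exists_root_of_slot hT.symm hlt hAu heven hslot 3
    exact ⟨u₀, y₀, h.1, h.2.1, Or.inr h.2.2⟩
  obtain ⟨hu, hodd⟩ := Classical.not_imp.1 heven
  have hdir : F.Dir u v := Or.inl ⟨hT.symm, hlt⟩
  have htarget := F.target_odd hT.symm hu hAu hodd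
  by_cases hex : v = F.ex u
  · exact ⟨u, v, hdir, Function.iterate_fixed
      (F.tie_eq_self hdir (htarget.trans (if_pos hex))) 4, Or.inr (Or.inl hslot)⟩
  · have hp := F.par_spec u (pos_of_not_even hodd)
    obtain ⟨u₀, y₀, h⟩ := exists_root_of_slot hp.1.symm hp.2 (hAu' _ hp.1.1.1)
      (fun _ => even_par_of_not_even hodd)
      (show F.Slot u v from ⟨hv, Or.inr ⟨hu, hodd, hT.symm, hlt, hex⟩⟩) 2
    refine ⟨u₀, y₀, h.1, ?_, Or.inr h.2.2⟩
    rw [Function.iterate_succ_apply, F.tie_of_dir hdir, htarget, if_neg hex, Sym2.eq_swap, h.2.1]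

theorem root_port_notMem (hW : IsGuard G A W) (hv : F.σ v ≠ v) (hvW : v ∉ W) :
    F.tie^[4] (F.port v) ∉ A.edgeSet := by
  obtain ⟨u₀, y₀, hdir, hx, -⟩ := exists_root_port hW hv hvW
  rw [hx]
  exact hdir.adj.2

theorem ncard_ports_le_two [Finite V] (hG : IsCubic G) (hW : IsGuard G A W) (e : Sym2 V) :
    {v | F.σ v ≠ v ∧ v ∉ W ∧ F.tie^[4] (F.port v) = e}.ncard ≤ 2 := by
  rcases Set.eq_empty_or_nonempty {v | F.σ v ≠ v ∧ v ∉ W ∧ F.tie^[4] (F.port v) = e} with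
    h | ⟨v₁, h1, h2, h3⟩
  · rw [h, Set.ncard_empty]
    exact Nat.zero_le 2
  obtain ⟨u₀, y₀, hdir, he, -⟩ := exists_root_port hW h1 h2
  rw [h3] at he
  have hsub : {v | F.σ v ≠ v ∧ v ∉ W ∧ F.tie^[4] (F.port v) = e} ⊆
      {v | (F.σ u₀ ≠ u₀ ∧ v = u₀) ∨ (F.σ u₀ = u₀ ∧ F.Slot (F.snd u₀) v)} ∪
        {v | F.Slot y₀ v} := by
    rintro v ⟨a1, a2, a3⟩
    obtain ⟨u', y', hdir', he', h⟩ := exists_root_port hW a1 a2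
    obtain ⟨rfl, rfl⟩ := hdir.unique hdir' (he.symm.trans (a3.symm.trans he'))
    exact h.elim (fun h => Or.inl (Or.inl h)) (Or.symm ∘ Or.imp_right Or.inr)
  refine (Set.ncard_le_ncard hsub (Set.toFinite _)).trans ((Set.ncard_union_le _ _).trans ?_)
  refine add_le_add (b := 1) (d := 1) ?_ ?_ <;> rw [Set.ncard_le_one (Set.toFinite _)]
  · rintro a (⟨ha, rfl⟩ | ⟨ha, ha'⟩) b (⟨hb, rfl⟩ | ⟨hb, hb'⟩)
    · rfl
    · exact absurd hb ha
    · exact absurd ha hb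
    · exact ha'.eq hG hb'
  · exact fun a ha b hb => Slot.eq hG ha hb

end Frame

end Ports

section Triples

variable {V : Type*} {σ : Equiv.Perm V} {W Q : Set V} {v : V}

/-- The triples `q, σ q, σ (σ q)` for `q` in `Q` are disjoint, contain no fixed point of `σ` and
avoid `W`. -/
def IsTripleFamily (σ : Equiv.Perm V) (W Q : Set V) : Prop :=
  (∀ q ∈ Q, σ q ≠ q ∧ ∀ i < 3, σ^[i] q ∉ W) ∧
    ∀ q ∈ Q, ∀ q' ∈ Q, ∀ i < 3, ∀ j < 3, σ^[i] q = σ^[j] q' → q = q' ∧ i = j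

theorem perm_iterate_ne (hv : σ v ≠ v) (n : ℕ) : σ (σ^[n] v) ≠ σ^[n] v := by
  rw [← Function.iterate_succ_apply' (σ : V → V), Function.iterate_succ_apply]
  exact fun h => hv (σ.injective.iterate n h)

theorem IsTripleFamily.insert (hQ : IsTripleFamily σ W Q) (hv : σ v ≠ v) (hvv : σ (σ v) ≠ v)
    (hW : ∀ i < 3, σ^[i] v ∉ W)
    (hcross : ∀ q ∈ Q, ∀ i < 3, ∀ j < 3, σ^[i] q ≠ σ^[j] v) :
    IsTripleFamily σ W (insert v Q) := by
  have hself : ∀ i < 3, ∀ j < 3, σ^[i] v = σ^[j] v → i = j := by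
    intro i hi j hj h
    interval_cases i <;> interval_cases j <;> simp only [Function.iterate_succ_apply',
      Function.iterate_zero, id, σ.injective.eq_iff] at h ⊢
    exacts [absurd h.symm hv, absurd h.symm hvv, absurd h hv, absurd h.symm hv, absurd h hvv,
      absurd h hv]
  refine ⟨?_, ?_⟩
  · rintro q (rfl | hq)
    · exact ⟨hv, hW⟩
    · exact hQ.1 q hq
  · rintro q (rfl | hq) q' (rfl | hq') i hi j hj h
    · exact ⟨rfl, hself i hi j hj h⟩
    · exact absurd h.symm (hcross q' hq' j hj i hi)
    · exact absurd h (hcross q hq i hi j hj)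
    · exact hQ.2 q hq q' hq' i hi j hj h

theorem exists_isTripleFamily [Finite V] (σ : Equiv.Perm V) (W : Set V)
    (hσ : ∀ v, σ v ≠ v → σ (σ v) ≠ v) :
    ∃ Q : Set V, IsTripleFamily σ W Q ∧
      ∀ v, σ v ≠ v → (∀ i < 7, σ^[i] v ∉ W) → ∃ m ≤ 4, σ^[m] v ∈ Q := by
  obtain ⟨Q, hQ, hmax⟩ := Set.Finite.exists_maximal (s := {Q : Set V | IsTripleFamily σ W Q})
    (Set.toFinite _) ⟨∅, by simp [IsTripleFamily]⟩
  refine ⟨Q, hQ, fun v hv hvW => ?_⟩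
  by_contra! hcon
  have hadd : ∀ i, σ^[i] (σ^[2] v) = σ^[i + 2] v := fun i =>
    (Function.iterate_add_apply _ _ _ _).symm
  have hv2 := perm_iterate_ne hv 2
  have hins := hQ.insert hv2 (hσ _ hv2) (fun i hi => hadd i ▸ hvW (i + 2) (by lia))
    fun q hq i hi j hj h => hcon (j + 2 - i) (by lia) (by
      rw [hadd, show j + 2 = i + (j + 2 - i) by lia, Function.iterate_add_apply] at h
      rwa [← σ.injective.iterate i h])
  exact hcon 2 (by lia) (hmax hins (Set.subset_insert _ _) (Set.mem_insert _ _))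

end Triples

section Obeys

variable {V : Type*} {G A : SimpleGraph V}

/-- Tied edges have opposite colours in `col`. This puts both colours at every vertex with at most
one edge in `A`. -/
def Frame.Obeys (F : Frame G A) (col : Sym2 V → Bool) : Prop :=
  ∀ e, F.tie e ≠ e → col e ≠ col (F.tie e)

namespace Frame.Obeys

variable {F : Frame G A} {col : Sym2 V → Bool} {u v y : V}

theorem ne (h : F.Obeys col) (hd : F.Dir u y) (ht : F.target u y ≠ y) :
    col s(u, y) ≠ col s(u, F.target u y) := by
  have hne := h s(u, y) (by rw [F.tie_of_dir hd]; exact fun he => ht (Sym2.congr_right.mp he))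
  rwa [F.tie_of_dir hd] at hne

theorem port_ne (h : F.Obeys col) (hv : F.σ v ≠ v) : col s(v, F.σ v) ≠ col (F.port v) := by
  have := h.ne (Or.inr ⟨rfl, hv⟩) (by rw [F.target_cycle]; exact (F.nb_spec v).2.1)
  rwa [F.target_cycle] at this

theorem exists_ne_of_adj (h : F.Obeys col) (hG : IsCubic G) (hA : A ≤ G) (hu : F.σ u = u)
    (hAu : ∃ w, A.Adj u w) (hone : ∀ w, A.Adj u w → w = F.anb u) :
    ∃ a b, G.Adj u a ∧ G.Adj u b ∧ col s(u, a) ≠ col s(u, b) := by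
  classical
  have hanb := hAu.elim (F.anb_spec u)
  obtain ⟨a, ha, ha1, -⟩ := hG.exists_third u (F.anb u) (F.anb u)
  obtain ⟨b, hb, hb1, hb2⟩ := hG.exists_third u (F.anb u) a
  have haT : F.T.Adj u a := offCycles_adj_of_fixed hu ⟨ha, fun h' => ha1 (hone _ h')⟩
  have hbT : F.T.Adj u b := offCycles_adj_of_fixed hu ⟨hb, fun h' => hb1 (hone _ h')⟩
  have hchild : ∀ y, F.T.Adj u y → y ≠ F.anb u → F.d u < F.d y →
      ∃ a b, G.Adj u a ∧ G.Adj u b ∧ col s(u, a) ≠ col s(u, b) := by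
    intro y hy hne hlt
    have ht := (F.target_of_adj hy hu hAu).trans (if_pos hone)
    exact ⟨y, F.anb u, hy.1.1, hA hanb, ht ▸ h.ne (Or.inl ⟨hy, hlt⟩) (ht ▸ hne.symm)⟩
  rcases F.depth.lt_or_lt hb2.symm haT hbT with hlt | hlt
  · exact hchild a haT ha1 hlt
  · exact hchild b hbT hb1 hlt

theorem exists_ne_of_not_adj (h : F.Obeys col) (hG : IsCubic G) (hu : F.σ u = u)
    (hAu : ∀ w, ¬ A.Adj u w) :
    ∃ a b, G.Adj u a ∧ G.Adj u b ∧ col s(u, a) ≠ col s(u, b) := by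
  classical
  by_cases heven : Even (F.d u)
  · obtain ⟨hne, hfst, hsnd⟩ := F.children_spec u hu hAu
    have ht := (F.target_even hsnd.1 hu hAu heven).trans (if_pos rfl)
    exact ⟨F.snd u, F.fst u, hsnd.1.1.1, hfst.1.1.1, ht ▸ h.ne (Or.inl hsnd) (ht ▸ hne)⟩
  · have hp := F.par_spec u (pos_of_not_even heven)
    obtain ⟨y, hy, hypar, hyex⟩ := hG.exists_third u (F.par u) (F.ex u)
    have hyT : F.T.Adj u y := offCycles_adj_of_fixed hu ⟨hy, hAu y⟩
    have hlt : F.d u < F.d y := (F.depth.lt_or_lt hypar hyT hp.1).resolve_right hp.2.not_gt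
    have ht := (F.target_odd hyT hu hAu heven).trans (if_neg hyex)
    exact ⟨y, F.par u, hy, hp.1.1.1, ht ▸ h.ne (Or.inl ⟨hyT, hlt⟩) (ht ▸ hypar.symm)⟩

theorem bothColours (h : F.Obeys col) (hG : IsCubic G) (hA : A ≤ G)
    (hdeg : ∀ v x y, A.Adj v x → A.Adj v y → x ≠ y →
      ∃ x' y', A.Adj v x' ∧ A.Adj v y' ∧ col s(v, x') ≠ col s(v, y')) :
    BothColours G col := by
  intro u c
  suffices hs : ∃ a b, G.Adj u a ∧ G.Adj u b ∧ col s(u, a) ≠ col s(u, b) by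
    obtain ⟨a, b, ha, hb, hne⟩ := hs
    by_cases hc : col s(u, a) = c
    · exact ⟨a, ha, hc⟩
    · exact ⟨b, hb, (Bool.eq_not.2 hne.symm).trans (Bool.eq_not.2 (Ne.symm hc)).symm⟩
  by_cases hu : F.σ u = u
  swap
  · exact ⟨F.σ u, F.nb u, (F.cyc u hu).1.1, (F.nb_spec u).1, h.port_ne hu⟩
  by_cases hAu : ∃ w, A.Adj u w
  swap
  · exact h.exists_ne_of_not_adj hG hu (not_exists.1 hAu)
  by_cases hone : ∀ w, A.Adj u w → w = F.anb u
  · exact h.exists_ne_of_adj hG hA hu hAu hone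
  · push Not at hone
    obtain ⟨x, hx, hne⟩ := hone
    obtain ⟨x', y', hx', hy', hcol⟩ := hdeg u x _ hx (F.anb_spec u x hx) hne
    exact ⟨x', y', hA hx', hA hy', hcol⟩

end Frame.Obeys

end Obeys

/-! ### Non-backtracking walks -/

section NonBacktracking

variable {V : Type*} {H : SimpleGraph V} {n : ℕ} {v : ℕ → V}

/-- The sequence `v 0, …, v n` is a walk in `H` without backtracking; the values of `v` after `n`
are irrelevant. -/
structure NonBacktracking (H : SimpleGraph V) (n : ℕ) (v : ℕ → V) : Prop where
  adj : ∀ i < n, H.Adj (v i) (v (i + 1))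
  ne : ∀ i, i + 1 < n → v i ≠ v (i + 2)

namespace NonBacktracking

theorem reverse (h : NonBacktracking H n v) : NonBacktracking H n fun i => v (n - i) where
  adj i hi := by
    have := (h.adj (n - (i + 1)) (by lia)).symm
    rwa [show n - (i + 1) + 1 = n - i by lia] at this
  ne i hi := by
    have := (h.ne (n - (i + 2)) (by lia)).symm
    rwa [show n - (i + 2) + 2 = n - i by lia] at this

theorem shift (h : NonBacktracking H n v) {k m : ℕ} (hkm : k + m ≤ n) :
    NonBacktracking H m fun i => v (k + i) where
  adj i hi := h.adj (k + i) (by lia)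
  ne i hi := h.ne (k + i) (by lia)

theorem iterate_eq_of_apply_eq {f : V → V}
    (hf : ∀ i < n, f (v (i + 1)) = v (i + 2) → f (v i) = v (i + 1))
    (hn : f (v n) = v (n + 1)) : ∀ i ≤ n + 1, f^[i] (v 0) = v i := by
  have hall : ∀ j ≤ n, f (v (n - j)) = v (n - j + 1) := by
    intro j hj
    induction j with
    | zero => exact hn
    | succ j ih =>
      have := hf (n - (j + 1)) (by lia)
      rw [show n - (j + 1) + 1 = n - j by lia, show n - (j + 1) + 2 = n - j + 1 by lia] at this
      rw [this (ih (by lia)), show n - (j + 1) + 1 = n - j by lia]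
  intro i hi
  induction i with
  | zero => rfl
  | succ i ih =>
    have := hall (n - i) (by lia)
    rw [Function.iterate_succ_apply', ih (by lia)]
    rwa [show n - (n - i) = i by lia] at this

theorem lt_of_lt {T : SimpleGraph V} {d : V → ℕ} (hd : IsDepth T d) (h : NonBacktracking T n v)
    {i j : ℕ} (hij : i ≤ j) (hj : j < n) (hlt : d (v i) < d (v (i + 1))) :
    d (v j) < d (v (j + 1)) := by
  induction j, hij using Nat.le_induction with
  | base => exact hlt
  | succ j _ ih =>
    have := ih (by lia)
    rcases hd.lt_or_lt (h.ne j (by lia)) (h.adj j (by lia)).symm (h.adj (j + 1) hj) with h1 | h1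
    · lia
    · exact h1

end NonBacktracking

end NonBacktracking

section MonochromaticWalks

variable {V : Type*} {G A : SimpleGraph V} {F : Frame G A} {col : Sym2 V → Bool} {c : Bool}
  {v : ℕ → V} {W : Set V}

namespace Frame

theorem apply_eq_self_of_ascending (hG : IsCubic G) {x y z : V} (hxy : F.T.Adj x y)
    (hyz : F.T.Adj y z) (h1 : F.d x < F.d y) (h2 : F.d y < F.d z) : F.σ y = y := by
  by_contra hy
  have : x = z := (F.eq_nb_of_T hG hy hxy.symm).trans (F.eq_nb_of_T hG hy hyz).symm
  lia

namespace Obeys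

theorem even_of_ascending (h : F.Obeys col) (hG : IsCubic G) {x y z w : V}
    (hA : ∀ a, ¬ A.Adj y a) (hxy : F.T.Adj x y) (hyz : F.T.Adj y z) (hzw : F.T.Adj z w)
    (h1 : F.d x < F.d y) (h2 : F.d y < F.d z) (h3 : F.d z < F.d w)
    (hcol : col s(x, y) = col s(y, z)) : Even (F.d y) := by
  classical
  by_contra hodd
  have hy := apply_eq_self_of_ascending hG hxy hyz h1 h2
  have hz := apply_eq_self_of_ascending hG hyz hzw h2 h3
  have hex : z ≠ F.ex y := by
    rintro rfl
    exact F.ex_mem y hyz hz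
  have hp := F.par_spec y (pos_of_not_even hodd)
  have ht : F.target y z = x := by
    rw [F.target_odd hyz hy hA hodd, if_neg hex]
    exact F.depth.unique hp.1 hxy.symm hp.2 h1
  have hne := h.ne (Or.inl ⟨hyz, h2⟩) (by rw [ht]; rintro rfl; lia)
  rw [ht, Sym2.eq_swap (a := y) (b := x)] at hne
  exact hne hcol.symm

theorem not_ascending (h : F.Obeys col) (hG : IsCubic G)
    (hA : ∀ i ≤ 4, ∀ w, ¬ A.Adj (v i) w) (hT : ∀ i < 4, F.T.Adj (v i) (v (i + 1)))
    (hd : ∀ i < 4, F.d (v i) < F.d (v (i + 1))) (hcol : ∀ i < 4, col s(v i, v (i + 1)) = c) :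
    False := by
  have heven : ∀ i < 2, Even (F.d (v (i + 1))) := fun i hi =>
    h.even_of_ascending hG (hA _ (by lia)) (hT i (by lia)) (hT (i + 1) (by lia))
      (hT (i + 2) (by lia)) (hd i (by lia)) (hd (i + 1) (by lia)) (hd (i + 2) (by lia))
      ((hcol i (by lia)).trans (hcol (i + 1) (by lia)).symm)
  have hsucc : F.d (v 2) = F.d (v 1) + 1 := by
    have := F.depth.adj (hT 1 (by lia))
    have : F.d (v 1) < F.d (v 2) := hd 1 (by lia)
    lia
  have h2 := heven 1 (by lia)
  rw [hsucc, Nat.even_add_one] at h2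
  exact h2 (heven 0 (by lia))

theorem not_nonBacktracking_T (h : F.Obeys col) (hG : IsCubic G)
    (hA : ∀ i ≤ 7, ∀ w, ¬ A.Adj (v i) w) (hcol : ∀ i < 7, col s(v i, v (i + 1)) = c) :
    ¬ NonBacktracking F.T 7 v := by
  intro hT
  wlog hlt : F.d (v 3) < F.d (v 4) generalizing v
  · refine this (fun i _ => hA (7 - i) (by lia)) (fun i hi => ?_) hT.reverse ?_
    · have := hcol (7 - (i + 1)) (by lia)
      rwa [show 7 - (i + 1) + 1 = 7 - i by lia, Sym2.eq_swap] at this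
    · have : F.d (v 3) = F.d (v 4) + 1 ∨ F.d (v 4) = F.d (v 3) + 1 :=
        F.depth.adj (hT.adj 3 (by lia))
      change F.d (v 4) < F.d (v 3)
      lia
  · exact h.not_ascending hG (v := fun i => v (3 + i)) (fun i hi => hA (3 + i) (by lia))
      (fun i hi => hT.adj (3 + i) (by lia))
      (fun i hi => hT.lt_of_lt F.depth (by lia) (by lia) hlt) fun i hi => hcol (3 + i) (by lia)

theorem apply_eq_of_apply_eq (h : F.Obeys col) (hG : IsCubic G) {x y z : V}
    (hxy : (colourClass G col c).Adj x y) (hyz : (colourClass G col c).Adj y z) (hne : x ≠ z)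
    (hσ : F.σ y = z) : F.σ x = y := by
  by_contra hcon
  have hy : F.σ y ≠ y := hσ ▸ hyz.1.ne'
  have hx : x = F.nb y := F.eq_nb_of_adj hG hy hxy.1.symm (hσ ▸ hne) fun hx =>
    hcon (hx ▸ F.σ.apply_symm_apply y)
  refine h.port_ne hy ?_
  rw [Frame.port, ← hx, hσ, Sym2.eq_swap (a := y) (b := x)]
  exact hyz.2.trans hxy.2.symm

theorem apply_ne_of_nonBacktracking (h : F.Obeys col) (hG : IsCubic G)
    (htriple : ∀ v, F.σ v ≠ v → (∀ i < 7, F.σ^[i] v ∉ W) →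
      ∃ i < 7, ∃ j < 7, col (F.port (F.σ^[i] v)) ≠ col (F.port (F.σ^[j] v)))
    (hv : NonBacktracking (colourClass G col c) 7 v) (hvW : ∀ i < 7, v i ∉ W) :
    F.σ (v 6) ≠ v 7 := by
  intro h7
  have hit := NonBacktracking.iterate_eq_of_apply_eq (n := 6) (fun i hi =>
    h.apply_eq_of_apply_eq hG (hv.adj i (by lia)) (hv.adj (i + 1) (by lia)) (hv.ne i (by lia))) h7
  have hσ : ∀ i < 7, F.σ (v i) = v (i + 1) := fun i hi => by
    rw [← hit i (by lia), ← hit (i + 1) (by lia), Function.iterate_succ_apply']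
  have hport : ∀ i < 7, col (F.port (v i)) = !c := fun i hi => by
    have := h.port_ne (v := v i) (by rw [hσ i hi]; exact (hv.adj i hi).1.ne')
    rw [hσ i hi, (hv.adj i hi).2] at this
    exact Bool.eq_not.2 this.symm
  have hσ₀ : F.σ (v 0) ≠ v 0 := by
    rw [hσ 0 (by lia)]
    exact (hv.adj 0 (by lia)).1.ne'
  obtain ⟨i, hi, j, hj, hne⟩ := htriple (v 0) hσ₀
    fun i hi => by rw [hit i (by lia)]; exact hvW i hi
  rw [hit i (by lia), hit j (by lia), hport i hi, hport j hj] at hne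
  exact hne rfl

theorem exists_mem_guard (h : F.Obeys col) (hG : IsCubic G) (hW : IsGuard G A W)
    (htriple : ∀ v, F.σ v ≠ v → (∀ i < 7, F.σ^[i] v ∉ W) →
      ∃ i < 7, ∃ j < 7, col (F.port (F.σ^[i] v)) ≠ col (F.port (F.σ^[j] v)))
    (hv : NonBacktracking (colourClass G col c) 20 v) : ∃ i ≤ 20, v i ∈ W := by
  by_contra! hvW
  have hA : ∀ i ≤ 20, ∀ w, ¬ A.Adj (v i) w := fun i hi => (hW _ (hvW i hi)).1
  have hforward : ∀ i < 14, F.σ (v (i + 6)) ≠ v (i + 7) := fun i hi =>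
    h.apply_ne_of_nonBacktracking hG htriple (hv.shift (k := i) (by lia)) fun j _ =>
      hvW _ (by lia)
  have hbackward : ∀ i < 14, F.σ (v (i + 1)) ≠ v i := fun i hi => by
    have := h.apply_ne_of_nonBacktracking hG htriple
      (hv.reverse.shift (k := 13 - i) (m := 7) (by lia)) fun j _ => hvW _ (by lia)
    rwa [show 20 - (13 - i + 6) = i + 1 by lia, show 20 - (13 - i + 7) = i by lia] at this
  refine h.not_nonBacktracking_T hG (v := fun i => v (6 + i)) (fun i hi => hA _ (by lia))
    (fun i hi => (hv.adj (6 + i) (by lia)).2) ⟨fun i hi => ⟨⟨(hv.adj (6 + i) (by lia)).1,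
      hA _ (by lia) _⟩, ?_, hbackward (6 + i) (by lia)⟩, fun i hi => hv.ne (6 + i) (by lia)⟩
  rw [add_comm 6 i, show 6 + (i + 1) = i + 7 by lia]
  exact hforward i (by lia)

end Obeys

end Frame

end MonochromaticWalks

section BitColouring

variable {V : Type*} {G A : SimpleGraph V} {W : Set V}

namespace Frame

variable (F : Frame G A)

theorem tie_eq_or (e : Sym2 V) : F.tie e = e ∨ ∃ u y z, F.Dir u y ∧ e = s(u, y) ∧
    F.tie e = s(u, z) := by
  by_cases h : ∃ u y, F.Dir u y ∧ e = s(u, y)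
  · obtain ⟨u, y, hd, rfl⟩ := h
    exact Or.inr ⟨u, y, _, hd, rfl, F.tie_of_dir hd⟩
  · push Not at h
    exact Or.inl (F.tie_of_not_dir h)

theorem ncard_tie_fibre_le [Finite V] (hG : IsCubic G) (e : Sym2 V) :
    {x | F.tie x = e}.ncard ≤ 7 := by
  induction e with
  | _ a b =>
    have hsub : {x | F.tie x = s(a, b)} ⊆ {s(a, b)} ∪
        ((fun w => s(a, w)) '' G.neighborSet a ∪ (fun w => s(b, w)) '' G.neighborSet b) := by
      intro x (hx : F.tie x = s(a, b))
      rcases F.tie_eq_or x with h | ⟨u, y, z, hd, rfl, h⟩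
      · exact Or.inl (h.symm.trans hx)
      · rcases Sym2.eq_iff.mp (h.symm.trans hx) with ⟨rfl, rfl⟩ | ⟨rfl, rfl⟩
        · exact Or.inr (Or.inl ⟨y, hd.adj.1, rfl⟩)
        · exact Or.inr (Or.inr ⟨y, hd.adj.1, rfl⟩)
    have ha := Set.ncard_image_le (f := fun w => s(a, w)) (Set.toFinite (G.neighborSet a))
    have hb := Set.ncard_image_le (f := fun w => s(b, w)) (Set.toFinite (G.neighborSet b))
    rw [hG] at ha hb
    calc {x | F.tie x = s(a, b)}.ncard
        ≤ 1 + (3 + 3) := (Set.ncard_le_ncard hsub (Set.toFinite _)).trans <|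
          (Set.ncard_union_le _ _).trans <| Nat.add_le_add (Set.ncard_singleton _).le <|
          (Set.ncard_union_le _ _).trans <| Nat.add_le_add ha hb
      _ = 7 := rfl

/-- The edge at which the iteration of `tie` from `e` stops. -/
noncomputable def root (e : Sym2 V) : Sym2 V := F.tie^[4] e

theorem root_tie (e : Sym2 V) : F.root (F.tie e) = F.root e :=
  (Function.iterate_succ_apply F.tie 4 e).symm.trans <|
    (Function.iterate_succ_apply' F.tie 4 e).trans <|
    apply_iterate_eq_of_rank_le F.rank_tie_lt (F.rank_le e)

open Classical in
/-- The value at the root of `e` of `f` if this root is in `A`, and of `g` otherwise. -/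
noncomputable def onRoots {α : Type*} (f g : Sym2 V → α) (e : Sym2 V) : α :=
  if F.root e ∈ A.edgeSet then f (F.root e) else g (F.root e)

theorem onRoots_tie {α : Type*} (f g : Sym2 V → α) (e : Sym2 V) :
    F.onRoots f g (F.tie e) = F.onRoots f g e := by
  rw [onRoots, onRoots, F.root_tie]

theorem onRoots_of_mem_edgeSet {α : Type*} (f g : Sym2 V → α) {e : Sym2 V} (h : e ∈ A.edgeSet) :
    F.onRoots f g e = f e := by
  have hroot : F.root e = e := Function.iterate_fixed (F.tie_of_mem_edgeSet h) 4
  rw [onRoots, hroot, if_pos h]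

variable {F} in
theorem onRoots_port {α : Type*} (hW : IsGuard G A W) {v : V} (hv : F.σ v ≠ v) (hvW : v ∉ W)
    (f g : Sym2 V → α) : F.onRoots f g (F.port v) = g (F.root (F.port v)) :=
  if_neg (root_port_notMem hW hv hvW)

theorem ncard_onRoots_fibre_le [Finite V] (hG : IsCubic G) {α : Type*} (f g : Sym2 V → α) (b : α) :
    {e | F.onRoots f g e = b}.ncard ≤
      7 ^ 4 * ({e ∈ A.edgeSet | f e = b}.ncard + {e | g e = b}.ncard) := by
  have hsub : {e | F.onRoots f g e = b} ⊆
      F.root ⁻¹' ({e ∈ A.edgeSet | f e = b} ∪ {e | g e = b}) := by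
    intro e (he : F.onRoots f g e = b)
    rw [onRoots] at he
    split_ifs at he with h
    · exact Or.inl ⟨h, he⟩
    · exact Or.inr he
  calc {e | F.onRoots f g e = b}.ncard
      ≤ 7 ^ 4 * ({e ∈ A.edgeSet | f e = b} ∪ {e | g e = b}).ncard :=
        (Set.ncard_le_ncard hsub (Set.toFinite _)).trans <| ncard_preimage_le_mul
          (ncard_iterate_fibre_le (F.ncard_tie_fibre_le hG) 4) (Set.toFinite _)
    _ ≤ _ := Nat.mul_le_mul_left _ (Set.ncard_union_le _ _)

end Frame

/-- The colouring given by the random bits `ω`, where the edge `e` uses the bit of `β e`. -/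
def bitColouring (β : Sym2 V → Sym2 V) (k : Sym2 V → Bool) (ω : Sym2 V → Bool) : Sym2 V → Bool :=
  fun e => xor (k e) (ω (β e))

theorem Frame.obeys_bitColouring (F : Frame G A) {k : Sym2 V → Bool}
    (hk : ∀ e, F.tie e ≠ e → k e = !k (F.tie e)) (e₀ ρ : Sym2 V → Sym2 V) (a κ ω : Sym2 V → Bool) :
    F.Obeys (bitColouring (F.onRoots e₀ ρ) (fun e => xor (k e) (F.onRoots a κ e)) ω) := by
  intro e he
  simp only [bitColouring, F.onRoots_tie, hk e he, Bool.not_xor]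
  exact Bool.not_ne_self _

namespace Frame

variable {F : Frame G A}

theorem ncard_triple_roots_le_two [Finite V] (hG : IsCubic G) (hW : IsGuard G A W) {Q : Set V}
    (hQ : IsTripleFamily F.σ W Q) (e : Sym2 V) :
    {p : Q × Fin 3 | F.root (F.port (F.σ^[p.2] p.1)) = e}.ncard ≤ 2 := by
  refine (Set.ncard_le_ncard_of_injOn (fun p => F.σ^[p.2] p.1.1) ?_ ?_ (Set.toFinite _)).trans
    (ncard_ports_le_two (F := F) hG hW e)
  · rintro ⟨q, i⟩ hp
    exact ⟨perm_iterate_ne (hQ.1 q q.2).1 i, (hQ.1 q q.2).2 i i.2, hp⟩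
  · rintro ⟨q, i⟩ - ⟨q', i'⟩ - h
    obtain ⟨h1, h2⟩ := hQ.2 q q.2 q' q'.2 i i.2 i' i'.2 h
    exact Prod.ext (Subtype.ext h1) (Fin.ext h2)

theorem exists_nonconstant_on_triples [Finite V] (F : Frame G A) (hG : IsCubic G)
    (hW : IsGuard G A W) (k : Sym2 V → Bool) {D : ℕ} (hD : 2 ^ D * Nat.card V < 3 ^ D) :
    ∃ (ρ : Sym2 V → Sym2 V) (κ : Sym2 V → Bool), (∀ b, {e | ρ e = b}.ncard ≤ 2 * D + 1) ∧
      ∀ e₀ a ω v, F.σ v ≠ v → (∀ i < 7, F.σ^[i] v ∉ W) →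
        let col := bitColouring (F.onRoots e₀ ρ) (fun e => xor (k e) (F.onRoots a κ e)) ω
        ∃ i < 7, ∃ j < 7, col (F.port (F.σ^[i] v)) ≠ col (F.port (F.σ^[j] v)) := by
  obtain ⟨Q, hQ, hhit⟩ := exists_isTripleFamily F.σ W fun v hv => (F.cyc v hv).2
  obtain ⟨ρ, κ, hρ, hne⟩ := exists_identification_nonconstant
    (pos := fun (q : Q) (i : Fin 3) => F.root (F.port (F.σ^[i] q)))
    (sg := fun q i => k (F.port (F.σ^[i] q)))
    (ncard_triple_roots_le_two hG hW hQ)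
    ((Nat.mul_le_mul_left _ (Finite.card_subtype_le _)).trans_lt hD)
  refine ⟨ρ, κ, hρ, fun e₀ a ω v hv hvW => ?_⟩
  obtain ⟨m, hm, hmQ⟩ := hhit v hv hvW
  obtain ⟨i, j, hij⟩ := hne ω ⟨F.σ^[m] v, hmQ⟩
  refine ⟨i + m, by lia, j + m, by lia, ?_⟩
  have hmoved : ∀ i, F.σ (F.σ^[i] (F.σ^[m] v)) ≠ F.σ^[i] (F.σ^[m] v) :=
    perm_iterate_ne (perm_iterate_ne hv m)
  have hnotMem := (hQ.1 _ hmQ).2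
  simp only [bitColouring, Function.iterate_add_apply, onRoots_port hW (hmoved i) (hnotMem i i.2),
    onRoots_port hW (hmoved j) (hnotMem j j.2), Bool.xor_assoc]
  exact hij

end Frame

/- The bits are first identified along the chosen triples on the directed cycles, so that no long
monochromatic walk follows a directed cycle, and then spread from the roots along `tie`. -/
theorem exists_bitColouring [Finite V] (hG : IsCubic G) (hA : A ≤ G) (a : Sym2 V → Bool)
    (e₀ : Sym2 V → Sym2 V)
    (hdeg : ∀ v x y, A.Adj v x → A.Adj v y → x ≠ y →
      ∃ x' y', A.Adj v x' ∧ A.Adj v y' ∧ a s(v, x') ≠ a s(v, y') ∧ e₀ s(v, x') = e₀ s(v, y'))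
    (hW : IsGuard G A W) {M D : ℕ} (hM : ∀ b, {e ∈ A.edgeSet | e₀ e = b}.ncard ≤ M)
    (hD : 2 ^ D * Nat.card V < 3 ^ D) :
    ∃ (β : Sym2 V → Sym2 V) (k : Sym2 V → Bool),
      (∀ e ∈ A.edgeSet, β e = e₀ e ∧ k e = a e) ∧
      (∀ b, {e | β e = b}.ncard ≤ (M + (2 * D + 1)) * 7 ^ 4) ∧
      ∀ ω, BothColours G (bitColouring β k ω) ∧
        ∀ (c : Bool) (v : ℕ → V), NonBacktracking (colourClass G (bitColouring β k ω) c) 20 v →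
          ∃ i ≤ 20, v i ∈ W := by
  obtain ⟨F⟩ := nonempty_frame hG A
  obtain ⟨k, hk⟩ := exists_parity_of_rank_le F.rank_tie_lt (fun _ => true) 4
  obtain ⟨ρ, κ, hρ, htriple⟩ := F.exists_nonconstant_on_triples hG hW k hD
  have hedge : ∀ e ∈ A.edgeSet, F.onRoots e₀ ρ e = e₀ e ∧ xor (k e) (F.onRoots a κ e) = a e :=
    fun e he => ⟨F.onRoots_of_mem_edgeSet _ _ he, by
      rw [F.onRoots_of_mem_edgeSet _ _ he, (hk e (F.rank_le e)).1 (F.tie_of_mem_edgeSet he),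
        Bool.false_xor]⟩
  refine ⟨F.onRoots e₀ ρ, fun e => xor (k e) (F.onRoots a κ e), hedge, fun b => ?_, fun ω => ?_⟩
  · rw [mul_comm]
    exact (F.ncard_onRoots_fibre_le hG e₀ ρ b).trans
      (Nat.mul_le_mul_left _ (Nat.add_le_add (hM b) (hρ b)))
  have hob := F.obeys_bitColouring
    (fun e he => ((hk e (F.rank_le e)).2 he).trans (Bool.true_xor _)) e₀ ρ a κ ω
  refine ⟨hob.bothColours hG hA fun v x y hx hy hxy => ?_, fun c v hv =>
    hob.exists_mem_guard hG hW (htriple e₀ a ω) hv⟩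
  obtain ⟨x', y', hx', hy', hne, heq⟩ := hdeg v x y hx hy hxy
  refine ⟨x', y', hx', hy', ?_⟩
  obtain ⟨hβx, hkx⟩ := hedge s(v, x') hx'
  obtain ⟨hβy, hky⟩ := hedge s(v, y') hy'
  simp only [bitColouring, hβx, hβy, hkx, hky, heq]
  exact fun h => hne (Bool.xor_left_inj.1 h)

end BitColouring

/-! ### Pieces and their neighbourhoods -/

theorem ncard_biUnion_le_mul {α β : Type*} {S : Set α} (hS : S.Finite) (f : α → Set β) {n : ℕ}
    (h : ∀ x ∈ S, (f x).ncard ≤ n) : (⋃ x ∈ S, f x).ncard ≤ S.ncard * n := by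
  lift S to Finset α using hS
  rw [Set.ncard_coe_finset]
  exact (S.set_ncard_biUnion_le f).trans (Finset.sum_le_card_nsmul S _ n h)

section NearSet

variable {V : Type*} {G : SimpleGraph V} {S : Set V} {r : ℕ} {v w : V}

/-- The vertices at distance at most `r` from `S`. -/
def nearSet (G : SimpleGraph V) (S : Set V) (r : ℕ) : Set V :=
  {v | ∃ x ∈ S, ∃ p : G.Walk x v, p.length ≤ r}

theorem nearSet_mono {r' : ℕ} (h : r ≤ r') : nearSet G S r ⊆ nearSet G S r' :=
  fun _ ⟨x, hx, p, hp⟩ => ⟨x, hx, p, hp.trans h⟩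

theorem subset_nearSet (S : Set V) (r : ℕ) : S ⊆ nearSet G S r :=
  fun x hx => ⟨x, hx, Walk.nil, by simp⟩

theorem mem_nearSet_of_walk (hv : v ∈ nearSet G S r) (q : G.Walk v w) :
    w ∈ nearSet G S (r + q.length) := by
  obtain ⟨x, hx, p, hp⟩ := hv
  exact ⟨x, hx, p.append q, by rw [Walk.length_append]; lia⟩

theorem mem_nearSet_of_adj (hv : v ∈ nearSet G S r) (h : G.Adj v w) :
    w ∈ nearSet G S (r + 1) := by
  simpa using mem_nearSet_of_walk hv h.toWalk

theorem IsCubic.ncard_nearSet_le [Finite V] (hG : IsCubic G) (S : Set V) (r : ℕ) :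
    (nearSet G S r).ncard ≤ S.ncard * 4 ^ r := by
  induction r with
  | zero =>
    have : nearSet G S 0 ⊆ S := by
      rintro v ⟨x, hx, p, hp⟩
      rwa [← Walk.eq_of_length_eq_zero (p := p) (by lia)]
    simpa using Set.ncard_le_ncard this (Set.toFinite _)
  | succ r ih =>
    have hsub : nearSet G S (r + 1) ⊆
        nearSet G S r ∪ ⋃ v ∈ nearSet G S r, G.neighborSet v := by
      rintro v ⟨x, hx, p, hp⟩
      by_cases h0 : p.Nil
      · exact Or.inl ⟨x, hx, p, by rw [Walk.length_eq_zero_iff.mpr h0]; lia⟩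
      · have hl : p.dropLast.length = p.length - 1 := by simp
        exact Or.inr (Set.mem_biUnion ⟨x, hx, p.dropLast, by lia⟩ (p.adj_penultimate h0))
    have h1 := ncard_biUnion_le_mul (Set.toFinite (nearSet G S r)) G.neighborSet
      fun v _ => (hG v).le
    have h2 := (Set.ncard_le_ncard hsub (Set.toFinite _)).trans (Set.ncard_union_le _ _)
    rw [pow_succ, ← mul_assoc]
    lia

/-- The edges of `G` with an end point in `S`. -/
def edgesMeeting (G : SimpleGraph V) (S : Set V) : Set (Sym2 V) :=
  {e | e ∈ G.edgeSet ∧ ∃ x ∈ e, x ∈ S}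

theorem IsCubic.ncard_edgesMeeting_le [Finite V] (hG : IsCubic G) (S : Set V) :
    (edgesMeeting G S).ncard ≤ S.ncard * 3 := by
  have hsub : edgesMeeting G S ⊆ ⋃ x ∈ S, (fun w => s(x, w)) '' G.neighborSet x := by
    rintro e ⟨he, x, hx, hxS⟩
    obtain ⟨y, rfl⟩ := hx
    exact Set.mem_biUnion hxS ⟨y, he, rfl⟩
  refine (Set.ncard_le_ncard hsub (Set.toFinite _)).trans
    (ncard_biUnion_le_mul (Set.toFinite S) _ fun x _ => ?_)
  exact (Set.ncard_image_le (Set.toFinite _)).trans (hG x).le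

end NearSet

section Sequences

variable {V : Type*} {G : SimpleGraph V}

theorem exists_nonBacktracking_of_isCycle {u : V} {p : G.Walk u u} (hp : p.IsCycle) :
    ∃ v : ℕ → V, (∀ n, NonBacktracking G n v) ∧ ∀ x, x ∈ p.support ↔ ∃ k, v k = x := by
  have h3 := hp.three_le_length
  have hlt : ∀ k, k % p.length < p.length := fun k => Nat.mod_lt _ (by lia)
  refine ⟨fun k => p.getVert (k % p.length), fun _ => ⟨fun k _ => ?_, fun k _ h => ?_⟩,
    fun x => ⟨fun hx => ?_, ?_⟩⟩
  · have hadj := p.adj_getVert_succ (hlt k)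
    rw [← Nat.mod_add_mod k]
    rcases Nat.lt_or_eq_of_le (show k % p.length + 1 ≤ p.length from hlt k) with h | h
    · rwa [Nat.mod_eq_of_lt h]
    · rw [h, Nat.mod_self, Walk.getVert_zero]
      rwa [h, Walk.getVert_length] at hadj
  · have hlt' := hlt k
    have heq := hp.getVert_injOn' (by simp only [Set.mem_ofPred_eq]; lia)
      (by have := hlt (k + 2); simp only [Set.mem_ofPred_eq]; lia) h
    rw [← Nat.mod_add_mod k] at heq
    generalize k % p.length = j at heq hlt'
    by_cases h' : j + 2 < p.length
    · rw [Nat.mod_eq_of_lt h'] at heq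
      lia
    · rw [Nat.mod_eq_sub_mod (by lia), Nat.mod_eq_of_lt (by lia)] at heq
      lia
  · obtain ⟨i, rfl, hi⟩ := Walk.mem_support_iff_exists_getVert.mp hx
    rcases hi.lt_or_eq with hi | rfl
    · exact ⟨i, congrArg p.getVert (Nat.mod_eq_of_lt hi)⟩
    · exact ⟨0, by simp⟩
  · rintro ⟨k, rfl⟩
    exact Walk.getVert_mem_support _ _

theorem exists_walk_length_eq_sub {v : ℕ → V} {k l : ℕ} (hkl : k ≤ l)
    (h : ∀ m, k ≤ m → m < l → G.Adj (v m) (v (m + 1))) :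
    ∃ p : G.Walk (v k) (v l), p.length = l - k := by
  induction l, hkl using Nat.le_induction with
  | base => exact ⟨Walk.nil, by simp⟩
  | succ l hkl ih =>
    obtain ⟨p, hp⟩ := ih fun m h1 h2 => h m h1 (by lia)
    exact ⟨p.concat (h l hkl (by lia)), by rw [Walk.length_concat, hp]; lia⟩

theorem exists_walk_length_eq_sub_add_sub {v : ℕ → V} {N k l : ℕ}
    (h : ∀ m < N, G.Adj (v m) (v (m + 1))) (hk : k ≤ N) (hl : l ≤ N) :
    ∃ p : G.Walk (v k) (v l), p.length = (l - k) + (k - l) := by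
  rcases le_total k l with hkl | hkl
  · obtain ⟨p, hp⟩ := exists_walk_length_eq_sub hkl fun m _ _ => h m (by lia)
    exact ⟨p, by lia⟩
  · obtain ⟨p, hp⟩ := exists_walk_length_eq_sub hkl fun m _ _ => h m (by lia)
    exact ⟨p.reverse, by rw [Walk.length_reverse]; lia⟩

end Sequences

section Pieces

variable {V : Type*} {G : SimpleGraph V}

/-- Pairwise distant pieces `D i` carrying a partial colouring of the graph `G`: the coloured edges
are those of `A`, and `a e` is the colour of the edge `e` of `A`. -/
structure Pieces (G : SimpleGraph V) (ι : Type*) where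
  D : ι → Set V
  A : SimpleGraph V
  a : Sym2 V → Bool
  le : A ≤ G
  adj_mem : ∀ {u v}, A.Adj u v → ∃ i, u ∈ D i ∧ v ∈ D i
  exists_adj : ∀ i, ∃ u v, u ∈ D i ∧ v ∈ D i ∧ A.Adj u v
  deg : ∀ v x y, A.Adj v x → A.Adj v y → x ≠ y →
    ∃ x' y', A.Adj v x' ∧ A.Adj v y' ∧ a s(v, x') ≠ a s(v, y')
  sep : ∀ {i j x y}, x ∈ D i → y ∈ D j → ∀ p : G.Walk x y, p.length ≤ 100 → i = j
  cyc : ∀ i u (p : G.Walk u u), p.IsCycle → (∀ x ∈ p.support, x ∈ D i) →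
    (∀ e ∈ p.edges, ∀ e' ∈ p.edges, e ∈ A.edgeSet → e' ∈ A.edgeSet → a e = a e') →
    ∃ x y z, x ≠ z ∧ s(x, y) ∈ p.edges ∧ s(y, z) ∈ p.edges ∧ ¬ A.Adj x y ∧ ¬ A.Adj y z

/-- Non-backtracking monochromatic walks with twenty edges meet `W`. -/
def Meets (G : SimpleGraph V) (col : Sym2 V → Bool) (W : Set V) : Prop :=
  ∀ (c : Bool) (v : ℕ → V), NonBacktracking (colourClass G col c) 20 v → ∃ i ≤ 20, v i ∈ W

theorem Meets.congr {col col' : Sym2 V → Bool} {W : Set V} (h : Meets G col W)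
    (hc : ∀ x y, x ∉ W → y ∉ W → col' s(x, y) = col s(x, y)) : Meets G col' W := by
  intro c v hv
  by_contra! hW
  obtain ⟨i, hi, hiW⟩ := h c v ⟨fun i hi => ⟨(hv.adj i hi).1,
    (hc _ _ (hW i (by lia)) (hW (i + 1) (by lia))).symm.trans (hv.adj i hi).2⟩, hv.ne⟩
  exact hW i hi hiW

namespace Pieces

variable {ι : Type*} (P : Pieces G ι)

/-- The vertices near a piece whose edges may be recoloured to repair a colouring. -/
def zone (i : ι) : Set V := nearSet G (P.D i) 2

/-- The neighbourhood of a piece that contains all long monochromatic walks meeting its zone. -/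
def region (i : ι) : Set V := nearSet G (P.D i) 22

/-- The union of the zones. -/
def guard : Set V := ⋃ i, P.zone i

/-- The edges that may be recoloured near a piece. -/
def free (i : ι) : Set (Sym2 V) := edgesMeeting G (P.zone i) \ P.A.edgeSet

theorem zone_subset_region (i : ι) : P.zone i ⊆ P.region i := nearSet_mono (by lia)

variable {P}

theorem eq_of_near {i j : ι} {r r' : ℕ} {v w : V} (hv : v ∈ nearSet G (P.D i) r)
    (hw : w ∈ nearSet G (P.D j) r') (q : G.Walk v w) (h : r + r' + q.length ≤ 100) : i = j := by
  obtain ⟨x, hx, p, hp⟩ := hv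
  obtain ⟨y, hy, p', hp'⟩ := hw
  refine P.sep hx hy (p.append (q.append p'.reverse)) ?_
  rw [Walk.length_append, Walk.length_append, Walk.length_reverse]
  lia

theorem eq_of_mem {i j : ι} {r r' : ℕ} {v : V} (hv : v ∈ nearSet G (P.D i) r)
    (hw : v ∈ nearSet G (P.D j) r') (h : r + r' ≤ 100) : i = j :=
  eq_of_near hv hw Walk.nil (by simpa using h)

variable (P) in
theorem isGuard : IsGuard G P.A P.guard := by
  have key : ∀ v r, (∀ i, v ∉ nearSet G (P.D i) r) → ∀ w, ¬ P.A.Adj v w := by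
    intro v r h w hw
    obtain ⟨i, hi, -⟩ := P.adj_mem hw
    exact h i (subset_nearSet _ _ hi)
  intro v hv
  have hv2 : ∀ i, v ∉ nearSet G (P.D i) 2 := fun i hi => hv (Set.mem_iUnion.mpr ⟨i, hi⟩)
  refine ⟨key v 2 hv2, fun u hu => ?_⟩
  have hu1 : ∀ i, u ∉ nearSet G (P.D i) 1 := fun i hi => hv2 i (mem_nearSet_of_adj hi hu.symm)
  refine ⟨key u 1 hu1, fun p hp => ?_⟩
  exact key p 0 fun i hi => hu1 i (mem_nearSet_of_adj hi hp.symm)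

theorem exists_region_of_adj {v : ℕ → V} {N : ℕ} (hv : ∀ k < N, G.Adj (v k) (v (k + 1)))
    (h : ∀ k ≤ N, ∃ i, v k ∈ P.region i) : ∃ i, ∀ k ≤ N, v k ∈ P.region i := by
  obtain ⟨i, hi⟩ := h 0 (by lia)
  refine ⟨i, fun k => ?_⟩
  induction k with
  | zero => exact fun _ => hi
  | succ k ih =>
    intro hk
    obtain ⟨j, hj⟩ := h (k + 1) hk
    obtain rfl := eq_of_near (ih (by lia)) hj (hv k (by lia)).toWalk (by simp)
    exact hj

theorem exists_region {col : Sym2 V → Bool} (hcol : Meets G col P.guard) {c : Bool} {v : ℕ → V}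
    {N : ℕ} (hN : 20 ≤ N) (hv : NonBacktracking (colourClass G col c) N v) :
    ∃ i, (∀ k ≤ N, v k ∈ P.region i) ∧
      ∀ k, k + 20 ≤ N → ∃ m, k ≤ m ∧ m ≤ k + 20 ∧ v m ∈ P.zone i := by
  have hwindow : ∀ k, k + 20 ≤ N → ∃ m, k ≤ m ∧ m ≤ k + 20 ∧ ∃ i, v m ∈ P.zone i := by
    intro k hk
    obtain ⟨i, hi, hiW⟩ := hcol c _ (hv.shift hk)
    exact ⟨k + i, by lia, by lia, Set.mem_iUnion.mp hiW⟩
  have hadj : ∀ k < N, G.Adj (v k) (v (k + 1)) := fun k hk => (hv.adj k hk).1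
  have hnear : ∀ k ≤ N, ∃ i, v k ∈ P.region i := by
    intro k hk
    obtain ⟨m, hm₁, hm₂, i, hi⟩ := hwindow (min k (N - 20)) (by lia)
    obtain ⟨p, hp⟩ := exists_walk_length_eq_sub_add_sub hadj (k := m) (l := k) (by lia) hk
    exact ⟨i, nearSet_mono (by lia) (mem_nearSet_of_walk hi p)⟩
  obtain ⟨i, hi⟩ := exists_region_of_adj hadj hnear
  refine ⟨i, hi, fun k hk => ?_⟩
  obtain ⟨m, hm₁, hm₂, j, hj⟩ := hwindow k hk
  obtain rfl := eq_of_mem (hi m (by lia)) hj (by lia)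
  exact ⟨m, hm₁, hm₂, hj⟩

theorem exists_region_of_isCycle {col : Sym2 V → Bool} (hcol : Meets G col P.guard) {c : Bool}
    {u : V} {p : (colourClass G col c).Walk u u} (hp : p.IsCycle) :
    ∃ i, (∀ x ∈ p.support, x ∈ P.region i) ∧ ∃ x ∈ p.support, x ∈ P.zone i := by
  obtain ⟨v, hv, hs⟩ := exists_nonBacktracking_of_isCycle hp
  obtain ⟨i, hi, hz⟩ := exists_region hcol le_rfl (hv 20)
  obtain ⟨m, -, -, hm⟩ := hz 0 (by lia)
  refine ⟨i, fun x hx => ?_, v m, (hs _).2 ⟨m, rfl⟩, hm⟩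
  obtain ⟨k, rfl⟩ := (hs x).1 hx
  obtain ⟨j, hj, -⟩ := exists_region hcol (by lia) (hv (20 + k))
  obtain rfl := eq_of_mem (hi 0 (by lia)) (hj 0 (by lia)) (by lia)
  exact hj k (by lia)

theorem mem_free {i : ι} {x y : V} (h : G.Adj x y) (hx : x ∈ P.zone i) (hD : x ∉ P.D i) :
    s(x, y) ∈ P.free i := by
  refine ⟨⟨h, x, by simp, hx⟩, fun hA => hD ?_⟩
  obtain ⟨j, hj, -⟩ := P.adj_mem (u := x) (v := y) hA
  obtain rfl := eq_of_mem hx (subset_nearSet (G := G) _ 0 hj) (by lia)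
  exact hj

section TwoFree

variable {col : Sym2 V → Bool} {i : ι} {b c : Bool} {u : V} {p : (colourClass G col c).Walk u u}

theorem exists_two_free_of_support_subset
    (hcol : ∀ x y, x ∈ P.D i → P.A.Adj x y → col s(x, y) = xor (P.a s(x, y)) b)
    (hp : p.IsCycle) (hD : ∀ x ∈ p.support, x ∈ P.D i) :
    ∃ y x₁ x₂, x₁ ≠ x₂ ∧ s(y, x₁) ∈ p.edges ∧ s(y, x₂) ∈ p.edges ∧
      s(y, x₁) ∈ P.free i ∧ s(y, x₂) ∈ P.free i := by
  have hle := colourClass_le (G := G) (col := col) c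
  have hconst : ∀ e ∈ p.edges, e ∈ P.A.edgeSet → P.a e = xor c b := by
    intro e he heA
    induction e with
    | _ x y =>
      have := (hcol x y (hD x (p.fst_mem_support_of_mem_edges he)) heA).symm.trans
        (p.adj_of_mem_edges he).2
      rw [← this, Bool.xor_assoc, Bool.xor_self, Bool.xor_false]
  obtain ⟨x, y, z, hne, h1, h2, n1, n2⟩ := P.cyc i u (p.mapLe hle)
    ((Walk.isCycle_mapLe hle).mpr hp) (by simpa only [Walk.support_mapLe_eq_support] using hD) (by
      rw [Walk.edges_mapLe_eq_edges]
      exact fun e he e' he' heA heA' => (hconst e he heA).trans (hconst e' he' heA').symm)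
  rw [Walk.edges_mapLe_eq_edges] at h1 h2
  have hyz : y ∈ P.zone i := subset_nearSet _ _ (hD y (p.fst_mem_support_of_mem_edges h2))
  refine ⟨y, x, z, hne, by rwa [Sym2.eq_swap], h2, ?_, ?_⟩
  · exact ⟨⟨(p.adj_of_mem_edges h1).1.symm, y, by simp, hyz⟩, fun h => n1 h.symm⟩
  · exact ⟨⟨(p.adj_of_mem_edges h2).1, y, by simp, hyz⟩, n2⟩

theorem exists_mem_zone_notMem (hz : ∃ x ∈ p.support, x ∈ P.zone i)
    (hD : ∃ x ∈ p.support, x ∉ P.D i) : ∃ y ∈ p.support, y ∈ P.zone i ∧ y ∉ P.D i := by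
  classical
  obtain ⟨w, hw, hwD⟩ := hD
  by_cases hin : ∃ x ∈ p.support, x ∈ P.D i
  · obtain ⟨x, hx, hxD⟩ := hin
    have hw' : w ∈ (p.rotate x hx).support := by simpa using hw
    obtain ⟨d, hd, hd1, hd2⟩ :=
      ((p.rotate x hx).takeUntil w hw').exists_boundary_dart (P.D i) hxD hwD
    have hd3 : d.snd ∈ (p.rotate x hx).support :=
      Walk.support_takeUntil_subset_support _ _ (Walk.dart_snd_mem_support_of_mem_darts _ hd)
    refine ⟨d.snd, by simpa using hd3, ?_, hd2⟩
    exact nearSet_mono (by lia) (mem_nearSet_of_adj (subset_nearSet (G := G) _ 0 hd1) d.adj.1)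
  · push Not at hin
    obtain ⟨x, hx, hxz⟩ := hz
    exact ⟨x, hx, hxz, hin x hx⟩

theorem exists_two_free
    (hcol : ∀ x y, x ∈ P.D i → P.A.Adj x y → col s(x, y) = xor (P.a s(x, y)) b)
    (hp : p.IsCycle) (hz : ∃ x ∈ p.support, x ∈ P.zone i) :
    ∃ y x₁ x₂, x₁ ≠ x₂ ∧ s(y, x₁) ∈ p.edges ∧ s(y, x₂) ∈ p.edges ∧
      s(y, x₁) ∈ P.free i ∧ s(y, x₂) ∈ P.free i := by
  by_cases hD : ∀ x ∈ p.support, x ∈ P.D i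
  · exact exists_two_free_of_support_subset hcol hp hD
  push Not at hD
  obtain ⟨y, hy, hyz, hyD⟩ := exists_mem_zone_notMem hz hD
  obtain ⟨x₁, x₂, hne, h1, h2⟩ := exists_two_edges_of_isCycle hp hy
  exact ⟨y, x₁, x₂, hne, h1, h2, mem_free (p.adj_of_mem_edges h1).1 hyz hyD,
    mem_free (p.adj_of_mem_edges h2).1 hyz hyD⟩

end TwoFree

end Pieces

end Pieces

namespace Pieces

variable {V ι : Type*} {G : SimpleGraph V} {P : Pieces G ι} {i : ι} {κ κ' ψ : Sym2 V → Bool}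

/-- Both colours are present at all vertices of the region of a piece, and there is no
monochromatic cycle in this region. -/
def LocallyGood (P : Pieces G ι) (i : ι) (col : Sym2 V → Bool) : Prop :=
  (∀ v ∈ P.region i, ∀ c, ∃ w, (colourClass G col c).Adj v w) ∧
    ∀ (c : Bool) (u : V) (p : (colourClass G col c).Walk u u), p.IsCycle →
      ¬ ∀ x ∈ p.support, x ∈ P.region i

theorem LocallyGood.congr (h : P.LocallyGood i κ)
    (hc : ∀ e ∈ edgesMeeting G (P.region i), κ e = κ' e) : P.LocallyGood i κ' := by
  refine ⟨fun v hv c => ?_, fun c u p hp hX => ?_⟩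
  · obtain ⟨w, hw⟩ := h.1 v hv c
    exact ⟨w, hw.1, (hc _ ⟨hw.1, v, by simp, hv⟩).symm.trans hw.2⟩
  · have htr : ∀ e ∈ p.edges, e ∈ (colourClass G κ c).edgeSet := by
      intro e he
      induction e with
      | _ x y =>
        have hadj := p.adj_of_mem_edges he
        exact ⟨hadj.1, (hc _ ⟨hadj.1, x, by simp,
          hX x (p.fst_mem_support_of_mem_edges he)⟩).trans hadj.2⟩
    exact h.2 c u (p.transfer _ htr) (hp.transfer htr) (by simpa using hX)

theorem LocallyGood.not (h : P.LocallyGood i κ) : P.LocallyGood i fun e => !κ e := by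
  refine ⟨fun v hv c => ?_, fun c u p hp hX => ?_⟩
  · obtain ⟨w, hw⟩ := h.1 v hv (!c)
    exact ⟨w, hw.1, by simp [hw.2]⟩
  · have htr : ∀ e ∈ p.edges, e ∈ (colourClass G κ (!c)).edgeSet := by
      intro e he
      induction e with
      | _ x y =>
        have hadj := p.adj_of_mem_edges he
        exact ⟨hadj.1, by rw [← hadj.2]; simp⟩
    exact h.2 (!c) u (p.transfer _ htr) (hp.transfer htr) (by simpa using hX)

open Classical in
/-- The colouring `κ`, changed to `ψ` on the free edges near a piece. -/
noncomputable def patch (P : Pieces G ι) (i : ι) (κ ψ : Sym2 V → Bool) : Sym2 V → Bool :=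
  (P.free i).piecewise ψ κ

theorem patch_of_mem {e : Sym2 V} (he : e ∈ P.free i) : P.patch i κ ψ e = ψ e := by
  classical exact Set.piecewise_eq_of_mem _ _ _ he

theorem patch_of_notMem {e : Sym2 V} (he : e ∉ P.free i) : P.patch i κ ψ e = κ e := by
  classical exact Set.piecewise_eq_of_notMem _ _ _ he

theorem patch_not (κ ψ : Sym2 V → Bool) :
    P.patch i (fun e => !κ e) (fun e => !ψ e) = fun e => !P.patch i κ ψ e := by
  funext e
  by_cases he : e ∈ P.free i
  · rw [patch_of_mem he, patch_of_mem he]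
  · rw [patch_of_notMem he, patch_of_notMem he]

theorem locallyGood_patch_congr
    (h : ∀ e ∈ edgesMeeting G (P.region i), κ e = κ' e) (ψ : Sym2 V → Bool) :
    P.LocallyGood i (P.patch i κ ψ) ↔ P.LocallyGood i (P.patch i κ' ψ) := by
  have hpatch : ∀ e ∈ edgesMeeting G (P.region i), P.patch i κ ψ e = P.patch i κ' ψ e := by
    intro e he
    by_cases hf : e ∈ P.free i
    · rw [patch_of_mem hf, patch_of_mem hf]
    · rw [patch_of_notMem hf, patch_of_notMem hf, h e he]
  exact ⟨fun hg => hg.congr hpatch, fun hg => hg.congr fun e he => (hpatch e he).symm⟩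

variable (P) in
/-- An edge of `A` in the piece `D i`. -/
noncomputable def rep (i : ι) : Sym2 V :=
  s((P.exists_adj i).choose, (P.exists_adj i).choose_spec.choose)

variable (P) in
theorem exists_rep_eq (i : ι) : ∃ u v, P.rep i = s(u, v) ∧ u ∈ P.D i ∧ v ∈ P.D i ∧ P.A.Adj u v :=
  ⟨_, _, rfl, (P.exists_adj i).choose_spec.choose_spec⟩

theorem rep_mem_edgesMeeting : P.rep i ∈ edgesMeeting G (P.region i) := by
  obtain ⟨u, v, h, hu, -, hA⟩ := P.exists_rep_eq i
  rw [h]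
  exact ⟨P.le hA, u, by simp, subset_nearSet _ _ hu⟩

theorem eq_of_mem_D {j : ι} {x : V} (hi : x ∈ P.D i) (hj : x ∈ P.D j) : i = j :=
  P.sep hi hj Walk.nil (by simp)

theorem rep_injective : Function.Injective P.rep := by
  intro i j hij
  obtain ⟨u, v, h, hu, -⟩ := P.exists_rep_eq i
  obtain ⟨u', v', h', hu', hv', -⟩ := P.exists_rep_eq j
  rw [h, h'] at hij
  rcases Sym2.eq_iff.mp hij with ⟨rfl, rfl⟩ | ⟨rfl, rfl⟩
  · exact eq_of_mem_D hu hu'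
  · exact eq_of_mem_D hu hv'

/-- New colours for the free edges near a piece that make the colouring `κ` locally good, if such
colours exist. -/
noncomputable def goodColours (P : Pieces G ι) (i : ι) (κ : Sym2 V → Bool) : Sym2 V → Bool :=
  Classical.epsilon fun ψ => P.LocallyGood i (P.patch i κ ψ)

/-- As `goodColours`, but equivariant under exchanging the colours: the colour of `rep i` decides
whether the choice is made for `κ` or for its negation. -/
noncomputable def oddColours (P : Pieces G ι) (i : ι) (κ : Sym2 V → Bool) : Sym2 V → Bool :=
  if κ (P.rep i) then P.goodColours i κ else fun e => !P.goodColours i (fun e => !κ e) e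

theorem goodColours_congr (h : ∀ e ∈ edgesMeeting G (P.region i), κ e = κ' e) :
    P.goodColours i κ = P.goodColours i κ' :=
  congrArg Classical.epsilon (funext fun ψ => propext (locallyGood_patch_congr h ψ))

theorem oddColours_congr (h : ∀ e ∈ edgesMeeting G (P.region i), κ e = κ' e) :
    P.oddColours i κ = P.oddColours i κ' := by
  rw [oddColours, oddColours, h _ rep_mem_edgesMeeting, goodColours_congr h,
    goodColours_congr fun e he => congrArg Bool.not (h e he)]

theorem oddColours_not (κ : Sym2 V → Bool) (e : Sym2 V) :
    P.oddColours i (fun e => !κ e) e = !P.oddColours i κ e := by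
  by_cases h : κ (P.rep i) = true <;> simp [oddColours, h]

theorem locallyGood_patch_oddColours (h : ∃ ψ, P.LocallyGood i (P.patch i κ ψ)) :
    P.LocallyGood i (P.patch i κ (P.oddColours i κ)) := by
  by_cases hk : κ (P.rep i) = true
  · rw [oddColours, if_pos hk]
    exact Classical.epsilon_spec h
  · rw [oddColours, if_neg hk]
    obtain ⟨ψ, hψ⟩ := h
    have hnot : ∃ ψ, P.LocallyGood i (P.patch i (fun e => !κ e) ψ) :=
      ⟨fun e => !ψ e, by rw [patch_not]; exact hψ.not⟩
    have hgood := (Classical.epsilon_spec hnot).not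
    rw [← patch_not] at hgood
    simpa only [goodColours, Bool.not_not] using hgood

open Classical in
/-- The colouring `κ`, recoloured by `oddColours` on the free edges near all pieces. -/
noncomputable def repaired (P : Pieces G ι) (κ : Sym2 V → Bool) : Sym2 V → Bool :=
  fun e => if h : ∃ i, e ∈ P.free i then P.oddColours h.choose κ e else κ e

theorem eq_of_mem_edgesMeeting {j : ι} {r r' : ℕ} {e : Sym2 V}
    (hi : e ∈ edgesMeeting G (nearSet G (P.D i) r))
    (hj : e ∈ edgesMeeting G (nearSet G (P.D j) r')) (h : r + r' + 1 ≤ 100) : i = j := by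
  obtain ⟨he, x, hx, hxi⟩ := hi
  obtain ⟨-, y, hy, hyj⟩ := hj
  by_cases hxy : x = y
  · subst hxy
    exact eq_of_mem hxi hyj (by lia)
  · rw [(Sym2.mem_and_mem_iff hxy).mp ⟨hx, hy⟩] at he
    exact eq_of_near hxi hyj (Adj.toWalk he) h

theorem repaired_of_mem {e : Sym2 V} (he : e ∈ P.free i) :
    P.repaired κ e = P.oddColours i κ e := by
  have hex : ∃ i, e ∈ P.free i := ⟨i, he⟩
  have hi : hex.choose = i := eq_of_mem_edgesMeeting hex.choose_spec.1 he.1 (by lia)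
  rw [repaired, dif_pos hex, hi]

theorem repaired_of_notMem {e : Sym2 V} (he : ∀ i, e ∉ P.free i) : P.repaired κ e = κ e :=
  dif_neg (not_exists.2 he)

theorem repaired_not (κ : Sym2 V → Bool) (e : Sym2 V) :
    P.repaired (fun e => !κ e) e = !P.repaired κ e := by
  by_cases h : ∃ i, e ∈ P.free i
  · obtain ⟨i, hi⟩ := h
    rw [repaired_of_mem hi, repaired_of_mem hi, oddColours_not]
  · rw [not_exists] at h
    rw [repaired_of_notMem h, repaired_of_notMem h]

theorem repaired_of_adj {x y : V} (h : P.A.Adj x y) : P.repaired κ s(x, y) = κ s(x, y) :=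
  repaired_of_notMem fun _ hi => hi.2 h

theorem patch_oddColours_eq_repaired {e : Sym2 V} (he : e ∈ edgesMeeting G (P.region i)) :
    P.patch i κ (P.oddColours i κ) e = P.repaired κ e := by
  by_cases h : e ∈ P.free i
  · rw [patch_of_mem h, repaired_of_mem h]
  · rw [patch_of_notMem h, repaired_of_notMem]
    intro j hj
    obtain rfl := eq_of_mem_edgesMeeting he hj.1 (by lia)
    exact h hj

theorem notMem_free {x y : V} (hx : x ∉ P.zone i) (hy : y ∉ P.zone i) : s(x, y) ∉ P.free i := by
  rintro ⟨⟨-, z, hz, hzi⟩, -⟩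
  rcases Sym2.mem_iff.mp hz with rfl | rfl
  · exact hx hzi
  · exact hy hzi

theorem notMem_free_of_notMem_guard {x y : V} (hx : x ∉ P.guard) (hy : y ∉ P.guard) (i : ι) :
    s(x, y) ∉ P.free i :=
  notMem_free (fun h => hx (Set.mem_iUnion.2 ⟨i, h⟩)) fun h => hy (Set.mem_iUnion.2 ⟨i, h⟩)

theorem meets_repaired (hm : Meets G κ P.guard) : Meets G (P.repaired κ) P.guard :=
  hm.congr fun _ _ hx hy => repaired_of_notMem (notMem_free_of_notMem_guard hx hy)

theorem exists_locallyGood_patch [Finite V] (hG : IsCubic G) (hκ : BothColours G κ)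
    (hm : Meets G κ P.guard) {b : Bool}
    (hA : ∀ x y, x ∈ P.D i → P.A.Adj x y → κ s(x, y) = xor (P.a s(x, y)) b) :
    ∃ ψ, P.LocallyGood i (P.patch i κ ψ) := by
  obtain ⟨col, hcol, hboth, hcyc⟩ := hκ.exists_repair hG (P.free i) (P.region i) (by
    intro col hcol _ c u p hp hX
    have hm' : Meets G col P.guard := hm.congr fun x y hx hy =>
      hcol _ (notMem_free_of_notMem_guard hx hy i)
    obtain ⟨j, hj, hz⟩ := exists_region_of_isCycle hm' hp
    obtain rfl : i = j :=
      eq_of_mem (hX u p.start_mem_support) (hj u p.start_mem_support) (by lia)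
    exact exists_two_free (fun x y hx hxy => (hcol _ fun hf => hf.2 hxy).trans (hA x y hx hxy))
      hp hz)
  have hpatch : P.patch i κ col = col := by
    funext e
    by_cases he : e ∈ P.free i
    · exact patch_of_mem he
    · rw [patch_of_notMem he, hcol e he]
  exact ⟨col, by rw [hpatch]; exact ⟨fun v _ c => hboth v c, hcyc⟩⟩

theorem bothColours_repaired (hκ : BothColours G κ) (hgood : ∀ i, P.LocallyGood i (P.repaired κ)) :
    BothColours G (P.repaired κ) := by
  intro v c
  by_cases hv : ∃ i, v ∈ P.region i
  · obtain ⟨i, hi⟩ := hv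
    exact (hgood i).1 v hi c
  · rw [not_exists] at hv
    obtain ⟨w, hw⟩ := hκ v c
    refine ⟨w, hw.1, ?_⟩
    rw [repaired_of_notMem fun i => notMem_free (fun h => hv i (P.zone_subset_region i h)) fun h =>
      hv i (nearSet_mono (by lia) (mem_nearSet_of_adj h hw.1.symm))]
    exact hw.2

theorem repaired_spec [Finite V] (hG : IsCubic G) (hκ : BothColours G κ) (hm : Meets G κ P.guard)
    (hA : ∀ i, ∃ b, ∀ x y, x ∈ P.D i → P.A.Adj x y → κ s(x, y) = xor (P.a s(x, y)) b) :
    BothColours G (P.repaired κ) ∧ ∀ c, (colourClass G (P.repaired κ) c).IsAcyclic := by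
  have hgood : ∀ i, P.LocallyGood i (P.repaired κ) := fun i =>
    (locallyGood_patch_oddColours (exists_locallyGood_patch hG hκ hm (hA i).choose_spec)).congr
      fun _ he => patch_oddColours_eq_repaired he
  refine ⟨bothColours_repaired hκ hgood, fun c u p hp => ?_⟩
  obtain ⟨i, hi, -⟩ := exists_region_of_isCycle (meets_repaired hm) hp
  exact (hgood i).2 c u p hp hi

theorem setOf_repaired_ne_subset (P : Pieces G ι) (κ κ' : Sym2 V → Bool) :
    {e ∈ G.edgeSet | P.repaired κ e ≠ P.repaired κ' e} ⊆ {e ∈ G.edgeSet | κ e ≠ κ' e} ∪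
      ⋃ e ∈ {e ∈ G.edgeSet | κ e ≠ κ' e},
        {e' | ∃ i, e ∈ edgesMeeting G (P.region i) ∧ e' ∈ P.free i} := by
  rintro e ⟨he, hne⟩
  by_cases h : ∃ i, e ∈ P.free i
  · obtain ⟨i, hi⟩ := h
    rw [repaired_of_mem hi, repaired_of_mem hi] at hne
    obtain ⟨e', h1, h2⟩ : ∃ e' ∈ edgesMeeting G (P.region i), κ e' ≠ κ' e' := by
      by_contra! hcon
      exact hne (by rw [oddColours_congr hcon])
    exact Or.inr (Set.mem_biUnion ⟨h1.1, h2⟩ ⟨i, h1, hi⟩)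
  · rw [not_exists] at h
    rw [repaired_of_notMem h, repaired_of_notMem h] at hne
    exact Or.inl ⟨he, hne⟩

theorem ncard_repaired_ne_le [Finite V] (κ κ' : Sym2 V → Bool) {K : ℕ}
    (hK : ∀ i, (P.free i).ncard ≤ K) :
    {e ∈ G.edgeSet | P.repaired κ e ≠ P.repaired κ' e}.ncard ≤
      {e ∈ G.edgeSet | κ e ≠ κ' e}.ncard * (1 + K) := by
  refine (Set.ncard_le_ncard (P.setOf_repaired_ne_subset κ κ') (Set.toFinite _)).trans
    ((Set.ncard_union_le _ _).trans ?_)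
  rw [mul_add, mul_one]
  refine Nat.add_le_add_left (ncard_biUnion_le_mul (Set.toFinite _) _ fun e _ => ?_) _
  by_cases h : ∃ i, e ∈ edgesMeeting G (P.region i)
  · obtain ⟨i, hi⟩ := h
    refine (Set.ncard_le_ncard ?_ (Set.toFinite _)).trans (hK i)
    rintro e' ⟨j, hj, he'⟩
    obtain rfl := eq_of_mem_edgesMeeting hi hj (by lia)
    exact he'
  · have hempty : {e' | ∃ i, e ∈ edgesMeeting G (P.region i) ∧ e' ∈ P.free i} = ∅ :=
      Set.eq_empty_of_forall_notMem fun _ ⟨i, hi, _⟩ => h ⟨i, hi⟩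
    rw [hempty, Set.ncard_empty]
    exact Nat.zero_le K

end Pieces

/-! ### The random colouring -/

theorem bitColouring_not {V : Type*} (β : Sym2 V → Sym2 V) (k ω : Sym2 V → Bool) :
    bitColouring β k (fun b => !ω b) = fun e => !bitColouring β k ω e := by
  funext e
  simp [bitColouring]

theorem setOf_bitColouring_ne_subset {V : Type*} {β : Sym2 V → Sym2 V} {k ω ω' : Sym2 V → Bool}
    {b : Sym2 V} (hω : ∀ b', b' ≠ b → ω b' = ω' b') :
    {e | bitColouring β k ω e ≠ bitColouring β k ω' e} ⊆ {e | β e = b} := by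
  intro e hne
  by_contra hb
  exact hne (by simp only [bitColouring, hω _ hb])

namespace Pieces

variable {V ι : Type*} {G : SimpleGraph V} {P : Pieces G ι} {i : ι} {s : ℕ}

open Classical in
/-- The edge whose random bit decides the colour of `e`: all edges at the piece `D i` share the bit
of the edge `rep i`. -/
noncomputable def bitEdge (P : Pieces G ι) (e : Sym2 V) : Sym2 V :=
  if h : ∃ i, ∃ x ∈ e, x ∈ P.D i then P.rep h.choose else e

theorem mem_D_of_adj {x y : V} (hx : x ∈ P.D i) (hxy : P.A.Adj x y) : y ∈ P.D i := by
  obtain ⟨j, hj, hj'⟩ := P.adj_mem hxy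
  rwa [eq_of_mem_D hx hj]

theorem bitEdge_of_adj {x y : V} (hx : x ∈ P.D i) (hxy : P.A.Adj x y) :
    P.bitEdge s(x, y) = P.rep i := by
  have hex : ∃ i, ∃ z ∈ s(x, y), z ∈ P.D i := ⟨i, x, by simp, hx⟩
  have hi : hex.choose = i := by
    obtain ⟨z, hz, hzi⟩ := hex.choose_spec
    rcases Sym2.mem_iff.mp hz with rfl | rfl
    · exact eq_of_mem_D hzi hx
    · exact eq_of_mem_D hzi (mem_D_of_adj hx hxy)
  rw [bitEdge, dif_pos hex, hi]

theorem exists_adj_bitEdge_eq {v x y : V} (hx : P.A.Adj v x) (hy : P.A.Adj v y) (hxy : x ≠ y) :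
    ∃ x' y', P.A.Adj v x' ∧ P.A.Adj v y' ∧ P.a s(v, x') ≠ P.a s(v, y') ∧
      P.bitEdge s(v, x') = P.bitEdge s(v, y') := by
  obtain ⟨x', y', hx', hy', hne⟩ := P.deg v x y hx hy hxy
  obtain ⟨i, hi, -⟩ := P.adj_mem hx
  exact ⟨x', y', hx', hy', hne, by rw [bitEdge_of_adj hi hx', bitEdge_of_adj hi hy']⟩

theorem ncard_bitEdge_eq_le [Finite V] (hG : IsCubic G) (hs : ∀ i, (P.D i).ncard ≤ s)
    (b : Sym2 V) : {e ∈ P.A.edgeSet | P.bitEdge e = b}.ncard ≤ s * 3 := by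
  rcases Set.eq_empty_or_nonempty {e ∈ P.A.edgeSet | P.bitEdge e = b} with h | ⟨e, he, rfl⟩
  · rw [h, Set.ncard_empty]
    exact Nat.zero_le _
  have hrep : ∀ e ∈ P.A.edgeSet, ∃ i, P.bitEdge e = P.rep i ∧ ∃ x ∈ e, x ∈ P.D i := by
    intro e he
    induction e with
    | _ x y =>
      obtain ⟨i, hi, -⟩ := P.adj_mem (u := x) (v := y) he
      exact ⟨i, bitEdge_of_adj hi he, x, by simp, hi⟩
  obtain ⟨i, hi, -⟩ := hrep e he
  have hsub : {e' ∈ P.A.edgeSet | P.bitEdge e' = P.bitEdge e} ⊆ edgesMeeting G (P.D i) := by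
    rintro e' ⟨he', heq⟩
    obtain ⟨j, hj, hx⟩ := hrep e' he'
    obtain rfl := rep_injective (hj.symm.trans (heq.trans hi))
    exact ⟨edgeSet_mono P.le he', hx⟩
  exact (Set.ncard_le_ncard hsub (Set.toFinite _)).trans
    ((hG.ncard_edgesMeeting_le _).trans (Nat.mul_le_mul_right 3 (hs i)))

theorem ncard_free_le [Finite V] (hG : IsCubic G) (hs : (P.D i).ncard ≤ s) :
    (P.free i).ncard ≤ s * 4 ^ 2 * 3 :=
  (Set.ncard_le_ncard Set.sdiff_subset (Set.toFinite _)).trans <|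
    (hG.ncard_edgesMeeting_le _).trans <| Nat.mul_le_mul_right 3 <|
      (hG.ncard_nearSet_le _ 2).trans <| Nat.mul_le_mul_right _ hs

theorem exists_random_colouring [Finite V] (P : Pieces G ι) (hG : IsCubic G) {D : ℕ}
    (hs : ∀ i, (P.D i).ncard ≤ s) (hD : 2 ^ D * Nat.card V < 3 ^ D) :
    ∃ (χ : (Sym2 V → Bool) → Sym2 V → Bool) (B : Set (Sym2 V)),
      B.ncard ≤ Nat.card V * 3 ∧
      (∀ ω, BothColours G (χ ω) ∧ (∀ c, (colourClass G (χ ω) c).IsAcyclic) ∧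
        Meets G (χ ω) P.guard) ∧
      (∀ ω e, χ (fun b => !ω b) e = !χ ω e) ∧
      (∀ ω i x y, x ∈ P.D i → P.A.Adj x y → χ ω s(x, y) = xor (P.a s(x, y)) (ω (P.rep i))) ∧
      ∀ ω ω' b, (∀ b', b' ≠ b → ω b' = ω' b') →
        {e ∈ G.edgeSet | χ ω e ≠ χ ω' e}.ncard ≤
          (s * 3 + (2 * D + 1)) * 7 ^ 4 * (1 + s * 4 ^ 2 * 3) ∧
        (b ∉ B → {e ∈ G.edgeSet | χ ω e ≠ χ ω' e} = ∅) := by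
  obtain ⟨β, k, hβA, hβ, hχ⟩ := exists_bitColouring hG P.le P.a P.bitEdge
    (fun _ _ _ => exists_adj_bitEdge_eq) P.isGuard (ncard_bitEdge_eq_le hG hs) hD
  have hcolA : ∀ ω i x y, x ∈ P.D i → P.A.Adj x y →
      bitColouring β k ω s(x, y) = xor (P.a s(x, y)) (ω (P.rep i)) := by
    intro ω i x y hx hxy
    obtain ⟨h1, h2⟩ := hβA s(x, y) hxy
    rw [bitColouring, h1, h2, bitEdge_of_adj hx hxy]
  refine ⟨fun ω => P.repaired (bitColouring β k ω), β '' G.edgeSet, ?_, fun ω => ?_, fun ω e => ?_,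
    fun ω i x y hx hxy => ?_, fun ω ω' b hω => ?_⟩
  · refine (Set.ncard_image_le (Set.toFinite _)).trans ?_
    rw [← Set.ncard_univ]
    refine (Set.ncard_le_ncard ?_ (Set.toFinite _)).trans (hG.ncard_edgesMeeting_le Set.univ)
    exact fun e he => ⟨he, _, e.out_fst_mem, Set.mem_univ _⟩
  · obtain ⟨hboth, hacyc⟩ := repaired_spec hG (hχ ω).1 (hχ ω).2 fun i => ⟨_, hcolA ω i⟩
    exact ⟨hboth, hacyc, meets_repaired (hχ ω).2⟩
  · simp only [bitColouring_not]
    exact repaired_not _ e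
  · beta_reduce
    rw [repaired_of_adj hxy, hcolA ω i x y hx hxy]
  · have hsub := setOf_bitColouring_ne_subset (β := β) (k := k) hω
    have hle := ncard_repaired_ne_le (bitColouring β k ω) (bitColouring β k ω') fun i =>
      ncard_free_le hG (hs i)
    refine ⟨hle.trans (Nat.mul_le_mul_right _ ?_), fun hb => ?_⟩
    · exact (Set.ncard_le_ncard (fun e he => hsub he.2) (Set.toFinite _)).trans (hβ b)
    · have hempty : {e ∈ G.edgeSet | bitColouring β k ω e ≠ bitColouring β k ω' e} = ∅ :=
        Set.eq_empty_of_forall_notMem fun e he => hb ⟨e, he.1, hsub he.2⟩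
      rw [hempty, Set.ncard_empty, zero_mul, Nat.le_zero, Set.ncard_eq_zero] at hle
      exact hle

end Pieces

/-! ### Separated components -/

section Separated

variable {α β : Type*} [Finite α] (q : α → β) (conf : α → α → Prop)

theorem ncard_frequent_mul_le [Finite β] (N : ℕ) :
    {b | N ≤ {c | q c = b}.ncard}.ncard * N ≤ Nat.card α := by
  classical
  cases nonempty_fintype α
  cases nonempty_fintype β
  have hfibre : ∀ b, {c | q c = b}.ncard = (Finset.univ.filter fun c => q c = b).card := fun b => by
    rw [← Set.ncard_coe_finset]; simp
  rw [Set.ncard_eq_toFinset_card', ← smul_eq_mul, Nat.card_eq_fintype_card, ← Finset.card_univ]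
  refine (Finset.card_nsmul_le_sum _ (fun b => {c | q c = b}.ncard) N fun b hb => ?_).trans ?_
  · simpa using hb
  · simp only [hfibre]
    exact (Finset.sum_card_fiberwise_eq_card_filter Finset.univ _ q).le.trans
      (Finset.card_filter_le _ _)

variable {conf}

theorem exists_maximal_separated (hrefl : ∀ c, conf c c) (hsymm : ∀ c d, conf c d → conf d c)
    (m : ℕ) (F : Set β) :
    ∃ S : Set α, (∀ c ∈ S, q c ∈ F) ∧ (∀ c ∈ S, ∀ d ∈ S, conf c d → c = d) ∧
      (∀ b, {c ∈ S | q c = b}.ncard ≤ m) ∧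
      ∀ d, q d ∈ F → {c ∈ S | q c = q d}.ncard < m → ∃ c ∈ S, conf c d := by
  obtain ⟨S, ⟨hF, hS, hm⟩, hmax⟩ := Set.Finite.exists_maximal (s := {S : Set α |
      (∀ c ∈ S, q c ∈ F) ∧ (∀ c ∈ S, ∀ d ∈ S, conf c d → c = d) ∧
      ∀ b, {c ∈ S | q c = b}.ncard ≤ m}) (Set.toFinite _) ⟨∅, by simp⟩
  refine ⟨S, hF, hS, hm, fun d hd hlt => ?_⟩
  by_contra! hfree
  refine hfree d (hmax (y := insert d S) ⟨?_, ?_, fun b => ?_⟩ (Set.subset_insert _ _)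
    (Set.mem_insert _ _)) (hrefl d)
  · rintro c (rfl | hc)
    exacts [hd, hF c hc]
  · rintro c (rfl | hc) c' (rfl | hc') h
    · rfl
    · exact absurd (hsymm _ _ h) (hfree c' hc')
    · exact absurd h (hfree c hc)
    · exact hS c hc c' hc' h
  · by_cases hb : q d = b
    · have hsub : {c ∈ insert d S | q c = b} ⊆ insert d {c ∈ S | q c = b} := by
        rintro c ⟨rfl | hc, hq⟩
        exacts [Set.mem_insert _ _, Set.mem_insert_of_mem _ ⟨hc, hq⟩]
      have := (Set.ncard_le_ncard hsub (Set.toFinite _)).trans (Set.ncard_insert_le _ _)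
      rw [hb] at hlt
      lia
    · have hsub : {c ∈ insert d S | q c = b} ⊆ {c ∈ S | q c = b} := by
        rintro c ⟨rfl | hc, hq⟩
        exacts [absurd hq hb, ⟨hc, hq⟩]
      exact (Set.ncard_le_ncard hsub (Set.toFinite _)).trans (hm b)

theorem exists_separated [Finite β] (hrefl : ∀ c, conf c c)
    (hsymm : ∀ c d, conf c d → conf d c) {m Δ N : ℕ} (hΔ : ∀ c, {d | conf c d}.ncard ≤ Δ)
    (hN : Nat.card α * m * Δ < N * N) :
    ∃ S : Set α, (∀ c ∈ S, ∀ d ∈ S, conf c d → c = d) ∧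
      ∀ b, N ≤ {c | q c = b}.ncard → m ≤ {c ∈ S | q c = b}.ncard := by
  set F : Set β := {b | N ≤ {c | q c = b}.ncard}
  obtain ⟨S, hF, hS, hm, hmax⟩ := exists_maximal_separated q hrefl hsymm m F
  refine ⟨S, hS, fun b hb => ?_⟩
  by_contra! hlt
  have hNS : N ≤ S.ncard * Δ := by
    have hcover : {c | q c = b} ⊆ ⋃ c ∈ S, {d | conf c d} := by
      rintro d rfl
      obtain ⟨c, hc, hcd⟩ := hmax d hb hlt
      exact Set.mem_biUnion hc hcd
    exact hb.trans <| (Set.ncard_le_ncard hcover (Set.toFinite _)).trans <|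
      ncard_biUnion_le_mul (Set.toFinite S) _ fun c _ => hΔ c
  have hSF : S.ncard ≤ F.ncard * m := by
    have hcover : S ⊆ ⋃ b ∈ F, {c ∈ S | q c = b} := fun c hc =>
      Set.mem_biUnion (hF c hc) ⟨hc, rfl⟩
    exact (Set.ncard_le_ncard hcover (Set.toFinite _)).trans <|
      ncard_biUnion_le_mul (Set.toFinite F) _ fun b _ => hm b
  refine hN.not_ge ?_
  calc N * N ≤ F.ncard * m * Δ * N := by gcongr; exact hNS.trans (by gcongr)
    _ = F.ncard * N * m * Δ := by ring
    _ ≤ Nat.card α * m * Δ := by gcongr; exact ncard_frequent_mul_le q N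

end Separated

theorem exists_adj_of_nontrivial_supp {V : Type*} {F : SimpleGraph V} {c : F.ConnectedComponent}
    (hc : c.supp.Nontrivial) : ∃ u ∈ c.supp, ∃ v ∈ c.supp, F.Adj u v := by
  have : Nontrivial c := Set.nontrivial_coe_sort.mpr hc
  obtain ⟨u⟩ := c.connected_toSimpleGraph.nonempty
  obtain ⟨v, huv⟩ := c.connected_toSimpleGraph.preconnected.exists_adj_of_nontrivial u
  exact ⟨u, u.2, v, v.2, huv⟩

namespace ColouredGraph

variable {V : Type*} {A : ColouredGraph V} {c d : A.graph.ConnectedComponent}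

theorem not_red_of_blue {x y : V} (h : A.blue.Adj x y) : ¬ A.red.Adj x y :=
  fun h' => disjoint_iff_inf_le.mp A.disjoint ⟨h', h⟩

/-- Isomorphism of components as red-blue coloured graphs. -/
def compSetoid (A : ColouredGraph V) : Setoid A.graph.ConnectedComponent where
  r c d := ∃ φ : c.supp ≃ d.supp, ∀ x y : c.supp,
    (A.red.Adj x y ↔ A.red.Adj (φ x) (φ y)) ∧ (A.blue.Adj x y ↔ A.blue.Adj (φ x) (φ y))
  iseqv :=
    { refl := fun _ => ⟨Equiv.refl _, fun _ _ => ⟨Iff.rfl, Iff.rfl⟩⟩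
      symm := fun ⟨φ, h⟩ => ⟨φ.symm, fun x y => by
        simpa [iff_comm] using h (φ.symm x) (φ.symm y)⟩
      trans := fun ⟨φ, h⟩ ⟨ψ, h'⟩ => ⟨φ.trans ψ, fun x y =>
        ⟨(h x y).1.trans (h' _ _).1, (h x y).2.trans (h' _ _).2⟩⟩ }

theorem componentIso_iff {W : Type*} {H : ColouredGraph W} (h : A.ComponentIso H c) :
    A.ComponentIso H d ↔ A.compSetoid d c := by
  obtain ⟨φ, hφ⟩ := h
  constructor
  · rintro ⟨ψ, hψ⟩
    refine ⟨ψ.trans φ.symm, fun x y => ?_⟩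
    have h := hφ (φ.symm (ψ x)) (φ.symm (ψ y))
    simp only [Equiv.apply_symm_apply] at h
    exact ⟨(hψ x y).1.trans h.1.symm, (hψ x y).2.trans h.2.symm⟩
  · rintro ⟨ψ, hψ⟩
    exact ⟨ψ.trans φ, fun x y => ⟨(hψ x y).1.trans (hφ _ _).1, (hψ x y).2.trans (hφ _ _).2⟩⟩

/-- Two components of `A` that are at distance at most `100` in `G`. -/
def Close (A : ColouredGraph V) (G : SimpleGraph V) (c d : A.graph.ConnectedComponent) : Prop :=
  ∃ x ∈ c.supp, ∃ y ∈ d.supp, ∃ p : G.Walk x y, p.length ≤ 100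

theorem Close.refl (G : SimpleGraph V) (c : A.graph.ConnectedComponent) : A.Close G c c := by
  obtain ⟨x, hx⟩ := c.nonempty_supp
  exact ⟨x, hx, x, hx, Walk.nil, by simp⟩

theorem Close.symm {G : SimpleGraph V} (h : A.Close G c d) : A.Close G d c := by
  obtain ⟨x, hx, y, hy, p, hp⟩ := h
  exact ⟨y, hy, x, hx, p.reverse, by rwa [Walk.length_reverse]⟩

theorem ncard_close_le [Finite V] {G : SimpleGraph V} (hG : IsCubic G)
    (c : A.graph.ConnectedComponent) : {d | A.Close G c d}.ncard ≤ c.supp.ncard * 4 ^ 100 := by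
  have hsub : {d | A.Close G c d} ⊆ A.graph.connectedComponentMk '' nearSet G c.supp 100 := by
    rintro d ⟨x, hx, y, hy, p, hp⟩
    exact ⟨y, ⟨x, hx, p, hp⟩, hy⟩
  exact (Set.ncard_le_ncard hsub (Set.toFinite _)).trans <|
    (Set.ncard_image_le (Set.toFinite _)).trans (hG.ncard_nearSet_le c.supp 100)

end ColouredGraph

/-- The part of `C`-extendability that the colouring needs: (E1), the bound on the sizes of the
components from (E2), with an arbitrary bound `s`, and (E3). -/
structure LocallyExtendable {V : Type*} (G : SimpleGraph V) (A : ColouredGraph V) (s : ℝ) :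
    Prop where
  le : A.graph ≤ G
  degree : ∀ v, 2 ≤ (A.graph.neighborSet v).ncard →
    1 ≤ (A.red.neighborSet v).ncard ∧ 1 ≤ (A.blue.neighborSet v).ncard
  size : ∀ c : A.graph.ConnectedComponent, c.supp.Nontrivial → (c.supp.ncard : ℝ) ≤ s
  cycle : ∀ (u : V) (p : G.Walk u u), p.IsCycle →
    (¬ ∃ x y x' y', s(x, y) ∈ p.edges ∧ A.red.Adj x y ∧ s(x', y') ∈ p.edges ∧ A.blue.Adj x' y' ∧
      A.graph.Reachable x x') →
    ∃ x y z, x ≠ z ∧ s(x, y) ∈ p.edges ∧ s(y, z) ∈ p.edges ∧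
      ¬ A.graph.Adj x y ∧ ¬ A.graph.Adj y z

theorem Extendable.locallyExtendable {V : Type*} {G : SimpleGraph V} {A : ColouredGraph V}
    {s s' : ℝ} (h : Extendable G A s) (hs : s ≤ s') : LocallyExtendable G A s' :=
  ⟨h.le, h.degree, fun c hc => (h.size c hc).trans hs, h.cycle⟩

namespace LocallyExtendable

variable {V : Type*} {G : SimpleGraph V} {A : ColouredGraph V} {s : ℝ} [Finite V]

theorem exists_red_blue (hA : LocallyExtendable G A s) {v x y : V} (hx : A.graph.Adj v x)
    (hy : A.graph.Adj v y) (hxy : x ≠ y) : ∃ r b, A.red.Adj v r ∧ A.blue.Adj v b := by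
  have hdeg : 2 ≤ (A.graph.neighborSet v).ncard := by
    rw [← Set.ncard_pair hxy]
    exact Set.ncard_le_ncard (Set.pair_subset hx hy) (Set.toFinite _)
  obtain ⟨hr, hb⟩ := hA.degree v hdeg
  obtain ⟨r, hr⟩ := (Set.ncard_pos (Set.toFinite _)).mp hr
  obtain ⟨b, hb⟩ := (Set.ncard_pos (Set.toFinite _)).mp hb
  exact ⟨r, b, hr, hb⟩

open Classical in
/-- The nontrivial components in a set `S` of components of `A` pairwise at distance more than
`100`; in the template colouring `true` is red. -/
noncomputable def pieces (hA : LocallyExtendable G A s) (S : Set A.graph.ConnectedComponent)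
    (hS : ∀ c ∈ S, ∀ d ∈ S, A.Close G c d → c = d) :
    Pieces G {c // c ∈ S ∧ c.supp.Nontrivial} where
  D i := i.1.supp
  A :=
    { Adj := fun u v => A.graph.Adj u v ∧ A.graph.connectedComponentMk u ∈ S
      symm := ⟨fun _ _ h => ⟨h.1.symm, ConnectedComponent.sound h.1.reachable ▸ h.2⟩⟩
      loopless := ⟨fun _ h => h.1.ne rfl⟩ }
  a e := decide (e ∈ A.red.edgeSet)
  le := fun _ _ h => hA.le h.1
  adj_mem := fun {u v} h =>
    have hv := ConnectedComponent.mem_supp_of_adj_mem_supp _ rfl h.1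
    ⟨⟨A.graph.connectedComponentMk u, h.2, u, rfl, v, hv, h.1.ne⟩, rfl, hv⟩
  exists_adj := by
    rintro ⟨c, hc, hnt⟩
    obtain ⟨u, rfl, v, hv, huv⟩ := exists_adj_of_nontrivial_supp hnt
    exact ⟨u, v, rfl, hv, huv, hc⟩
  deg := fun v x y hx hy hxy => by
    obtain ⟨r, b, hr, hb⟩ := hA.exists_red_blue hx.1 hy.1 hxy
    exact ⟨r, b, ⟨Or.inl hr, hx.2⟩, ⟨Or.inr hb, hx.2⟩,
      by simp [hr, ColouredGraph.not_red_of_blue hb]⟩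
  sep := by
    rintro ⟨c, hc, _⟩ ⟨d, hd, _⟩ x y hx hy p hp
    exact Subtype.ext (hS c hc d hd ⟨x, hx, y, hy, p, hp⟩)
  cyc := by
    rintro ⟨c, hc, hnt⟩ u p hp hX hmono
    obtain ⟨x, y, z, hne, hxy, hyz, h, h'⟩ := hA.cycle u p hp (by
      rintro ⟨x, y, x', y', hxy, hr, hxy', hb, -⟩
      have hmem : ∀ {w}, w ∈ p.support → A.graph.connectedComponentMk w ∈ S := fun {w} hw => by
        rwa [(ConnectedComponent.mem_supp_iff _ _).mp (hX w hw)]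
      have heq := hmono _ hxy _ hxy' ⟨Or.inl hr, hmem (p.fst_mem_support_of_mem_edges hxy)⟩
        ⟨Or.inr hb, hmem (p.fst_mem_support_of_mem_edges hxy')⟩
      simp [hr, ColouredGraph.not_red_of_blue hb] at heq)
    exact ⟨x, y, z, hne, hxy, hyz, fun h₁ => h h₁.1, fun h₁ => h' h₁.1⟩

end LocallyExtendable

/-! ### Monochromatic paths and imbalances -/

section PathsInSets

variable {V : Type*} [Finite V] {F : SimpleGraph V} {S : Set V}

theorem length_lt_ncard_of_isPath {u v : V} {p : F.Walk u v} (hp : p.IsPath)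
    (h : ∀ x ∈ p.support, x ∈ S) : p.length < S.ncard := by
  classical
  have hsub : (p.support.toFinset : Set V) ⊆ S := fun x hx => h x (by simpa using hx)
  have hcard := Set.ncard_le_ncard hsub (Set.toFinite _)
  rw [Set.ncard_coe_finset, List.toFinset_card_of_nodup hp.support_nodup,
    Walk.length_support] at hcard
  lia

theorem card_mul_le_ncard_of_disjoint_paths {κ : Type*} [Fintype κ] {M : ℕ} {a b : κ → V}
    {q : ∀ i, F.Walk (a i) (b i)} (hq : ∀ i, (q i).IsPath) (hM : ∀ i, M ≤ (q i).length)
    (hdisj : ∀ i j, i ≠ j → (q i).support.Disjoint (q j).support)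
    (hS : ∀ i, ∀ x ∈ (q i).support, x ∈ S) : Fintype.card κ * M ≤ S.ncard := by
  classical
  have hsub : ((Finset.univ.biUnion fun i => (q i).support.toFinset : Finset V) : Set V) ⊆ S := by
    intro x hx
    obtain ⟨i, hi⟩ : ∃ i, x ∈ (q i).support := by simpa using hx
    exact hS i x hi
  refine le_trans ?_ (Set.ncard_le_ncard hsub (Set.toFinite _))
  rw [Set.ncard_coe_finset, Finset.card_biUnion fun i _ j _ hij =>
    List.disjoint_toFinset_iff_disjoint.mpr (hdisj i j hij), ← Finset.card_univ, ← smul_eq_mul]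
  refine Finset.card_nsmul_le_sum _ _ _ fun i _ => ?_
  rw [List.toFinset_card_of_nodup (hq i).support_nodup, Walk.length_support]
  exact (hM i).trans (Nat.le_succ _)

end PathsInSets

namespace Pieces

variable {V ι : Type*} {G : SimpleGraph V} {P : Pieces G ι} {col : Sym2 V → Bool} {R : ℕ}
  {c c' : Bool} {u v : V} {p : (colourClass G col c).Walk u v}

theorem exists_region_of_isPath (hcol : Meets G col P.guard) (hp : p.IsPath)
    (hlen : 20 ≤ p.length) : ∃ i, ∀ x ∈ p.support, x ∈ P.region i := by
  obtain ⟨i, hi, -⟩ := exists_region hcol (v := p.getVert) hlen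
    ⟨fun k hk => p.adj_getVert_succ hk, fun k hk h => by
      have := hp.getVert_injOn (show k ≤ p.length by lia) (show k + 2 ≤ p.length by lia) h
      lia⟩
  refine ⟨i, fun x hx => ?_⟩
  obtain ⟨k, rfl, hk⟩ := Walk.mem_support_iff_exists_getVert.mp hx
  exact hi k hk

theorem length_lt_of_isPath [Finite V] (hcol : Meets G col P.guard) (hR : 20 ≤ R)
    (hreg : ∀ i, (P.region i).ncard ≤ R) (hp : p.IsPath) : p.length < R := by
  rcases lt_or_ge p.length 20 with h | h
  · lia
  · obtain ⟨i, hi⟩ := exists_region_of_isPath hcol hp h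
    exact (length_lt_ncard_of_isPath hp hi).trans_le (hreg i)

theorem exists_isPathComponent [Finite V] (hG : IsCubic G) (hboth : BothColours G col)
    (hacyc : ∀ c, (colourClass G col c).IsAcyclic) (hcol : Meets G col P.guard) (hR : 20 ≤ R)
    (hreg : ∀ i, (P.region i).ncard ≤ R) (d : (colourClass G col c).ConnectedComponent) :
    ∃ t < R, IsPathComponent _ d t := by
  obtain ⟨u, v, p, hp, hsupp⟩ := (hboth.maxDegTwo hG c).exists_isPath_support_eq d
  exact ⟨p.length, length_lt_of_isPath hcol hR hreg hp,
    isPathComponent_of_isPath (hacyc c) hp hsupp⟩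

theorem exists_common_region (hcol : Meets G col P.guard) (hp : p.IsPath) {κ : Type*} [Nonempty κ]
    {a b : κ → V} {q : ∀ i, (colourClass G col c').Walk (a i) (b i)} (hq : ∀ i, (q i).IsPath)
    (hlen : ∀ i, 20 ≤ (q i).length) (hpq : ∀ i, ∃ x ∈ p.support, x ∈ (q i).support) :
    ∃ i₀, ∀ i, ∀ x ∈ (q i).support, x ∈ P.region i₀ := by
  choose r hr using fun i => exists_region_of_isPath hcol (hq i) (hlen i)
  choose x hxp hxq using hpq
  suffices ∃ i₀, ∀ i, r i = i₀ by
    obtain ⟨i₀, hi₀⟩ := this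
    exact ⟨i₀, fun i => hi₀ i ▸ hr i⟩
  rcases lt_or_ge p.length 20 with hshort | hlong
  · refine ⟨r (Classical.arbitrary κ), fun i => ?_⟩
    obtain ⟨k, hk, hkl⟩ := Walk.mem_support_iff_exists_getVert.mp (hxp i)
    obtain ⟨l, hl, hll⟩ := Walk.mem_support_iff_exists_getVert.mp (hxp (Classical.arbitrary κ))
    obtain ⟨w, hw⟩ := exists_walk_length_eq_sub_add_sub (G := G)
      (fun m hm => (p.adj_getVert_succ hm).1) hkl hll
    exact eq_of_near (hk ▸ hr _ _ (hxq _)) (hl ▸ hr _ _ (hxq _)) w (by lia)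
  · obtain ⟨i₀, hi₀⟩ := exists_region_of_isPath hcol hp hlong
    exact ⟨i₀, fun i => eq_of_mem (hr i _ (hxq i)) (hi₀ _ (hxp i)) (by lia)⟩

theorem card_mul_le_of_disjoint_paths [Finite V] (hcol : Meets G col P.guard)
    (hreg : ∀ i, (P.region i).ncard ≤ R) (hp : p.IsPath) {κ : Type*} [Fintype κ] {M : ℕ}
    (hM : 20 ≤ M) {a b : κ → V} {q : ∀ i, (colourClass G col c').Walk (a i) (b i)}
    (hq : ∀ i, (q i).IsPath) (hqM : ∀ i, M ≤ (q i).length)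
    (hpq : ∀ i, ∃ x ∈ p.support, x ∈ (q i).support)
    (hdisj : ∀ i j, i ≠ j → (q i).support.Disjoint (q j).support) : Fintype.card κ * M ≤ R := by
  rcases isEmpty_or_nonempty κ with hκ | hκ
  · simp
  obtain ⟨i₀, hi₀⟩ := exists_common_region hcol hp hq (fun i => hM.trans (hqM i)) hpq
  exact (card_mul_le_ncard_of_disjoint_paths hq hqM hdisj hi₀).trans (hreg i₀)

end Pieces

section Imbalance

variable {V : Type*} {G : SimpleGraph V}

theorem colourClass_not (col : Sym2 V → Bool) (c : Bool) :
    colourClass G (fun e => !col e) c = colourClass G col !c := by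
  ext u v
  simp [colourClass]

variable {col col' : Sym2 V → Bool}

theorem ncard_setOf_mem_sym2_le (e : Sym2 V) : {x | x ∈ e}.ncard ≤ 2 := by
  induction e with
  | _ x y =>
    have h : {z | z ∈ s(x, y)} = ({x, y} : Set V) := by ext; simp
    rw [h]
    exact (Set.ncard_insert_le _ _).trans (by simp)

theorem pathCount_colourClass_le [Finite V] {k : ℕ}
    (h : {e ∈ G.edgeSet | col e ≠ col' e}.ncard ≤ k) (c : Bool) (t : ℕ) :
    pathCount (colourClass G col c) t ≤ pathCount (colourClass G col' c) t + 2 * k := by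
  set X : Set (Sym2 V) := {e ∈ G.edgeSet | col e ≠ col' e}
  have hU : (⋃ e ∈ X, {x | x ∈ e}).ncard ≤ 2 * k := by
    refine (ncard_biUnion_le_mul X.toFinite _ fun e _ => ncard_setOf_mem_sym2_le e).trans ?_
    lia
  refine (pathCount_le_add_ncard (fun x hx y => ?_) t).trans (Nat.add_le_add_left hU _)
  have hxy : G.Adj x y → col s(x, y) = col' s(x, y) := fun hadj => by
    by_contra hne
    exact hx (Set.mem_biUnion (show s(x, y) ∈ X from ⟨hadj, hne⟩) (Sym2.mem_mk_left x y))
  exact and_congr_right fun hadj => by rw [hxy hadj]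

/-- The number of red paths of length `t` minus the number of blue ones; `true` is red. -/
noncomputable def imbalance (G : SimpleGraph V) (col : Sym2 V → Bool) (t : ℕ) : ℝ :=
  pathCount (colourClass G col true) t - pathCount (colourClass G col false) t

theorem imbalance_not (col : Sym2 V → Bool) (t : ℕ) :
    imbalance G (fun e => !col e) t = -imbalance G col t := by
  simp [imbalance, colourClass_not]

theorem abs_imbalance_sub_le [Finite V] {k : ℕ}
    (h : {e ∈ G.edgeSet | col e ≠ col' e}.ncard ≤ k) (t : ℕ) :
    |imbalance G col t - imbalance G col' t| ≤ 4 * k := by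
  have h' : {e ∈ G.edgeSet | col' e ≠ col e}.ncard ≤ k := by simpa only [ne_comm] using h
  have hle : ∀ c, |(pathCount (colourClass G col c) t : ℝ) -
      pathCount (colourClass G col' c) t| ≤ 2 * k := fun c => by
    rw [abs_sub_le_iff, sub_le_iff_le_add', sub_le_iff_le_add']
    exact ⟨mod_cast pathCount_colourClass_le h c t, mod_cast pathCount_colourClass_le h' c t⟩
  calc |imbalance G col t - imbalance G col' t|
      = |((pathCount (colourClass G col true) t : ℝ) - pathCount (colourClass G col' true) t) -
          (pathCount (colourClass G col false) t - pathCount (colourClass G col' false) t)| := by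
        rw [imbalance, imbalance]; ring_nf
    _ ≤ 2 * k + 2 * k := (abs_sub _ _).trans (add_le_add (hle true) (hle false))
    _ = 4 * k := by ring

end Imbalance

section SignSum

variable {ι B : Type*} {rep : ι → B} {S : Finset ι} {ω : B → Bool}

/-- The sum over `S` of the signs of the bits `ω (rep i)`. -/
def signSum (rep : ι → B) (S : Finset ι) (ω : B → Bool) : ℝ :=
  ∑ i ∈ S, if ω (rep i) then -1 else 1

theorem signSum_not : signSum rep S (fun b => !ω b) = -signSum rep S ω := by
  rw [signSum, signSum, ← Finset.sum_neg_distrib]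
  refine Finset.sum_congr rfl fun i _ => ?_
  cases ω (rep i) <;> simp

theorem signSum_eq :
    signSum rep S ω = 2 * ({i ∈ S | ω (rep i) = false} : Finset ι).card - S.card := by
  rw [signSum, Finset.card_filter, Finset.card_eq_sum_ones, Nat.cast_sum, Nat.cast_sum,
    Finset.mul_sum, ← Finset.sum_sub_distrib]
  refine Finset.sum_congr rfl fun i _ => ?_
  cases ω (rep i) <;> norm_num

variable [DecidableEq B]

theorem abs_signSum_flipBit_sub_le (hrep : rep.Injective) (b : B) :
    |signSum rep S (flipBit b ω) - signSum rep S ω| ≤ if b ∈ S.image rep then 2 else 0 := by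
  have hfix : ∀ i, rep i ≠ b → flipBit b ω (rep i) = ω (rep i) := fun i hi => by
    rw [flipBit_apply, if_neg hi]
  split_ifs with hb
  · obtain ⟨i, hi, rfl⟩ := Finset.mem_image.mp hb
    rw [signSum, signSum, ← Finset.sum_sub_distrib, Finset.sum_eq_single_of_mem i hi]
    · rw [flipBit_apply, if_pos rfl]
      cases ω (rep i) <;> norm_num
    · intro j _ hj
      rw [hfix j (hrep.ne hj), sub_self]
  · rw [signSum, signSum, ← Finset.sum_sub_distrib, Finset.sum_eq_zero, abs_zero]
    intro i hi
    rw [hfix i fun h => hb (h ▸ Finset.mem_image_of_mem rep hi), sub_self]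

theorem sum_half_indicator_sq [Fintype B] (L : Finset B) (x : ℝ) :
    ∑ b, ((if b ∈ L then x else 0) / 2) ^ 2 = L.card * (x / 2) ^ 2 := by
  simp only [ite_div, zero_div, ite_pow, ne_eq, OfNat.ofNat_ne_zero, not_false_eq_true, zero_pow]
  rw [Finset.sum_ite_mem, Finset.univ_inter, Finset.sum_const, nsmul_eq_mul]

theorem exists_forall_abs_le_and_le_card [Finite B] (hrep : rep.Injective) {I : Type*}
    (T : Finset I) (f : I → (B → Bool) → ℝ) (L : Finset B) {ℓ t₀ : ℝ} (ht₀ : 0 < t₀)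
    (hf : ∀ t b ω, |f t (flipBit b ω) - f t ω| ≤ if b ∈ L then ℓ else 0)
    (hodd : ∀ t ω, f t (fun b => !ω b) = -f t ω) (J : Finset (Finset ι)) {m : ℕ} (hm : 0 < m)
    (hJ : ∀ S ∈ J, m ≤ S.card)
    (hsum : T.card * (L.card * (ℓ / 2) ^ 2 / t₀ ^ 2) + J.card * (4 / m : ℝ) < 1) :
    ∃ ω, (∀ t ∈ T, |f t ω| ≤ t₀) ∧
      ∀ S ∈ J, (m / 4 : ℝ) ≤ ({i ∈ S | ω (rep i) = false} : Finset ι).card := by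
  cases nonempty_fintype B
  have hpos : ∀ S ∈ J, (0 : ℝ) < S.card := fun S hS => mod_cast hm.trans_le (hJ S hS)
  have hratio : ∀ S ∈ J, (S.card * (2 / 2) ^ 2 / (S.card / 2) ^ 2 : ℝ) ≤ 4 / m := fun S hS => by
    have hmS : (m : ℝ) ≤ S.card := mod_cast hJ S hS
    calc (S.card * (2 / 2) ^ 2 / (S.card / 2) ^ 2 : ℝ) = 4 / S.card := by
          field_simp [(hpos S hS).ne']; norm_num
      _ ≤ 4 / m := by gcongr
  suffices ∃ ω, ∀ i ∈ T.disjSum J,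
      |Sum.elim f (signSum rep) i ω| ≤ Sum.elim (fun _ => t₀) (fun S => (S.card : ℝ) / 2) i by
    obtain ⟨ω, hω⟩ := this
    refine ⟨ω, fun t ht => hω (.inl t) (Finset.inl_mem_disjSum.mpr ht), fun S hS => ?_⟩
    have hbal : |signSum rep S ω| ≤ S.card / 2 := hω (.inr S) (Finset.inr_mem_disjSum.mpr hS)
    rw [signSum_eq, abs_le] at hbal
    have hmS : (m : ℝ) ≤ S.card := mod_cast hJ S hS
    linarith [hbal.1]
  refine exists_forall_abs_le_of_odd _ _ (Sum.elim (fun _ b => if b ∈ L then ℓ else 0)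
    fun S b => if b ∈ S.image rep then 2 else 0) _ ?_ ?_ ?_ ?_
  · rintro (t | S) h
    · exact ht₀
    · exact half_pos (hpos S (Finset.inr_mem_disjSum.mp h))
  · rintro (t | S) - b ω
    · exact hf t b ω
    · exact abs_signSum_flipBit_sub_le hrep b
  · rintro (t | S) - ω
    · exact hodd t ω
    · exact signSum_not
  · rw [Finset.sum_disjSum]
    simp only [Sum.elim_inl, Sum.elim_inr, sum_half_indicator_sq,
      Finset.card_image_of_injective _ hrep, Finset.sum_const, nsmul_eq_mul]
    refine lt_of_le_of_lt (add_le_add_right ?_ _) hsum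
    rw [← nsmul_eq_mul]
    exact Finset.sum_le_card_nsmul _ _ _ hratio

end SignSum

namespace Pieces

variable {V ι : Type*} {G : SimpleGraph V}

theorem exists_colouring [Finite V] (P : Pieces G ι) (hG : IsCubic G) {s D k : ℕ}
    (hs : ∀ i, (P.D i).ncard ≤ s) (hD : 2 ^ D * Nat.card V < 3 ^ D)
    (hk : (s * 3 + (2 * D + 1)) * 7 ^ 4 * (1 + s * 4 ^ 2 * 3) ≤ k) (J : Finset (Finset ι))
    (T : Finset ℕ) {m : ℕ} (hm : 0 < m) (hJ : ∀ S ∈ J, m ≤ S.card) {t₀ : ℝ} (ht₀ : 0 < t₀)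
    (hsum : T.card * (Nat.card V * 3 * (2 * k) ^ 2 / t₀ ^ 2) + J.card * (4 / m : ℝ) < 1) :
    ∃ col : Sym2 V → Bool, BothColours G col ∧ (∀ c, (colourClass G col c).IsAcyclic) ∧
      Meets G col P.guard ∧ (∀ t ∈ T, |imbalance G col t| ≤ t₀) ∧
      ∀ S ∈ J, (m / 4 : ℝ) ≤
        {i | i ∈ S ∧ ∀ x y, x ∈ P.D i → P.A.Adj x y → col s(x, y) = P.a s(x, y)}.ncard := by
  classical
  cases nonempty_fintype V
  obtain ⟨χ, L, hL, hχ, hodd, hrep, hlip⟩ := P.exists_random_colouring hG hs hD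
  have hf : ∀ t b ω, |imbalance G (χ (flipBit b ω)) t - imbalance G (χ ω) t| ≤
      if b ∈ L.toFinset then 4 * (k : ℝ) else 0 := fun t b ω => by
    obtain ⟨hle, hempty⟩ := hlip (flipBit b ω) ω b fun b' hb' => by
      rw [flipBit_apply, if_neg hb']
    simp only [Set.mem_toFinset]
    split_ifs with hb
    · exact abs_imbalance_sub_le (hle.trans hk) t
    · simpa using abs_imbalance_sub_le (k := 0) (by simp [hempty hb]) t
  obtain ⟨ω, hbal, hmany⟩ := exists_forall_abs_le_and_le_card rep_injective T
    (fun t ω => imbalance G (χ ω) t) L.toFinset ht₀ hf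
    (fun t ω => by rw [funext (hodd ω), imbalance_not]) J hm hJ (by
      refine lt_of_le_of_lt ?_ hsum
      have hcard : (L.toFinset.card : ℝ) ≤ Nat.card V * 3 := by
        rw [← Set.ncard_eq_toFinset_card']
        exact_mod_cast hL
      rw [show (4 * k / 2 : ℝ) = 2 * k by ring]
      gcongr)
  refine ⟨χ ω, (hχ ω).1, (hχ ω).2.1, (hχ ω).2.2, hbal, fun S hS => (hmany S hS).trans ?_⟩
  rw [← Set.ncard_coe_finset, Nat.cast_le]
  refine Set.ncard_le_ncard (fun i hi => ?_) (S.finite_toSet.subset fun i hi => hi.1)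
  obtain ⟨hiS, hi⟩ := Finset.mem_filter.mp hi
  exact ⟨hiS, fun x y hx hxy => by rw [hrep ω i x y hx hxy, hi, Bool.xor_false]⟩

end Pieces

/-! ### Choice of parameters -/

section Parameters

open Filter

theorem eventually_mul_log_pow_lt_rpow (c : ℝ) (p : ℕ) {ε : ℝ} (hε : 0 < ε) :
    ∀ᶠ n : ℕ in atTop, c * Real.log n ^ p < (n : ℝ) ^ ε := by
  have hlittle := ((isLittleO_log_rpow_rpow_atTop (p : ℝ) hε).comp_tendsto
    (tendsto_natCast_atTop_atTop (R := ℝ))).def (c := (|c| + 1)⁻¹) (by positivity)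
  filter_upwards [hlittle, eventually_ge_atTop 2] with n hn h2
  have hL : 0 < Real.log n := Real.log_pos (mod_cast h2)
  have hLp : 0 < Real.log n ^ p := pow_pos hL p
  simp only [Function.comp, Real.rpow_natCast, Real.norm_eq_abs, abs_of_pos hLp,
    abs_of_nonneg (Real.rpow_nonneg (Nat.cast_nonneg n) ε)] at hn
  rw [inv_mul_eq_div, le_div_iff₀ (by positivity)] at hn
  nlinarith [le_abs_self c]

theorem exp_lt_three_halves_pow {x : ℝ} {D : ℕ} (h : 3 * x < D) :
    Real.exp x < (3 / 2 : ℝ) ^ D := by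
  have hexp : Real.exp (1 / 3) < 3 / 2 := by
    refine lt_of_pow_lt_pow_left₀ 3 (by norm_num) ?_
    rw [← Real.exp_nat_mul]
    norm_num
    linarith [Real.exp_one_lt_d9]
  calc Real.exp x < Real.exp (D * (1 / 3)) := Real.exp_lt_exp.mpr (by linarith)
    _ = Real.exp (1 / 3) ^ D := Real.exp_nat_mul _ _
    _ ≤ _ := by gcongr

theorem two_pow_mul_lt_three_pow {n D : ℕ} (hn : 0 < n) (h : 3 * Real.log n < D) :
    2 ^ D * n < 3 ^ D := by
  have hlt := exp_lt_three_halves_pow h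
  rw [Real.exp_log (mod_cast hn), div_pow, lt_div_iff₀ (by positivity), mul_comm] at hlt
  exact_mod_cast hlt

theorem eventually_mul_log_lt_sq (Q : ℕ) : ∀ᶠ n : ℕ in atTop, ∀ s m N : ℕ, s + 1 ≤ 2 * Real.log n →
    m ≤ 5 * (n : ℝ) ^ (0.9 : ℝ) → (n : ℝ) ^ (0.99 : ℝ) ≤ N → n * m * ((s + 1) * Q) < N * N := by
  filter_upwards [eventually_mul_log_pow_lt_rpow (10 * Q) 1 (ε := 0.08) (by norm_num),
    eventually_gt_atTop 0] with n hlog hn s m N hs hm hN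
  have hn₀ : (0 : ℝ) < n := mod_cast hn
  have hsq : (n : ℝ) ^ (0.99 : ℝ) * n ^ (0.99 : ℝ) = n * n ^ (0.9 : ℝ) * n ^ (0.08 : ℝ) := by
    rw [← Real.rpow_add hn₀, ← Real.rpow_one_add' hn₀.le (by norm_num), ← Real.rpow_add hn₀]
    norm_num
  have hreal : (n : ℝ) * m * ((s + 1) * Q) < N * N := by
    calc (n : ℝ) * m * ((s + 1) * Q)
        ≤ n * (5 * n ^ (0.9 : ℝ)) * (2 * Real.log n * Q) := by gcongr
      _ = n * n ^ (0.9 : ℝ) * (10 * Q * Real.log n ^ 1) := by ring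
      _ < n * n ^ (0.9 : ℝ) * n ^ (0.08 : ℝ) := by gcongr
      _ = n ^ (0.99 : ℝ) * n ^ (0.99 : ℝ) := hsq.symm
      _ ≤ N * N := by gcongr
  exact_mod_cast hreal

theorem eventually_balance_le_half (a : ℝ) : ∀ᶠ n : ℕ in atTop, ∀ k R : ℕ,
    k ≤ a * Real.log n ^ 2 → R ≤ Real.log n →
      R * (n * 3 * (2 * k) ^ 2 / ((n : ℝ) ^ (2 / 3 : ℝ)) ^ 2) ≤ 1 / 2 := by
  filter_upwards [eventually_mul_log_pow_lt_rpow (24 * a ^ 2) 5 (ε := 1 / 3) (by norm_num),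
    eventually_gt_atTop 0] with n hlog hn k R hk hR
  have hn₀ : (0 : ℝ) < n := mod_cast hn
  have hsq : ((n : ℝ) ^ (2 / 3 : ℝ)) ^ 2 = n * n ^ (1 / 3 : ℝ) := by
    rw [← Real.rpow_natCast, ← Real.rpow_mul hn₀.le, ← Real.rpow_one_add' hn₀.le (by norm_num)]
    norm_num
  rw [hsq, ← mul_div_assoc, div_le_iff₀ (by positivity)]
  calc R * (n * 3 * (2 * k) ^ 2)
      ≤ Real.log n * (n * 3 * (2 * (a * Real.log n ^ 2)) ^ 2) := by gcongr
    _ = n * (24 * a ^ 2 * Real.log n ^ 5) / 2 := by ring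
    _ ≤ n * n ^ (1 / 3 : ℝ) / 2 := by gcongr
    _ = 1 / 2 * (n * n ^ (1 / 3 : ℝ)) := by ring

theorem eventually_survival_lt_half : ∀ᶠ n : ℕ in atTop, ∀ m N j : ℕ,
    4 * (n : ℝ) ^ (0.9 : ℝ) ≤ m → (n : ℝ) ^ (0.99 : ℝ) ≤ N → j * N ≤ n →
      j * (4 / m : ℝ) < 1 / 2 := by
  filter_upwards [eventually_mul_log_pow_lt_rpow 2 0 (ε := 0.89) (by norm_num),
    eventually_gt_atTop 0] with n hlarge hn m N j hm hN hj
  have hn₀ : (0 : ℝ) < n := mod_cast hn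
  have hm₀ : (0 : ℝ) < m := lt_of_lt_of_le (by positivity) hm
  have hN₀ : (0 : ℝ) < N := lt_of_lt_of_le (by positivity) hN
  have hprod : (n : ℝ) ^ (0.9 : ℝ) * n ^ (0.99 : ℝ) = n * n ^ (0.89 : ℝ) := by
    rw [← Real.rpow_add hn₀, ← Real.rpow_one_add' hn₀.le (by norm_num)]
    norm_num
  rw [← mul_div_assoc, div_lt_iff₀ hm₀]
  refine lt_of_mul_lt_mul_right ?_ hN₀.le
  calc j * 4 * (N : ℝ) = 4 * ((j * N : ℕ) : ℝ) := by push_cast; ring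
    _ ≤ 4 * n := by gcongr
    _ < 2 * (n * n ^ (0.89 : ℝ)) := by nlinarith
    _ = 1 / 2 * (4 * n ^ (0.9 : ℝ) * n ^ (0.99 : ℝ)) := by rw [← hprod]; ring
    _ ≤ 1 / 2 * (m * N) := by gcongr
    _ = 1 / 2 * m * N := by ring

/-- The numerical conditions under which a locally extendable coloured subgraph of a cubic graph
of order `n`, with components of size at most `s`, can be extended. Here `D` is the number of rounds
in which bits are identified along the directed cycles, `k` bounds the number of edges recoloured by
flipping one random bit, `R` bounds the orders of monochromatic paths, `t₀` the imbalances, `N` is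
the number of components that makes an isomorphism class frequent and `m` is the number of its
components that are kept apart. -/
structure Admissible (n s D k m N R : ℕ) (t₀ : ℝ) : Prop where
  twenty_le : 20 ≤ R
  region_le : s * 4 ^ 22 ≤ R
  depth : 2 ^ D * n < 3 ^ D
  recolour_le : (s * 3 + (2 * D + 1)) * 7 ^ 4 * (1 + s * 4 ^ 2 * 3) ≤ k
  separate : n * m * ((s + 1) * 4 ^ 100) < N * N
  m_pos : 0 < m
  t₀_pos : 0 < t₀
  failure_lt : ∀ j : ℕ, j * N ≤ n → R * (n * 3 * (2 * k) ^ 2 / t₀ ^ 2) + j * (4 / m : ℝ) < 1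

theorem recolour_le_log_sq {s D : ℕ} {x : ℝ} (hx : 1 ≤ x) (hs : s ≤ x) (hD : D ≤ 3 * x + 1) :
    (((s * 3 + (2 * D + 1)) * 7 ^ 4 * (1 + s * 4 ^ 2 * 3) : ℕ) : ℝ) ≤
      12 * 7 ^ 4 * 49 * x ^ 2 := by
  calc (((s * 3 + (2 * D + 1)) * 7 ^ 4 * (1 + s * 4 ^ 2 * 3) : ℕ) : ℝ)
      = (s * 3 + (2 * D + 1)) * 7 ^ 4 * (1 + s * 4 ^ 2 * 3) := by push_cast; ring
    _ ≤ (12 * x) * 7 ^ 4 * (49 * x) := by gcongr <;> linarith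
    _ = 12 * 7 ^ 4 * 49 * x ^ 2 := by ring

theorem eventually_exists_admissible : ∀ᶠ n : ℕ in atTop, ∃ s D k m N R : ℕ,
    Real.log n / 4 ^ 22 < s + 1 ∧ R ≤ Real.log n ∧ N < (n : ℝ) ^ (0.99 : ℝ) + 1 ∧
      (n : ℝ) ^ (0.9 : ℝ) ≤ m / 4 ∧ Admissible n s D k m N R ((n : ℝ) ^ (2 / 3 : ℝ)) := by
  have hlog : Tendsto (fun n : ℕ => Real.log n) atTop atTop :=
    Real.tendsto_log_atTop.comp tendsto_natCast_atTop_atTop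
  filter_upwards [hlog.eventually_ge_atTop 20, eventually_gt_atTop 0,
    eventually_mul_log_lt_sq (4 ^ 100), eventually_balance_le_half (12 * 7 ^ 4 * 49),
    eventually_survival_lt_half] with n hL hn hsep hbal hsurv
  have hn₁ : (1 : ℝ) ≤ n := mod_cast hn
  have hx : 1 ≤ (n : ℝ) ^ (0.9 : ℝ) := Real.one_le_rpow hn₁ (by norm_num)
  have hm := Nat.le_ceil (4 * (n : ℝ) ^ (0.9 : ℝ))
  have hm' := Nat.ceil_lt_add_one (a := 4 * (n : ℝ) ^ (0.9 : ℝ)) (by positivity)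
  have hN := Nat.le_ceil ((n : ℝ) ^ (0.99 : ℝ))
  have hs := Nat.floor_le (a := Real.log n / 4 ^ 22) (by positivity)
  have hR := Nat.floor_le (a := Real.log n) (by positivity)
  have hD := Nat.lt_floor_add_one (3 * Real.log n)
  have hD' := Nat.floor_le (a := 3 * Real.log n) (by positivity)
  refine ⟨⌊Real.log n / 4 ^ 22⌋₊, ⌊3 * Real.log n⌋₊ + 1, _, ⌈4 * (n : ℝ) ^ (0.9 : ℝ)⌉₊,
    ⌈(n : ℝ) ^ (0.99 : ℝ)⌉₊, ⌊Real.log n⌋₊, Nat.lt_floor_add_one _, hR,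
    Nat.ceil_lt_add_one (by positivity), by linarith,
    { twenty_le := Nat.le_floor (mod_cast hL)
      region_le := Nat.le_floor ?_
      depth := two_pow_mul_lt_three_pow hn (mod_cast hD)
      recolour_le := le_rfl
      separate := hsep _ _ _ (by linarith) (by linarith) hN
      m_pos := Nat.ceil_pos.mpr (by positivity)
      t₀_pos := by positivity
      failure_lt := fun j hj => ?_ }⟩
  · rw [Nat.cast_mul]
    push_cast
    linarith
  · have hk := recolour_le_log_sq (x := Real.log n) (s := ⌊Real.log n / 4 ^ 22⌋₊)
      (D := ⌊3 * Real.log n⌋₊ + 1) (by linarith) (by linarith) (by push_cast; linarith)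
    linarith [hbal _ _ hk hR, hsurv _ _ j hm hN hj]

end Parameters

section Colouring

variable {V : Type*} {G : SimpleGraph V}

/-- The graph `G` with its edges coloured by `col`; `true` is red. -/
def colouredGraph (G : SimpleGraph V) (col : Sym2 V → Bool) : ColouredGraph V where
  red := colourClass G col true
  blue := colourClass G col false
  disjoint := by
    rw [disjoint_iff_inf_le]
    rintro u v ⟨h, h'⟩
    exact Bool.noConfusion (h.2.symm.trans h'.2)

theorem colouredGraph_graph (G : SimpleGraph V) (col : Sym2 V → Bool) :
    (colouredGraph G col).graph = G := by
  ext u v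
  refine ⟨fun h => h.elim And.left And.left, fun h => ?_⟩
  cases hc : col s(u, v)
  · exact Or.inr ⟨h, hc⟩
  · exact Or.inl ⟨h, hc⟩

namespace ColouredGraph

variable {A B : ColouredGraph V} {c d : A.graph.ConnectedComponent}

theorem nontrivial_supp_iff_of_compSetoid (h : A.compSetoid c d) :
    c.supp.Nontrivial ↔ d.supp.Nontrivial := by
  obtain ⟨φ, -⟩ := h
  rw [← Set.nontrivial_coe_sort, ← Set.nontrivial_coe_sort]
  exact φ.nontrivial_congr

theorem survives_of_not_nontrivial (hc : ¬ c.supp.Nontrivial) : A.Survives B c := by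
  intro x hx y hy
  obtain rfl := Set.not_nontrivial_iff.mp hc hx hy
  exact ⟨fun h => absurd rfl h.ne, fun h => absurd rfl h.ne⟩

theorem le_ncard_componentIso_survives [Finite V] {N : ℕ} {x : ℝ} (hx : 0 < x)
    (hsurv : ∀ c, c.supp.Nontrivial → N ≤ {d | A.compSetoid d c}.ncard →
      x ≤ {d | A.compSetoid d c ∧ A.Survives B d}.ncard)
    {W : Type*} (H : ColouredGraph W) (hN : N ≤ {d | A.ComponentIso H d}.ncard)
    (hxH : x ≤ {d | A.ComponentIso H d}.ncard) :
    x ≤ {d | A.ComponentIso H d ∧ A.Survives B d}.ncard := by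
  obtain ⟨c, hc⟩ : {d | A.ComponentIso H d}.Nonempty :=
    (Set.ncard_pos (Set.toFinite _)).mp (mod_cast hx.trans_le hxH)
  simp only [fun d => componentIso_iff (d := d) hc] at hN hxH ⊢
  by_cases hnt : c.supp.Nontrivial
  · exact hsurv c hnt hN
  · have hall : ∀ d, A.compSetoid d c → A.Survives B d := fun d hd =>
      survives_of_not_nontrivial fun h => hnt ((nontrivial_supp_iff_of_compSetoid hd).mp h)
    have hset : {d | A.compSetoid d c ∧ A.Survives B d} = {d | A.compSetoid d c} :=
      Set.ext fun d => and_iff_left_of_imp (hall d)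
    rwa [hset]

end ColouredGraph

namespace LocallyExtendable

variable {A : ColouredGraph V}

theorem of_lt_add_one {x : ℝ} {s : ℕ} (hA : LocallyExtendable G A x) (h : x < s + 1) :
    LocallyExtendable G A s where
  le := hA.le
  degree := hA.degree
  size c hc := by
    have hlt : (c.supp.ncard : ℝ) < s + 1 := (hA.size c hc).trans_lt h
    exact_mod_cast Nat.lt_succ_iff.mp (mod_cast hlt)
  cycle := hA.cycle

variable [Finite V] {x : ℝ} {S : Set A.graph.ConnectedComponent}
  {hS : ∀ c ∈ S, ∀ d ∈ S, A.Close G c d → c = d} {col : Sym2 V → Bool}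

theorem survives_of_forall_eq_template (hA : LocallyExtendable G A x)
    (i : {c // c ∈ S ∧ c.supp.Nontrivial})
    (h : ∀ x y, x ∈ (hA.pieces S hS).D i → (hA.pieces S hS).A.Adj x y →
      col s(x, y) = (hA.pieces S hS).a s(x, y)) : A.Survives (colouredGraph G col) i.1 := by
  intro x hx y _
  have hxS : A.graph.connectedComponentMk x ∈ S := by
    rw [(ConnectedComponent.mem_supp_iff _ _).mp hx]
    exact i.2.1
  refine ⟨fun hr => ⟨hA.le (Or.inl hr), (h x y hx ⟨Or.inl hr, hxS⟩).trans ?_⟩,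
    fun hb => ⟨hA.le (Or.inr hb), (h x y hx ⟨Or.inr hb, hxS⟩).trans ?_⟩⟩
  · simp [pieces, hr]
  · simp [pieces, ColouredGraph.not_red_of_blue hb]

variable {s D k m N R : ℕ} {t₀ : ℝ}

theorem exists_separated_components (hA : LocallyExtendable G A s) (hG : IsCubic G)
    (hpar : Admissible (Nat.card V) s D k m N R t₀) :
    ∃ S : Set A.graph.ConnectedComponent, (∀ c ∈ S, ∀ d ∈ S, A.Close G c d → c = d) ∧
      ∀ b, N ≤ {c | Quotient.mk A.compSetoid c = b}.ncard →
        m ≤ {c ∈ S | Quotient.mk A.compSetoid c = b}.ncard := by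
  refine exists_separated (Δ := (s + 1) * 4 ^ 100) (Quotient.mk A.compSetoid) (.refl G)
    (fun _ _ h => h.symm) (fun c => (ColouredGraph.ncard_close_le hG c).trans <|
      Nat.mul_le_mul_right _ ?_) (lt_of_le_of_lt ?_ hpar.separate)
  · by_cases hc : c.supp.Nontrivial
    · have hle : c.supp.ncard ≤ s := mod_cast hA.size c hc
      exact hle.trans (Nat.le_succ s)
    · have hle := (Set.ncard_le_one_iff_subsingleton (s := c.supp)).mpr
        (Set.not_nontrivial_iff.mp hc)
      exact hle.trans (Nat.le_add_left 1 s)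
  · gcongr
    exact Nat.card_le_card_of_surjective A.graph.connectedComponentMk Quot.mk_surjective

theorem card_image_frequent_mul_le {ι : Type*} (f : Quotient A.compSetoid → Finset ι)
    [DecidableEq (Finset ι)] {F : Finset (Quotient A.compSetoid)}
    (hF : ∀ b ∈ F, N ≤ {c | Quotient.mk A.compSetoid c = b}.ncard) :
    (F.image f).card * N ≤ Nat.card V := by
  calc (F.image f).card * N ≤ (F : Set (Quotient A.compSetoid)).ncard * N := by
        rw [Set.ncard_coe_finset]
        exact Nat.mul_le_mul_right N Finset.card_image_le
    _ ≤ {b | N ≤ {c | Quotient.mk A.compSetoid c = b}.ncard}.ncard * N :=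
        Nat.mul_le_mul_right N (Set.ncard_le_ncard hF (Set.toFinite _))
    _ ≤ Nat.card A.graph.ConnectedComponent := ncard_frequent_mul_le _ N
    _ ≤ Nat.card V :=
        Nat.card_le_card_of_surjective A.graph.connectedComponentMk Quot.mk_surjective

theorem exists_colouring_of_separated (hA : LocallyExtendable G A s) (hG : IsCubic G)
    (hpar : Admissible (Nat.card V) s D k m N R t₀)
    (hm : ∀ b, N ≤ {c | Quotient.mk A.compSetoid c = b}.ncard →
      m ≤ {c ∈ S | Quotient.mk A.compSetoid c = b}.ncard) :
    ∃ col : Sym2 V → Bool, BothColours G col ∧ (∀ c, (colourClass G col c).IsAcyclic) ∧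
      Meets G col (hA.pieces S hS).guard ∧ (∀ t < R, |imbalance G col t| ≤ t₀) ∧
      ∀ c, c.supp.Nontrivial → N ≤ {d | A.compSetoid d c}.ncard →
        (m / 4 : ℝ) ≤ {d | A.compSetoid d c ∧ A.Survives (colouredGraph G col) d}.ncard := by
  classical
  cases nonempty_fintype {c // c ∈ S ∧ c.supp.Nontrivial}
  cases nonempty_fintype (Quotient A.compSetoid)
  let F : Finset (Quotient A.compSetoid) :=
    {b | N ≤ {c | Quotient.mk A.compSetoid c = b}.ncard ∧
      ∃ c, c.supp.Nontrivial ∧ Quotient.mk A.compSetoid c = b}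
  let f (b : Quotient A.compSetoid) : Finset {c // c ∈ S ∧ c.supp.Nontrivial} :=
    {i | Quotient.mk A.compSetoid i.1 = b}
  have hf : ∀ X ∈ F.image f, m ≤ X.card := by
    simp only [Finset.mem_image, F, Finset.mem_filter_univ]
    rintro _ ⟨b, ⟨hb, c, hc, rfl⟩, rfl⟩
    refine (hm _ hb).trans ?_
    rw [← Set.ncard_coe_finset, ← Set.ncard_image_of_injective _ Subtype.val_injective]
    refine Set.ncard_le_ncard (fun d hd => ?_) (Set.toFinite _)
    have hdc := ColouredGraph.nontrivial_supp_iff_of_compSetoid (Quotient.exact hd.2)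
    exact ⟨⟨d, hd.1, hdc.mpr hc⟩, by simpa [f] using hd.2, rfl⟩
  obtain ⟨col, hboth, hacyc, hcol, hbal, hsurv⟩ := (hA.pieces S hS).exists_colouring hG
    (fun i => mod_cast hA.size i.1 i.2.2) hpar.depth hpar.recolour_le (F.image f)
    (Finset.range R) hpar.m_pos hf hpar.t₀_pos (by
      rw [Finset.card_range]
      exact hpar.failure_lt _ (card_image_frequent_mul_le f fun b hb => by
        exact ((Finset.mem_filter_univ _).mp hb).1))
  refine ⟨col, hboth, hacyc, hcol, fun t ht => hbal t (Finset.mem_range.mpr ht),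
    fun c hc hN => ?_⟩
  have hcF : f (Quotient.mk A.compSetoid c) ∈ F.image f := Finset.mem_image_of_mem f <| by
    simpa [F, Quotient.eq] using ⟨hN, c, hc, A.compSetoid.refl c⟩
  refine (hsurv _ hcF).trans ?_
  rw [Nat.cast_le, ← Set.ncard_image_of_injective _ Subtype.val_injective]
  refine Set.ncard_le_ncard ?_ (Set.toFinite _)
  rintro _ ⟨i, ⟨hi, hcol⟩, rfl⟩
  exact ⟨Quotient.exact (by simpa [f] using hi), hA.survives_of_forall_eq_template i hcol⟩

end LocallyExtendable

end Colouring

theorem pathCount_eq_zero {V : Type*} [Finite V] {F : SimpleGraph V} {R t : ℕ}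
    (h : ∀ c, ∃ t < R, IsPathComponent F c t) (ht : R ≤ t) : pathCount F t = 0 := by
  rw [pathCount, Set.ncard_eq_zero (Set.toFinite _), Set.eq_empty_iff_forall_notMem]
  intro c hc
  obtain ⟨t', ht', hc'⟩ := h c
  have hcard := (IsPathComponent.ncard_supp hc).symm.trans hc'.ncard_supp
  lia

theorem Pieces.noSpider {V ι : Type*} [Finite V] {G : SimpleGraph V} {P : Pieces G ι}
    {col : Sym2 V → Bool} {R : ℕ} (hcol : Meets G col P.guard)
    (hreg : ∀ i, (P.region i).ncard ≤ R) (c c' : Bool) (l : ℝ) {m m' : ℝ} (hm' : 20 ≤ m')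
    (hR : R < m * m') : NoSpider (colourClass G col c) (colourClass G col c') l m m' := by
  rintro ⟨u, v, p, k, a, b, q, hp, -, hk, hq, hdisj⟩
  have hM : 20 ≤ ⌈m'⌉₊ := by exact_mod_cast hm'.trans (Nat.le_ceil m')
  have hkR := Pieces.card_mul_le_of_disjoint_paths hcol hreg hp hM (fun i => (hq i).1)
    (fun i => Nat.ceil_le.mpr (hq i).2.1) (fun i => (hq i).2.2) hdisj
  rw [Fintype.card_fin] at hkR
  refine hR.not_ge ?_
  calc m * m' ≤ k * ⌈m'⌉₊ := by gcongr; exact Nat.le_ceil m'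
    _ ≤ R := mod_cast hkR

theorem LocallyExtendable.exists_colouring {V : Type*} [Finite V] {G : SimpleGraph V}
    {A : ColouredGraph V} {s D k m N R : ℕ} {t₀ : ℝ} (hA : LocallyExtendable G A s)
    (hG : IsCubic G) (hpar : Admissible (Nat.card V) s D k m N R t₀) :
    ∃ col : Sym2 V → Bool,
      (∀ c d, ∃ t < R, IsPathComponent (colourClass G col c) d t) ∧
      (∀ (c c' : Bool) (l m m' : ℝ), 20 ≤ m' → R < m * m' →
        NoSpider (colourClass G col c) (colourClass G col c') l m m') ∧
      (∀ t, |imbalance G col t| ≤ t₀) ∧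
      ∀ c, c.supp.Nontrivial → N ≤ {d | A.compSetoid d c}.ncard →
        (m / 4 : ℝ) ≤ {d | A.compSetoid d c ∧ A.Survives (colouredGraph G col) d}.ncard := by
  obtain ⟨S, hS, hm⟩ := hA.exists_separated_components hG hpar
  obtain ⟨col, hboth, hacyc, hcol, hbal, hsurv⟩ :=
    hA.exists_colouring_of_separated (hS := hS) hG hpar hm
  have hreg : ∀ i, ((hA.pieces S hS).region i).ncard ≤ R := fun i => by
    have hsize : ((hA.pieces S hS).D i).ncard ≤ s := mod_cast hA.size i.1 i.2.2
    exact (hG.ncard_nearSet_le _ _).trans <|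
      (Nat.mul_le_mul_right _ hsize).trans hpar.region_le
  have hpath : ∀ c d, ∃ t < R, IsPathComponent (colourClass G col c) d t := fun c d =>
    Pieces.exists_isPathComponent hG hboth hacyc hcol hpar.twenty_le hreg d
  refine ⟨col, hpath, fun c c' l m m' hm' hR => Pieces.noSpider hcol hreg c c' l hm' hR,
    fun t => ?_, hsurv⟩
  rcases lt_or_ge t R with ht | ht
  · exact hbal t ht
  · simpa [imbalance, pathCount_eq_zero (hpath _) ht] using hpar.t₀_pos.le

theorem lemma3p2_general :
    ∃ n₀ : ℕ, ∀ (V : Type*) [Finite V] (G : SimpleGraph V) (n : ℕ), n = Nat.card V → n₀ ≤ n →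
      IsCubic G → ∀ A : ColouredGraph V, LocallyExtendable G A (Real.log n / 4 ^ 22) →
        ∃ χ : ColouredGraph V, χ.graph = G ∧
          ((∀ c, ∃ t : ℕ, t ≤ Real.log n ∧ IsPathComponent χ.red c t) ∧
            ∀ c, ∃ t : ℕ, t ≤ Real.log n ∧ IsPathComponent χ.blue c t) ∧
          (∀ l m m' : ℝ, 20 ≤ m' → Real.log n < m * m' →
            NoSpider χ.red χ.blue l m m' ∧ NoSpider χ.blue χ.red l m m') ∧
          (∀ t, |(pathCount χ.red t : ℝ) - pathCount χ.blue t| ≤ (n : ℝ) ^ (2 / 3 : ℝ)) ∧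
          ∀ (W : Type*) (H : ColouredGraph W),
            (n : ℝ) ^ (0.99 : ℝ) ≤ {c | A.ComponentIso H c}.ncard →
            (n : ℝ) ^ (0.9 : ℝ) ≤ {c | A.ComponentIso H c ∧ A.Survives χ c}.ncard := by
  obtain ⟨n₀, hn₀⟩ := Filter.eventually_atTop.mp
    (eventually_exists_admissible.and (Filter.eventually_gt_atTop 0))
  refine ⟨n₀, fun V _ G n hn hle hG A hA => ?_⟩
  obtain ⟨⟨s, D, k, m, N, R, hs, hR, hN, hm, hpar⟩, hpos⟩ := hn₀ n hle
  subst hn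
  obtain ⟨col, hpath, hspider, hbal, hsurv⟩ := (hA.of_lt_add_one hs).exists_colouring hG hpar
  have hshort : ∀ c d, ∃ t : ℕ, t ≤ Real.log (Nat.card V) ∧
      IsPathComponent (colourClass G col c) d t := fun c d =>
    (hpath c d).imp fun t ht => ⟨le_trans (mod_cast ht.1.le) hR, ht.2⟩
  refine ⟨colouredGraph G col, colouredGraph_graph G col, ⟨hshort true, hshort false⟩,
    fun l m m' hm' hlog => ⟨hspider true false l m m' hm' (hR.trans_lt hlog),
      hspider false true l m m' hm' (hR.trans_lt hlog)⟩, hbal, fun W H hH => ?_⟩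
  refine ColouredGraph.le_ncard_componentIso_survives (N := N) (by positivity)
    (fun c hc hNc => hm.trans (hsurv c hc hNc)) H ?_ (le_trans ?_ hH)
  · exact Nat.lt_succ_iff.mp (mod_cast hN.trans_le (add_le_add_left hH 1))
  · exact Real.rpow_le_rpow_of_exponent_le (mod_cast hpos) (by norm_num)

theorem isCubic_of_isRegularOfDegree {V : Type*} [Fintype V] {G : SimpleGraph V}
    [DecidableRel G.Adj] (h : G.IsRegularOfDegree 3) : IsCubic G := fun v => by
  rw [Set.ncard_eq_toFinset_card', ← neighborFinset_def, card_neighborFinset_eq_degree, h v]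

theorem eventually_mul_sqrt_log_le (C : ℝ) :
    ∀ᶠ n : ℕ in Filter.atTop, C * √(Real.log n) ≤ Real.log n / 4 ^ 22 := by
  have hsqrt : Filter.Tendsto (fun n : ℕ => √(Real.log n)) Filter.atTop Filter.atTop :=
    Real.tendsto_sqrt_atTop.comp (Real.tendsto_log_atTop.comp tendsto_natCast_atTop_atTop)
  filter_upwards [hsqrt.eventually_ge_atTop (4 ^ 22 * C), Filter.eventually_gt_atTop 0] with n h hn
  have hlog : 0 ≤ Real.log n := Real.log_nonneg (mod_cast hn)
  rw [le_div_iff₀ (by positivity)]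
  calc C * √(Real.log n) * 4 ^ 22 = 4 ^ 22 * C * √(Real.log n) := by ring
    _ ≤ √(Real.log n) * √(Real.log n) := by gcongr
    _ = Real.log n := Real.mul_self_sqrt hlog

theorem lemma3p2 :
    ∃ K : ℝ, ∀ C : ℝ, ∃ n₀ : ℕ, ∀ (V : Type*) [Fintype V] (G : SimpleGraph V) [DecidableRel G.Adj]
      (n : ℕ), n = Fintype.card V → n₀ ≤ n → G.IsRegularOfDegree 3 →
      ∀ G₀ : ColouredGraph V, Extendable G G₀ (C * √(Real.log n)) →
        ∃ χ : ColouredGraph V, χ.graph = G ∧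
          -- monochromatic components are paths of length `O(log n)`
          ((∀ c : χ.red.ConnectedComponent,
              ∃ t : ℕ, (t : ℝ) ≤ K * Real.log n ∧ IsPathComponent χ.red c t) ∧
            (∀ c : χ.blue.ConnectedComponent,
              ∃ t : ℕ, (t : ℝ) ≤ K * Real.log n ∧ IsPathComponent χ.blue c t)) ∧
          -- no short path meets many long paths of the other colour
          (NoSpider χ.red χ.blue (Real.log n ^ (2 / 3 : ℝ))
              (100 * √(Real.log n)) (100 * √(Real.log n)) ∧
            NoSpider χ.blue χ.red (Real.log n ^ (2 / 3 : ℝ))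
              (100 * √(Real.log n)) (100 * √(Real.log n))) ∧
          -- the path counts are almost balanced
          (∀ t : ℕ, 1 ≤ t →
            |(pathCount χ.red t : ℝ) - (pathCount χ.blue t : ℝ)| ≤ (n : ℝ) ^ (2 / 3 : ℝ)) ∧
          -- many components of each frequent isomorphism type survive
          (∀ (k : ℕ) (H : ColouredGraph (Fin k)),
            (n : ℝ) ^ (0.99 : ℝ) ≤ ({c | G₀.ComponentIso H c}.ncard : ℝ) →
            (n : ℝ) ^ (0.9 : ℝ) ≤ ({c | G₀.ComponentIso H c ∧ G₀.Survives χ c}.ncard : ℝ)) := by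
  refine ⟨1, fun C => ?_⟩
  obtain ⟨n₁, hn₁⟩ := lemma3p2_general
  obtain ⟨n₀, hn₀⟩ := Filter.eventually_atTop.mp (((eventually_mul_sqrt_log_le C).and
    (Filter.eventually_ge_atTop n₁)).and (Filter.eventually_ge_atTop 3))
  refine ⟨n₀, fun V _ G _ n hn hle hreg G₀ hG₀ => ?_⟩
  obtain ⟨⟨hC, hn₁'⟩, h3⟩ := hn₀ n hle
  obtain ⟨χ, hχ, hpath, hspider, hbal, hsurv⟩ := hn₁ V G n (hn.trans Nat.card_eq_fintype_card.symm)
    hn₁' (isCubic_of_isRegularOfDegree hreg) G₀ (hG₀.locallyExtendable hC)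
  have hlog : 1 ≤ Real.log n := by
    rw [Real.le_log_iff_exp_le (by positivity)]
    have : (3 : ℝ) ≤ n := mod_cast h3
    linarith [Real.exp_one_lt_d9]
  have hsqrt : 1 ≤ √(Real.log n) := Real.one_le_sqrt.mpr hlog
  have hsq : √(Real.log n) * √(Real.log n) = Real.log n := Real.mul_self_sqrt (by linarith)
  simp only [one_mul]
  exact ⟨χ, hχ, hpath, hspider _ _ _ (by linarith) (by nlinarith), fun t _ => hbal t,
    fun k H => hsurv (Fin k) H⟩
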